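/- Let $G$ be a (type $F$)-by-(infinite cyclic) group, i.e. $G$ has a normal subgroup $N$ of type $F$ with $G/N\cong\mathbb Z$, and let $\phi\in H^1(G,\mathbb Z)=\mathrm{Hom}(G,\mathbb Z)$ be a primitive character (not a proper multiple of another character). Let $q\colon G\to G_{\mathrm{fab}}$ be the quotient map onto the maximal free abelian quotient (the abelianization modulo torsion). Here a group is of type $F$ if it has a finite classifying space, equivalently, if it is finitely presented and the trivial module $\mathbb Z$ has a finite resolution by finitely generated free $\mathbb Z$-group-ring modules. Let $D$ be a skew field, $\sigma\colon G\to \mathrm{GL}_n(D)$ a representation, and $K=\mathrm{Ore}(DG_{\mathrm{fab}})$ the Ore localization of the untwisted group ring. Let $\sigma\otimes_{\mathbb Z} q\colon G\to\mathrm{GL}_n(K)$, $g\mapsto\sigma(g)q(g)$, so that $G$ acts on the left of the right $K$-vector space $K^n$ of column vectors. For a subgroup $H\le G$, put $b_i^{\sigma\otimes q}(H)=\dim_K H_i(H;K^n)$ and $\chi^{\sigma\otimes q}(H)=\sum_i(-1)^i b_i^{\sigma\otimes q}(H)$; the latter is well-defined if all $b_i^{\sigma\otimes q}(H)$ are finite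 and almost all vanish. For a finite based free resolution $C_*$ of $\mathbb Z$ by right $\mathbb ZG$-modules such that $C_*\otimes_{\mathbb ZG}K^n$ is acyclic, choose a chain contraction $\gamma$ of $C_*\otimes_{\mathbb ZG}K^n$, and let $\rho(C_*)\in K^\times_{\mathrm{ab}}$ be the Dieudonné determinant of the matrix of $d+\gamma\colon C_{\mathrm{even}}\otimes_{\mathbb ZG} K^n\to C_{\mathrm{odd}}\otimes_{\mathbb ZG} K^n$ in the bases obtained from the preferred bases and the standard basis of $K^n$. Write $\rho(C_*)$ as the class of $b^{-1}a$ with non-zero $a,b\in DG_{\mathrm{fab}}$. With $P(\cdot)$ denoting the Newton polytope in $G_{\mathrm{fab}}\otimes\mathbb R$, the agrarian polytope is the formal difference $P(a)-P(b)$, and $\|\phi\|_\sigma$ is its $\phi$-width $w_\phi(P(a))-w_\phi(P(b))$, where $w_\phi(Q)=\sup_{z\in Q}\phi(z)-\inf_{z\in Q}\phi(z)$. Then: 1. $\|\phi\|_\sigma$ is well-defined: $G$ is of type $F$; for every finite based free resolution $C_*$ of $\mathbb Z$ over $\mathbb ZG$ the complex $C_*\otimes_{\mathbb ZG}K^n$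 is acyclic, and its torsion is defined and non-zero; and the resulting number depends on none of the choices (resolution, bases, contraction, $a$, $b$). 2. $\chi^{\sigma\otimes q}(\ker\phi)$ is well-defined. 3. $\|\phi\|_\sigma=-\chi^{\sigma\otimes q}(\ker\phi)$. -/

import Mathlib

universe u v w

noncomputable section

namespace Agrarian

open scoped Pointwise TensorProduct
open CategoryTheory

/-! ### The Ore field of fractions of the group ring of a torsion-free abelian group -/

theorem uniqueProds_of_isMulTorsionFree (H : Type*) [CommGroup H] [IsMulTorsionFree H] :
    UniqueProds H where
  uniqueMul_of_nonempty {A B} hA hB := by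
    classical
    let S : Subgroup H := Subgroup.closure ((A ∪ B : Finset H) : Set H)
    have hAS : ∀ a ∈ A, a ∈ S := fun a ha =>
      Subgroup.subset_closure (Finset.mem_coe.2 (Finset.mem_union_left _ ha))
    have hBS : ∀ b ∈ B, b ∈ S := fun b hb =>
      Subgroup.subset_closure (Finset.mem_coe.2 (Finset.mem_union_right _ hb))
    have : Group.FG S := (Group.fg_iff_subgroup_fg S).2 ⟨A ∪ B, rfl⟩
    have : Monoid.FG S := Group.fg_iff_monoid_fg.1 inferInstance
    have : IsMulTorsionFree S :=
      Function.Injective.isMulTorsionFree S.subtype S.subtype_injective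
    have hA' : (A.subtype (· ∈ S)).Nonempty := by
      obtain ⟨a, ha⟩ := hA
      exact ⟨⟨a, hAS a ha⟩, by simpa using ha⟩
    have hB' : (B.subtype (· ∈ S)).Nonempty := by
      obtain ⟨b, hb⟩ := hB
      exact ⟨⟨b, hBS b hb⟩, by simpa using hb⟩
    obtain ⟨a, ha, b, hb, hab⟩ := UniqueProds.uniqueMul_of_nonempty hA' hB'
    refine ⟨a, by simpa using ha, b, by simpa using hb, ?_⟩
    intro x y hx hy hxy
    have := @hab ⟨x, hAS x hx⟩ ⟨y, hBS y hy⟩ (by simpa using hx) (by simpa using hy)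
      (Subtype.ext hxy)
    exact ⟨congrArg Subtype.val this.1, congrArg Subtype.val this.2⟩

instance {D H : Type*} [DivisionRing D] [CommGroup H] [IsMulTorsionFree H] :
    NoZeroDivisors (MonoidAlgebra D H) :=
  haveI := uniqueProds_of_isMulTorsionFree H
  inferInstance

theorem card_pow_le_polynomial {H : Type*} [CommGroup H] [DecidableEq H] (S : Finset H) (N : ℕ) :
    (S ^ N).card ≤ (N + 1) ^ S.card := by
  have key : ∀ N : ℕ, ∀ x ∈ S ^ N, ∃ e : S → ℕ, (∀ s, e s ≤ N) ∧ x = ∏ s : S, (s : H) ^ e s := by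
    intro N
    induction N with
    | zero => intro x hx; exact ⟨fun _ => 0, fun _ => le_rfl, by simpa using hx⟩
    | succ N ih =>
      intro x hx
      rw [pow_succ, Finset.mem_mul] at hx
      obtain ⟨y, hy, s, hs, rfl⟩ := hx
      obtain ⟨e, he, rfl⟩ := ih y hy
      refine ⟨fun t => e t + if t = ⟨s, hs⟩ then 1 else 0, fun t => ?_, ?_⟩
      · have := he t
        dsimp only
        split_ifs <;> omega
      · simp only [pow_add, Finset.prod_mul_distrib]
        congr 1
        rw [Finset.prod_eq_single ⟨s, hs⟩] <;> simp +contextual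
  have hsub : S ^ N ⊆ (Finset.univ : Finset (S → Fin (N + 1))).image
      (fun e => ∏ s : S, (s : H) ^ (e s : ℕ)) := by
    intro x hx
    obtain ⟨e, he, rfl⟩ := key N x hx
    rw [Finset.mem_image]
    exact ⟨fun s => ⟨e s, Nat.lt_succ_of_le (he s)⟩, Finset.mem_univ _, rfl⟩
  refine (Finset.card_le_card hsub).trans (Finset.card_image_le.trans ?_)
  simp

theorem exists_card_pow_succ_lt {H : Type*} [CommGroup H] [DecidableEq H] (S : Finset H) :
    ∃ N : ℕ, (S ^ (N + 1)).card < 2 * (S ^ N).card := by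
  by_contra! h
  have h2 : ∀ N : ℕ, 2 ^ N ≤ (S ^ N).card := by
    intro N
    induction N with
    | zero => simp
    | succ N ih => rw [pow_succ]; have := h N; omega
  have h3 : ∀ N : ℕ, 2 ^ N ≤ (N + 1) ^ S.card := fun N => (h2 N).trans (card_pow_le_polynomial S N)
  have lim := tendsto_pow_const_div_const_pow_of_one_lt S.card (one_lt_two : (1 : ℝ) < 2)
  have := (lim.eventually_lt_const (show (0 : ℝ) < 1 / 4 by norm_num)).and
    (Filter.eventually_ge_atTop 1)
  obtain ⟨N, hN, hN1⟩ := this.exists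
  obtain ⟨M, rfl⟩ : ∃ M, N = M + 1 := ⟨N - 1, by omega⟩
  have h4 := h3 M
  have h5 : ((2 : ℝ) ^ M) ≤ ((M + 1 : ℕ) : ℝ) ^ S.card := by exact_mod_cast h4
  rw [div_lt_iff₀ (by positivity), pow_succ] at hN
  have : (0 : ℝ) < 2 ^ M := by positivity
  linarith

theorem exists_ore_pair {D H : Type*} [DivisionRing D] [CommGroup H] [IsMulTorsionFree H]
    (a s : MonoidAlgebra D H) (hs : s ≠ 0) :
    ∃ r' s' : MonoidAlgebra D H, s' ≠ 0 ∧ s' * a = r' * s := by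
  classical
  let S : Finset H := insert 1 (a.coeff.support ∪ s.coeff.support)
  obtain ⟨N, hN⟩ := exists_card_pow_succ_lt S
  let ext : ((S ^ N : Finset H) → D) →ₗ[D] MonoidAlgebra D H :=
    { toFun := fun w => ∑ x : (S ^ N : Finset H), MonoidAlgebra.single (x : H) (w x)
      map_add' := fun w w' => by simp [MonoidAlgebra.single_add, Finset.sum_add_distrib]
      map_smul' := fun c w => by simp [Finset.smul_sum] }
  have hext : ∀ w x, (ext w).coeff (x : (S ^ N : Finset H)) = w x := by
    intro w x
    simp [ext, MonoidAlgebra.coeff_sum, Finsupp.finsetSum_apply, Finsupp.single_apply]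
  have hsupp : ∀ w, (ext w).coeff.support ⊆ S ^ N := by
    intro w h hh
    by_contra hc
    refine (Finsupp.mem_support_iff.1 hh) ?_
    have e1 : (ext w).coeff h = ∑ x : (S ^ N : Finset H),
        (MonoidAlgebra.single (x : H) (w x)).coeff h := by
      simp [ext, MonoidAlgebra.coeff_sum, Finsupp.finsetSum_apply]
    rw [e1]
    refine Finset.sum_eq_zero fun x _ => ?_
    simp only [MonoidAlgebra.coeff_single, Finsupp.single_apply]
    rw [if_neg]
    rintro rfl
    exact hc x.2
  have hmul : ∀ w (b : MonoidAlgebra D H), b.coeff.support ⊆ S →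
      (ext w * b).coeff.support ⊆ S ^ (N + 1) := by
    intro w b hb
    rw [pow_succ]
    exact (MonoidAlgebra.support_coeff_mul_subset _ _).trans (Finset.mul_subset_mul (hsupp w) hb)
  let f : (((S ^ N : Finset H) → D) × ((S ^ N : Finset H) → D)) →ₗ[D]
      ((S ^ (N + 1) : Finset H) → D) :=
    { toFun := fun p h => (ext p.1 * a - ext p.2 * s).coeff (h : H)
      map_add' := fun p q => by
        funext h
        simp [add_mul]
        abel
      map_smul' := fun c p => by
        funext h
        rw [show (c • p).1 = c • p.1 from rfl, show (c • p).2 = c • p.2 from rfl, map_smul,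
          map_smul, smul_mul_assoc, smul_mul_assoc, ← smul_sub]
        rfl }
  have hker : LinearMap.ker f ≠ ⊥ := by
    apply LinearMap.ker_ne_bot_of_finrank_lt
    simp only [Module.finrank_prod, Module.finrank_fintype_fun_eq_card, Fintype.card_coe]
    omega
  obtain ⟨p, hp, hp0⟩ := (Submodule.ne_bot_iff _).1 hker
  have hzero : ext p.1 * a - ext p.2 * s = 0 := by
    ext h
    by_cases hh : h ∈ S ^ (N + 1)
    · exact congrFun (LinearMap.mem_ker.1 hp) ⟨h, hh⟩
    · have h1 : (ext p.1 * a).coeff h = 0 := Finsupp.notMem_support_iff.1 fun hc =>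
        hh (hmul p.1 a (fun x hx => Finset.mem_insert_of_mem (Finset.mem_union_left _ hx)) hc)
      have h2 : (ext p.2 * s).coeff h = 0 := Finsupp.notMem_support_iff.1 fun hc =>
        hh (hmul p.2 s (fun x hx => Finset.mem_insert_of_mem (Finset.mem_union_right _ hx)) hc)
      simp [h1, h2]
  have hinj : ∀ w, ext w = 0 → w = 0 := fun w hw => by
    funext x
    rw [← hext w x, hw]
    rfl
  refine ⟨ext p.2, ext p.1, fun h0 => ?_, sub_eq_zero.1 hzero⟩
  rw [h0, zero_mul, zero_sub, neg_eq_zero, mul_eq_zero, or_iff_left hs] at hzero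
  exact hp0 (Prod.ext (hinj _ h0) (hinj _ hzero))

/-- The non-zero elements of `DH` satisfy the left Ore condition. -/
instance monoidAlgebraOreSet {D H : Type*} [DivisionRing D] [CommGroup H]
    [IsMulTorsionFree H] :
    OreLocalization.OreSet (nonZeroDivisors (MonoidAlgebra D H)) :=
  Classical.choice <| OreLocalization.nonempty_oreSet_iff_of_noZeroDivisors.2 fun a s => by
    obtain ⟨r', s', hs', h⟩ := exists_ore_pair a (s : MonoidAlgebra D H)
      (nonZeroDivisors.coe_ne_zero s)
    exact ⟨r', ⟨s', mem_nonZeroDivisors_of_ne_zero hs'⟩, h⟩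

/-- The Ore localization `Ore(DH)` of the untwisted group ring `DH`, a skew field. -/
abbrev OreField (D H : Type*) [DivisionRing D] [CommGroup H] [IsMulTorsionFree H] : Type _ :=
  OreLocalization (nonZeroDivisors (MonoidAlgebra D H)) (MonoidAlgebra D H)

/-- The embedding of `DH` into `Ore(DH)`. -/
def toOre (D H : Type*) [DivisionRing D] [CommGroup H] [IsMulTorsionFree H] :
    MonoidAlgebra D H →+* OreField D H :=
  OreLocalization.numeratorRingHom

/-! ### The free abelianization and the rationalization of a representation -/

/-- The abelianization modulo torsion. For finitely generated `G` this is the maximal free abelian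
quotient `G_fab`. -/
abbrev FreeAb (G : Type*) [Group G] : Type _ :=
  Abelianization G ⧸ CommGroup.torsion (Abelianization G)

/-- The quotient map `q : G → G_fab`. -/
def toFreeAb (G : Type*) [Group G] : G →* FreeAb G :=
  (QuotientGroup.mk' _).comp Abelianization.of

/-- The homomorphism `G_fab → ℤ` induced by a character `φ : G → ℤ`. -/
def FreeAb.lift {G : Type*} [Group G] (φ : G →* Multiplicative ℤ) :
    FreeAb G →* Multiplicative ℤ :=
  QuotientGroup.lift _ (Abelianization.lift φ) fun x hx => by
    obtain ⟨m, hm, hx⟩ := (isOfFinOrder_iff_pow_eq_one.1 hx : ∃ m, 0 < m ∧ x ^ m = 1)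
    have h := congrArg (Abelianization.lift φ) hx
    rw [map_pow, map_one] at h
    have h' : m • Multiplicative.toAdd (Abelianization.lift φ x) = 0 := h
    exact (smul_eq_zero.1 h').resolve_left hm.ne'

/-- The representation `σ ⊗ q : G → GL_n(Ore(D G_fab))`, `g ↦ σ(g) q(g)`, with values regarded as
matrices. -/
def twist {G : Type u} [Group G] {D : Type v} [DivisionRing D] {n : ℕ}
    (σ : G →* Matrix.GeneralLinearGroup (Fin n) D) :
    G →* Matrix (Fin n) (Fin n) (OreField D (FreeAb G)) where
  toFun g := Matrix.of fun i j =>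
    toOre D (FreeAb G) (MonoidAlgebra.single (toFreeAb G g) ((σ g : Matrix (Fin n) (Fin n) D) i j))
  map_one' := by
    ext i j
    rw [map_one, map_one, Units.val_one, Matrix.of_apply, Matrix.one_apply, Matrix.one_apply]
    split_ifs
    · exact map_one _
    · rw [MonoidAlgebra.single_zero, map_zero]
  map_mul' g h := by
    ext i j
    simp only [map_mul, Units.val_mul, Matrix.of_apply, Matrix.mul_apply]
    simp only [← map_mul, MonoidAlgebra.single_mul_single, ← map_sum]
    congr 1
    exact map_sum (MonoidAlgebra.singleAddHom _) _ _

/-- The extension of `σ ⊗ q` to a ring homomorphism on `ℤG`. -/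
def twistRing {G : Type u} [Group G] {D : Type v} [DivisionRing D] {n : ℕ}
    (σ : G →* Matrix.GeneralLinearGroup (Fin n) D) :
    MonoidAlgebra ℤ G →+* Matrix (Fin n) (Fin n) (OreField D (FreeAb G)) :=
  (MonoidAlgebra.lift ℤ (Matrix (Fin n) (Fin n) (OreField D (FreeAb G))) G (twist σ)).toRingHom

/-- The augmentation `ℤG → ℤ`. -/
def augmentation (G : Type*) [Group G] : MonoidAlgebra ℤ G →+* ℤ :=
  (MonoidAlgebra.lift ℤ ℤ G 1).toRingHom

/-! ### Finite based free chain complexes and type F -/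

/-- A finite based chain complex of free right `R`-modules: `C_k = R^{rank k}` consists of column
vectors, and `d k l : C_l → C_k` is left multiplication by a matrix, zero unless `l = k + 1`. -/
structure BasedComplex (R : Type*) [Ring R] where
  rank : ℕ → ℕ
  finite : ∃ N, ∀ k, N ≤ k → rank k = 0
  d : ∀ k l, Matrix (Fin (rank k)) (Fin (rank l)) R
  shape : ∀ k l, l ≠ k + 1 → d k l = 0
  d_comp_d : ∀ j k l, d j k * d k l = 0

/-- `C` is a resolution of the trivial module `ℤ` over `ℤG`: there is an augmentation
`ε : C_0 → ℤ`, `v ↦ ∑ i, e i * aug (v i)`, making `⋯ → C_1 → C_0 → ℤ → 0` exact. -/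
def BasedComplex.IsResolution {G : Type*} [Group G] (C : BasedComplex (MonoidAlgebra ℤ G)) :
    Prop :=
  (∃ e : Fin (C.rank 0) → ℤ,
    (∀ z : ℤ, ∃ v : Fin (C.rank 0) → MonoidAlgebra ℤ G,
      ∑ i, e i * augmentation G (v i) = z) ∧
    ∀ v : Fin (C.rank 0) → MonoidAlgebra ℤ G,
      ∑ i, e i * augmentation G (v i) = 0 ↔ ∃ w, (C.d 0 1).mulVec w = v) ∧
  ∀ k, ∀ v, (C.d k (k + 1)).mulVec v = 0 ↔ ∃ w, (C.d (k + 1) (k + 2)).mulVec w = v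

/-- A group is of type F if it has a finite classifying space; equivalently, it is finitely
presented and the trivial module `ℤ` has a finite resolution by finitely generated free
`ℤG`-modules. -/
def IsTypeF (G : Type*) [Group G] : Prop :=
  Group.IsFinitelyPresented G ∧ ∃ C : BasedComplex (MonoidAlgebra ℤ G), C.IsResolution

/-- (type F)-by-(infinite cyclic) groups. -/
def IsTypeFByInfiniteCyclic (G : Type*) [Group G] : Prop :=
  ∃ (N : Subgroup G) (_ : N.Normal), IsTypeF N ∧ Nonempty (G ⧸ N ≃* Multiplicative ℤ)

/-- A character `φ ∈ H¹(G, ℤ)` is primitive if it is not a proper multiple of another character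
(so in particular `φ ≠ 0`). -/
def IsPrimitive {G : Type*} [Group G] (φ : G →* Multiplicative ℤ) : Prop :=
  ∀ (ψ : G →* Multiplicative ℤ) (k : ℤ), φ = ψ ^ k → IsUnit k

/-! ### Agrarian Betti numbers of finite based complexes -/

namespace BasedComplex

variable {R : Type*} [Ring R] {K : Type*} [DivisionRing K] {n : ℕ}

/-- The index set of the basis of `C_k ⊗_R K^n` obtained from the basis of `C_k` and the standard
basis of `K^n`. -/
abbrev Idx (C : BasedComplex R) (n k : ℕ) : Type := Fin (C.rank k) × Fin n

/-- The matrix of the differential `C_l ⊗_R K^n → C_k ⊗_R K^n`, where `R` acts on the left of `K^n`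
through `ρ`; it arises by applying `ρ` to all entries of `C.d k l`. -/
def tensorD (C : BasedComplex R) (ρ : R →+* Matrix (Fin n) (Fin n) K) (k l : ℕ) :
    Matrix (C.Idx n k) (C.Idx n l) K :=
  Matrix.comp _ _ _ _ K ((C.d k l).map ρ)

end BasedComplex

/-- Left multiplication by a matrix over `K`, as a map of right `K`-vector spaces of columns. -/
def mulVecRight {K : Type*} [DivisionRing K] {I J : Type*} [Fintype J] (A : Matrix I J K) :
    (J → K) →ₗ[Kᵐᵒᵖ] (I → K) where
  toFun := A.mulVec
  map_add' := A.mulVec_add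
  map_smul' c v := A.mulVec_smul c v

namespace BasedComplex

variable {R : Type*} [Ring R] {K : Type*} [DivisionRing K] {n : ℕ}

/-- The cycles of `C ⊗_R K^n` in degree `k`. -/
def cycles (C : BasedComplex R) (ρ : R →+* Matrix (Fin n) (Fin n) K) (k : ℕ) :
    Submodule Kᵐᵒᵖ (C.Idx n k → K) :=
  ⨅ j, LinearMap.ker (mulVecRight (C.tensorD ρ j k))

/-- The boundaries of `C ⊗_R K^n` in degree `k`. -/
def boundaries (C : BasedComplex R) (ρ : R →+* Matrix (Fin n) (Fin n) K) (k : ℕ) :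
    Submodule Kᵐᵒᵖ (C.Idx n k → K) :=
  LinearMap.range (mulVecRight (C.tensorD ρ k (k + 1)))

/-- The agrarian Betti number `dim_K H_k(C ⊗_R K^n)`. -/
def betti (C : BasedComplex R) (ρ : R →+* Matrix (Fin n) (Fin n) K) (k : ℕ) : ℕ :=
  Module.finrank Kᵐᵒᵖ (C.cycles ρ k ⧸ (C.boundaries ρ k).submoduleOf (C.cycles ρ k))

/-- All agrarian Betti numbers vanish. -/
def Acyclic (C : BasedComplex R) (ρ : R →+* Matrix (Fin n) (Fin n) K) : Prop :=
  ∀ k, C.betti ρ k = 0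

end BasedComplex

/-! ### The Dieudonné determinant -/

/-- The class of an element of `K` in `K^×_ab ⊔ {0}`. -/
def toAb {K : Type*} [DivisionRing K] (a : K) : WithZero (Abelianization Kˣ) :=
  open Classical in
  if h : a = 0 then 0 else ((Abelianization.of (Units.mk0 a h) : Abelianization Kˣ) : WithZero _)

/-- The Schur complement of the last diagonal entry. -/
def schur {K : Type*} [DivisionRing K] {m : ℕ} (A : Matrix (Fin (m + 1)) (Fin (m + 1)) K) :
    Matrix (Fin m) (Fin m) K :=
  Matrix.of fun i j => A i.castSucc j.castSucc -
    A i.castSucc (Fin.last m) * (A (Fin.last m) (Fin.last m))⁻¹ * A (Fin.last m) j.castSucc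

/-- The canonical representative of the Dieudonné determinant: it vanishes if the last row does;
otherwise, after interchanging (if necessary, with a sign) the last column and the last column in
which the last row is non-zero, it is the determinant of the Schur complement times the last
diagonal entry. -/
def detRep {K : Type*} [DivisionRing K] : ∀ {m : ℕ}, Matrix (Fin m) (Fin m) K → K
  | 0, _ => 1
  | m + 1, A =>
    open Classical in
    if h : (Finset.univ.filter fun j => A (Fin.last m) j ≠ 0).Nonempty then
      let j := (Finset.univ.filter fun j => A (Fin.last m) j ≠ 0).max' h
      let B := A.submatrix id (Equiv.swap j (Fin.last m))
      (if j = Fin.last m then 1 else -1) * (detRep (schur B) * B (Fin.last m) (Fin.last m))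
    else 0

/-- The Dieudonné determinant, with values in `K^×_ab ⊔ {0}`. -/
def dieudonneDet {K : Type*} [DivisionRing K] {m : ℕ} (A : Matrix (Fin m) (Fin m) K) :
    WithZero (Abelianization Kˣ) :=
  toAb (detRep A)

/-! ### Agrarian torsion -/

namespace BasedComplex

variable {R : Type*} [Ring R] {K : Type*} [DivisionRing K] {n : ℕ}

/-- `γ k l : C_l ⊗ K^n → C_k ⊗ K^n` (zero unless `k = l + 1`) form a chain contraction. -/
structure IsContraction (C : BasedComplex R) (ρ : R →+* Matrix (Fin n) (Fin n) K)
    (γ : ∀ k l, Matrix (C.Idx n k) (C.Idx n l) K) : Prop where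
  shape : ∀ k l, k ≠ l + 1 → γ k l = 0
  zero : C.tensorD ρ 0 1 * γ 1 0 = 1
  succ : ∀ k, C.tensorD ρ (k + 1) (k + 2) * γ (k + 2) (k + 1) +
    γ (k + 1) k * C.tensorD ρ k (k + 1) = 1

/-- The basis of `C_even ⊗_R K^n`. -/
abbrev EvenIdx (C : BasedComplex R) (n : ℕ) : Type := {x : Σ k, C.Idx n k // Even x.1}

/-- The basis of `C_odd ⊗_R K^n`. -/
abbrev OddIdx (C : BasedComplex R) (n : ℕ) : Type := {x : Σ k, C.Idx n k // Odd x.1}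

/-- The matrix of `d + γ : C_even ⊗_R K^n → C_odd ⊗_R K^n`. -/
def torsionMatrix (C : BasedComplex R) (ρ : R →+* Matrix (Fin n) (Fin n) K)
    (γ : ∀ k l, Matrix (C.Idx n k) (C.Idx n l) K) : Matrix (C.OddIdx n) (C.EvenIdx n) K :=
  Matrix.of fun x y => (C.tensorD ρ x.1.1 y.1.1 + γ x.1.1 y.1.1) x.1.2 y.1.2

/-- `τ ∈ K^×_ab ⊔ {0}` is the agrarian torsion of `C`, computed with some chain contraction and some
orderings of the preferred bases. -/
def IsTorsion (C : BasedComplex R) (ρ : R →+* Matrix (Fin n) (Fin n) K)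
    (τ : WithZero (Abelianization Kˣ)) : Prop :=
  ∃ γ, C.IsContraction ρ γ ∧ ∃ (m : ℕ) (o : Fin m ≃ C.OddIdx n) (e : Fin m ≃ C.EvenIdx n),
    τ = dieudonneDet ((C.torsionMatrix ρ γ).submatrix o e)

end BasedComplex

/-! ### The polytope group and the polytope homomorphism -/

/-- The vector space `H_1(H; ℝ) = ℝ ⊗ H`. -/
abbrev RealSpan (H : Type*) [CommGroup H] : Type _ := ℝ ⊗[ℤ] Additive H

/-- The map `H → ℝ ⊗ H`. -/
def latticePoint {H : Type*} [CommGroup H] (h : H) : RealSpan H := (1 : ℝ) ⊗ₜ[ℤ] Additive.ofMul h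

/-- The monoid of non-empty integral polytopes under Minkowski sum. -/
def integralPolytopes (H : Type*) [CommGroup H] : AddSubmonoid (Set (RealSpan H)) where
  carrier := {P | ∃ F : Finset H, F.Nonempty ∧ P = convexHull ℝ (latticePoint '' (F : Set H))}
  zero_mem' := ⟨{1}, Finset.singleton_nonempty _, by
    rw [Finset.coe_singleton, Set.image_singleton, convexHull_singleton, latticePoint, ofMul_one,
      TensorProduct.tmul_zero]
    rfl⟩
  add_mem' := by
    classical
    rintro _ _ ⟨F, hF, rfl⟩ ⟨F', hF', rfl⟩
    refine ⟨F * F', hF.mul hF', ?_⟩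
    rw [← convexHull_add, Finset.coe_mul]
    congr 1
    ext x
    simp only [Set.mem_add, Set.mem_image, Set.mem_mul]
    constructor
    · rintro ⟨_, ⟨a, ha, rfl⟩, _, ⟨b, hb, rfl⟩, rfl⟩
      exact ⟨a * b, ⟨a, ha, b, hb, rfl⟩, by
        rw [latticePoint, ofMul_mul, TensorProduct.tmul_add]; rfl⟩
    · rintro ⟨_, ⟨a, ha, b, hb, rfl⟩, rfl⟩
      exact ⟨_, ⟨a, ha, rfl⟩, _, ⟨b, hb, rfl⟩, by
        rw [latticePoint, latticePoint, latticePoint, ofMul_mul, TensorProduct.tmul_add]⟩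

/-- The polytope group `𝒫(H)` of formal differences of integral polytopes. -/
abbrev PolytopeGroup (H : Type*) [CommGroup H] : Type _ :=
  Algebra.GrothendieckAddGroup (integralPolytopes H)

/-- The Newton polytope of a non-zero element of `DH`. -/
def newtonPolytope {D H : Type*} [DivisionRing D] [CommGroup H] (p : MonoidAlgebra D H)
    (hp : p ≠ 0) : integralPolytopes H :=
  ⟨convexHull ℝ (latticePoint '' (p.coeff.support : Set H)), p.coeff.support,
    Finsupp.support_nonempty_iff.2 (by simpa using hp), rfl⟩

/-- `P` is the value `P(p) - P(q)` of the polytope homomorphism at the class `τ` of `q⁻¹ p`. -/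
def IsPolytope {D H : Type*} [DivisionRing D] [CommGroup H] [IsMulTorsionFree H]
    (τ : WithZero (Abelianization (OreField D H)ˣ)) (P : PolytopeGroup H) : Prop :=
  ∃ (p q : MonoidAlgebra D H) (hp : p ≠ 0) (hq : q ≠ 0),
    τ = toAb ((toOre D H q)⁻¹ * toOre D H p) ∧
    P = Algebra.GrothendieckAddGroup.of (newtonPolytope p hp) -
      Algebra.GrothendieckAddGroup.of (newtonPolytope q hq)

/-- The real linear functional `ℝ ⊗ H → ℝ` extending `φ : H → ℤ`. -/
def realExtension {H : Type*} [CommGroup H] (φ : H →* Multiplicative ℤ) : RealSpan H →ₗ[ℝ] ℝ :=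
  LinearMap.liftBaseChange ℝ
    ((Int.castAddHom ℝ).comp (MonoidHom.toAdditiveLeft φ)).toIntLinearMap

theorem isBounded_image_integralPolytope {H : Type*} [CommGroup H] (f : RealSpan H →ₗ[ℝ] ℝ)
    (P : integralPolytopes H) : Bornology.IsBounded (f '' (P : Set (RealSpan H))) := by
  obtain ⟨F, -, hF⟩ := P.2
  rw [hF, LinearMap.image_convexHull, isBounded_convexHull]
  exact ((F.finite_toSet.image _).image _).isBounded

theorem nonempty_image_integralPolytope {H : Type*} [CommGroup H] (f : RealSpan H →ₗ[ℝ] ℝ)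
    (P : integralPolytopes H) : (f '' (P : Set (RealSpan H))).Nonempty := by
  obtain ⟨F, hF0, hF⟩ := P.2
  rw [hF]
  exact (convexHull_nonempty_iff.2 ((Finset.coe_nonempty.2 hF0).image _)).image _

/-- The width `P ↦ sup_{z ∈ P} f(z) - inf_{z ∈ P} f(z)`, which is additive on polytopes. -/
def polytopeWidth {H : Type*} [CommGroup H] (f : RealSpan H →ₗ[ℝ] ℝ) :
    integralPolytopes H →+ ℝ where
  toFun P := sSup (f '' (P : Set (RealSpan H))) - sInf (f '' (P : Set (RealSpan H)))
  map_zero' := by simp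
  map_add' P Q := by
    rw [AddSubmonoid.coe_add, Set.image_add,
      csSup_add (nonempty_image_integralPolytope f P)
        (isBounded_image_integralPolytope f P).bddAbove
        (nonempty_image_integralPolytope f Q) (isBounded_image_integralPolytope f Q).bddAbove,
      csInf_add (nonempty_image_integralPolytope f P)
        (isBounded_image_integralPolytope f P).bddBelow
        (nonempty_image_integralPolytope f Q) (isBounded_image_integralPolytope f Q).bddBelow]
    ring

/-- The width of a formal difference of polytopes with respect to a character `φ` of `H`. -/
def width {H : Type*} [CommGroup H] (φ : H →* Multiplicative ℤ) : PolytopeGroup H →+ ℝ :=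
  Algebra.GrothendieckAddGroup.lift (polytopeWidth (realExtension φ))

/-! ### The agrarian norm -/

section Norm

variable {G : Type u} [Group G] {D : Type v} [DivisionRing D] {n : ℕ}

/-- `x` is the value `‖φ‖_{σ,C}` of the agrarian norm: the `φ`-width of the agrarian polytope
`P(ρ_{σ⊗q}(C))`. -/
def IsAgrarianNormOf (σ : G →* Matrix.GeneralLinearGroup (Fin n) D)
    (C : BasedComplex (MonoidAlgebra ℤ G)) (φ : G →* Multiplicative ℤ) (x : ℝ) : Prop :=
  ∃ τ P, C.IsTorsion (twistRing σ) τ ∧ IsPolytope τ P ∧ x = width (FreeAb.lift φ) P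

/-- `x` is the value `‖φ‖_σ`, computed with some finite based free resolution of `ℤ` over `ℤG`
(and some choice of chain contraction, of orderings of bases and of representatives). -/
def IsAgrarianNorm (σ : G →* Matrix.GeneralLinearGroup (Fin n) D)
    (φ : G →* Multiplicative ℤ) (x : ℝ) : Prop :=
  ∃ C : BasedComplex (MonoidAlgebra ℤ G), C.IsResolution ∧ IsAgrarianNormOf σ C φ x

/-- The agrarian norm `‖φ‖_σ` is well-defined: `G` is of type F, every finite based free resolution
of `ℤ` over `ℤG` is `(σ ⊗ q)`-acyclic and has an agrarian torsion, every value of the torsion has a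
polytope, and the number obtained does not depend on any choice. -/
def AgrarianNormDefined (σ : G →* Matrix.GeneralLinearGroup (Fin n) D)
    (φ : G →* Multiplicative ℤ) : Prop :=
  IsTypeF G ∧
  (∀ C : BasedComplex (MonoidAlgebra ℤ G), C.IsResolution →
    C.Acyclic (twistRing σ) ∧ (∃ τ, C.IsTorsion (twistRing σ) τ) ∧
    ∀ τ, C.IsTorsion (twistRing σ) τ → ∃ P, IsPolytope τ P) ∧
  ∃! x, IsAgrarianNorm σ φ x

/-- The agrarian norm `‖φ‖_σ`, meaningful when it is well-defined. -/
def agrarianNorm (σ : G →* Matrix.GeneralLinearGroup (Fin n) D)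
    (φ : G →* Multiplicative ℤ) : ℝ :=
  Classical.epsilon (IsAgrarianNorm σ φ)

end Norm

/-! ### Homology of groups with coefficients in `K^n` and the agrarian Euler characteristic -/

section Homology

variable {R : Type u} [Ring R] {K : Type w} [DivisionRing K] {n : ℕ}

/-- The relations `ρ(r) x ⊗ m = x ⊗ m r` defining `M ⊗_R K^n` as a quotient of `K^n ⊗_ℤ M`. -/
def balanced (ρ : R →+* Matrix (Fin n) (Fin n) K) (M : Type u) [AddCommGroup M] [Module Rᵐᵒᵖ M] :
    Submodule Kᵐᵒᵖ ((Fin n → K) ⊗[ℤ] M) :=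
  Submodule.span Kᵐᵒᵖ {z | ∃ (r : R) (x : Fin n → K) (m : M),
    z = (ρ r).mulVec x ⊗ₜ[ℤ] m - x ⊗ₜ[ℤ] (MulOpposite.op r • m)}

/-- The right `K`-vector space `M ⊗_R K^n` for a right `R`-module `M`, where `R` acts on the left of
the columns `K^n` through `ρ`. The factors are written in the opposite order. -/
abbrev TensorObj (ρ : R →+* Matrix (Fin n) (Fin n) K) (M : Type u) [AddCommGroup M]
    [Module Rᵐᵒᵖ M] : Type (max u w) :=
  ((Fin n → K) ⊗[ℤ] M) ⧸ balanced ρ M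

/-- Functoriality of `M ⊗_R K^n` in `M`. -/
def tensorMap (ρ : R →+* Matrix (Fin n) (Fin n) K) {M N : Type u} [AddCommGroup M]
    [Module Rᵐᵒᵖ M] [AddCommGroup N] [Module Rᵐᵒᵖ N] (f : M →ₗ[Rᵐᵒᵖ] N) :
    TensorObj ρ M →ₗ[Kᵐᵒᵖ] TensorObj ρ N :=
  Submodule.mapQ _ _
    (TensorProduct.AlgebraTensorModule.map (LinearMap.id : (Fin n → K) →ₗ[Kᵐᵒᵖ] (Fin n → K))
      f.toAddMonoidHom.toIntLinearMap) <| by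
    rw [balanced, Submodule.span_le]
    rintro _ ⟨r, x, m, rfl⟩
    refine Submodule.subset_span ⟨r, x, f m, ?_⟩
    simp

theorem tensorMap_ext {ρ : R →+* Matrix (Fin n) (Fin n) K} {M N : Type u} [AddCommGroup M]
    [Module Rᵐᵒᵖ M] [AddCommGroup N] [Module Rᵐᵒᵖ N] {f g : TensorObj ρ M →ₗ[Kᵐᵒᵖ] TensorObj ρ N}
    (h : ∀ (x : Fin n → K) (m : M), f (Submodule.Quotient.mk (x ⊗ₜ[ℤ] m)) =
      g (Submodule.Quotient.mk (x ⊗ₜ[ℤ] m))) : f = g := by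
  refine LinearMap.ext fun z => ?_
  obtain ⟨z, rfl⟩ := Submodule.Quotient.mk_surjective _ z
  induction z with
  | zero => rw [Submodule.Quotient.mk_zero, map_zero, map_zero]
  | add x y hx hy => rw [Submodule.Quotient.mk_add, map_add, map_add, hx, hy]
  | tmul x m => exact h x m

theorem tensorMap_add (ρ : R →+* Matrix (Fin n) (Fin n) K) {M N : Type u} [AddCommGroup M]
    [Module Rᵐᵒᵖ M] [AddCommGroup N] [Module Rᵐᵒᵖ N] (f g : M →ₗ[Rᵐᵒᵖ] N) :
    tensorMap ρ (f + g) = tensorMap ρ f + tensorMap ρ g :=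
  tensorMap_ext fun x m => congrArg Submodule.Quotient.mk (TensorProduct.tmul_add x (f m) (g m))

/-- The functor `M ↦ M ⊗_R K^n`. -/
def tensorFunctor (ρ : R →+* Matrix (Fin n) (Fin n) K) :
    ModuleCat.{u} Rᵐᵒᵖ ⥤ ModuleCat.{max u w} Kᵐᵒᵖ where
  obj M := ModuleCat.of Kᵐᵒᵖ (TensorObj ρ M)
  map f := ModuleCat.ofHom (tensorMap ρ f.hom)
  map_id _ := ModuleCat.hom_ext (tensorMap_ext fun _ _ => rfl)
  map_comp _ _ := ModuleCat.hom_ext (tensorMap_ext fun _ _ => rfl)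

instance (ρ : R →+* Matrix (Fin n) (Fin n) K) : (tensorFunctor.{u, w} ρ).Additive where
  map_add {_ _ f g} := ModuleCat.hom_ext (tensorMap_add ρ f.hom g.hom)

end Homology

section Euler

variable {H : Type u} [Group H] {K : Type w} [DivisionRing K] {n : ℕ}

/-- The trivial right `ℤH`-module `ℤ`. -/
def trivialModule (H : Type u) [Group H] : ModuleCat.{u} (MonoidAlgebra ℤ H)ᵐᵒᵖ :=
  (ModuleCat.restrictScalars
    ((augmentation H).fromOpposite fun _ _ => mul_comm _ _)).obj (ModuleCat.of ℤ (ULift.{u} ℤ))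

/-- The homology `H_i(H; K^n) = Tor_i^{ℤH}(ℤ, K^n)`, that is, the homology of `P ⊗_{ℤH} K^n` for a
projective resolution `P` of `ℤ` by right `ℤH`-modules, as a right `K`-vector space. -/
def groupHomologySpace (ρ : MonoidAlgebra ℤ H →+* Matrix (Fin n) (Fin n) K) (i : ℕ) :
    ModuleCat.{max u w} Kᵐᵒᵖ :=
  ((tensorFunctor.{u, w} ρ).leftDerived i).obj (trivialModule H)

/-- The agrarian Betti number `b_i(H) = dim_K H_i(H; K^n)`. -/
def groupBetti (ρ : MonoidAlgebra ℤ H →+* Matrix (Fin n) (Fin n) K) (i : ℕ) : ℕ :=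
  Module.finrank Kᵐᵒᵖ (groupHomologySpace.{u, w} ρ i)

/-- The agrarian Euler characteristic is well-defined: all Betti numbers are finite and only
finitely many are non-zero. -/
def EulerCharDefined (ρ : MonoidAlgebra ℤ H →+* Matrix (Fin n) (Fin n) K) : Prop :=
  (∀ i, Module.Finite Kᵐᵒᵖ (groupHomologySpace.{u, w} ρ i)) ∧
    {i | groupBetti.{u, w} ρ i ≠ 0}.Finite

/-- The agrarian Euler characteristic `∑ (-1)^i b_i(H)`. -/
def eulerChar (ρ : MonoidAlgebra ℤ H →+* Matrix (Fin n) (Fin n) K) : ℤ :=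
  ∑ᶠ i : ℕ, (-1) ^ i * (groupBetti.{u, w} ρ i : ℤ)

end Euler

/-- The restriction of `σ ⊗ q` to the group ring of a subgroup `H` of `G`. -/
def twistRestrict {G : Type u} [Group G] {D : Type v} [DivisionRing D] {n : ℕ}
    (σ : G →* Matrix.GeneralLinearGroup (Fin n) D) (H : Subgroup G) :
    MonoidAlgebra ℤ H →+* Matrix (Fin n) (Fin n) (OreField D (FreeAb G)) :=
  (twistRing σ).comp (MonoidAlgebra.mapDomainRingHom ℤ H.subtype)

end Agrarian

end

/-!
Write `K = Ore(D G_fab)` and `ρ = σ ⊗ q`. A character `χ` of `G` deforms the coefficients: with a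
central variable `u`, the representation `g ↦ ρ(g) u^{χ(g)}` is defined over `K[u, u⁻¹]`, hence over
its skew field of fractions `F`, and it arises from `ρ` through an embedding `K → F` (`deform`). The
Laurent polynomials form a lattice `Λ` in `F`: multiplication by a non-zero element of `F` carries
`Λ` to a commensurable right `K`-subspace. Two quantities are read off from `Λ`.

* The homology of `ker χ` with coefficients in `K^n` is the homology of the lattice of columns with
  entries in `Λ`, for any based resolution over `ℤG` and any surjective `χ`, because
  `(ℤG)^J ⊗_{ℤ ker χ} K^n` is the space of Laurent columns (`nonempty_groupHomologySpace_equiv`).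
* The `χ`-width of the Newton polytope of `p ∈ DG_fab` is the codimension of the multiples of a
  Laurent polynomial in `K[u, u⁻¹]`. Hence the width attached to `x ∈ K^×` is the index
  `[Λ : xΛ]` of its image in `F` (`width_of_isPolytope`), which is a homomorphism on `F^×`.

The index of the image of `Λ^m` under an invertible matrix is the index of `Λ` under multiplication
by its Dieudonné determinant (`IsLattice.relIndex_eq_weight_detRep`). So the width of the agrarian
polytope is the index of the lattice in the odd part of the complex relative to its image under
`d + γ` from the even part. Up to a unipotent factor, `d + γ` is the involution `d + γ d γ`, which
interchanges the parts of the lattice `B ⊕ γ B`, where `B` denotes the boundaries of the lattice.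
The index of `B ⊕ γ B` in the lattice in a fixed degree is the dimension of the homology of the
lattice there, so the width is minus the Euler characteristic of `ker χ`
(`BasedComplex.weight_detRep_torsionMatrix`). As the Euler characteristic involves no choices, this
also shows that the width does not depend on any.

Acyclicity uses the same lattice for a character `ψ` whose kernel is of type F. There the homology
of the lattice is finite-dimensional, whereas the multiples of a cycle over `F` which is not a
boundary would span an infinite-dimensional space of classes. So the complex is exact over `F`
(`exists_mulVec_eq_of_almostLE`), and exactness descends to `K` (`exists_mulVec_eq_of_map`). Generalized inverses then give a contraction, which in
turn makes the homology of `ker φ` finite-dimensional for every primitive `φ`.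

Finally `G` is of type F: it is presented by the kernel of `ψ`, a lift `t` of a generator of `ℤ`, and
the conjugation relations (`isFinitelyPresented_of_ker`), and the trivial module is resolved by the
mapping cone of `1 - f`, where `f` is a lift of the multiplication by `u` on `ℤ[u, u⁻¹]` to the
resolution induced from the kernel (`exists_isResolution_of_ker`).
-/

noncomputable section

namespace Agrarian

open scoped Pointwise TensorProduct
open CategoryTheory

/-! ### Relative indices of commensurable subspaces -/

section RelIndex

variable {k V W : Type*} [DivisionRing k] [AddCommGroup V] [Module k V] [AddCommGroup W]
  [Module k W]

/-- `X` is contained in `Y` up to finite dimension: the image of `X` in `V ⧸ Y` is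
finite-dimensional. -/
def AlmostLE (X Y : Submodule k V) : Prop := Module.Finite k (X.map Y.mkQ)

/-- The dimension of `(X + Y) / Y`. -/
def codim (X Y : Submodule k V) : ℕ := Module.finrank k (X.map Y.mkQ)

/-- The relative index `[X : Y] = dim X/(X ∩ Y) - dim Y/(X ∩ Y)`. -/
def relIndex (X Y : Submodule k V) : ℤ := codim X Y - codim Y X

theorem map_mkQ_inf_ker_mapQ (X Z : Submodule k V) (Y : Submodule k W) (f : V →ₗ[k] W)
    (h : Z ≤ Y.comap f) :
    X.map Z.mkQ ⊓ LinearMap.ker (Z.mapQ Y f h) = (X ⊓ Y.comap f).map Z.mkQ := by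
  ext v
  simp only [Submodule.mem_inf, Submodule.mem_map, LinearMap.mem_ker]
  constructor
  · rintro ⟨⟨x, hx, rfl⟩, hv⟩
    refine ⟨x, ⟨hx, ?_⟩, rfl⟩
    simpa [Submodule.mapQ_apply, Submodule.Quotient.mk_eq_zero] using hv
  · rintro ⟨x, ⟨hx, hx'⟩, rfl⟩
    refine ⟨⟨x, hx, rfl⟩, ?_⟩
    simpa [Submodule.mapQ_apply, Submodule.Quotient.mk_eq_zero] using hx'

theorem map_mkQ_map_mapQ (X Z : Submodule k V) (Y : Submodule k W) (f : V →ₗ[k] W)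
    (h : Z ≤ Y.comap f) :
    (X.map Z.mkQ).map (Z.mapQ Y f h) = (X.map f).map Y.mkQ := by
  rw [← Submodule.map_comp, ← Submodule.map_comp, Submodule.mapQ_mkQ]

theorem finrank_map_add_finrank_inf_ker (S : Submodule k V) [Module.Finite k S] (f : V →ₗ[k] W) :
    Module.finrank k (S.map f) + Module.finrank k (S ⊓ LinearMap.ker f : Submodule k V) =
      Module.finrank k S := by
  have h := LinearMap.finrank_range_add_finrank_ker (f.domRestrict S)
  rw [LinearMap.range_domRestrict] at h
  rw [← h, LinearMap.ker_domRestrict]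
  congr 1
  rw [← (Submodule.equivMapOfInjective S.subtype S.injective_subtype _).symm.finrank_eq,
    Submodule.map_comap_subtype]

theorem almostLE_of_le {X Y : Submodule k V} (h : X ≤ Y) : AlmostLE X Y := by
  have : X.map Y.mkQ = ⊥ := by
    rw [← le_bot_iff, Submodule.map_le_iff_le_comap]
    simpa using h
  rw [AlmostLE, this]
  infer_instance

theorem codim_of_le {X Y : Submodule k V} (h : X ≤ Y) : codim X Y = 0 := by
  have : X.map Y.mkQ = ⊥ := by
    rw [← le_bot_iff, Submodule.map_le_iff_le_comap]
    simpa using h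
  rw [codim, this, finrank_bot]

theorem AlmostLE.mono_left {X X' Y : Submodule k V} (h : AlmostLE X Y) (hX : X' ≤ X) :
    AlmostLE X' Y :=
  have : Module.Finite k (X.map Y.mkQ) := h
  Submodule.finiteDimensional_of_le (Submodule.map_mono hX)

theorem AlmostLE.map_comap {X Z : Submodule k V} {Y : Submodule k W} (h : AlmostLE X Z)
    (f : V →ₗ[k] W) (hf : Z ≤ Y.comap f) : AlmostLE (X.map f) Y := by
  rw [AlmostLE, ← map_mkQ_map_mapQ X Z Y f hf]
  have : Module.Finite k (X.map Z.mkQ) := h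
  infer_instance

theorem AlmostLE.map {X Y : Submodule k V} (h : AlmostLE X Y) (f : V →ₗ[k] W) :
    AlmostLE (X.map f) (Y.map f) :=
  h.map_comap f (Submodule.le_comap_map f Y)

theorem AlmostLE.mono_right {X Y Y' : Submodule k V} (h : AlmostLE X Y) (hY : Y ≤ Y') :
    AlmostLE X Y' := by
  simpa using h.map_comap LinearMap.id (Y := Y') hY

/-- The finiteness criterion behind all the closure properties of `AlmostLE`. -/
theorem AlmostLE.of_map {X Z : Submodule k V} {Y : Submodule k W} (f : V →ₗ[k] W)
    (hf : Z ≤ Y.comap f) (h₁ : AlmostLE (X.map f) Y) (h₂ : AlmostLE (X ⊓ Y.comap f) Z) :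
    AlmostLE X Z := by
  have h₁' : ((X.map Z.mkQ).map (Z.mapQ Y f hf)).FG := by
    rw [map_mkQ_map_mapQ]
    exact Module.Finite.iff_fg.1 h₁
  have h₂' : (X.map Z.mkQ ⊓ LinearMap.ker (Z.mapQ Y f hf)).FG := by
    rw [map_mkQ_inf_ker_mapQ]
    exact Module.Finite.iff_fg.1 h₂
  exact Module.Finite.iff_fg.2 (Submodule.fg_of_fg_map_of_fg_inf_ker _ h₁' h₂')

theorem codim_map {X Z : Submodule k V} {Y : Submodule k W} (f : V →ₗ[k] W)
    (hf : Z ≤ Y.comap f) (h : AlmostLE X Z) :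
    codim (X.map f) Y + codim (X ⊓ Y.comap f) Z = codim X Z := by
  have : Module.Finite k (X.map Z.mkQ) := h
  rw [codim, codim, codim, ← map_mkQ_map_mapQ X Z Y f hf, ← map_mkQ_inf_ker_mapQ X Z Y f hf]
  exact finrank_map_add_finrank_inf_ker _ _

theorem AlmostLE.inf_self {X Y : Submodule k V} (h : AlmostLE X Y) : AlmostLE X (X ⊓ Y) :=
  AlmostLE.of_map (Y := Y) LinearMap.id inf_le_right (by simpa using h)
    (by simpa using almostLE_of_le le_rfl)

theorem AlmostLE.inf {X Y Y' : Submodule k V} (h : AlmostLE X Y) (h' : AlmostLE X Y') :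
    AlmostLE X (Y ⊓ Y') := by
  refine AlmostLE.of_map (Y := Y) LinearMap.id inf_le_left (by simpa using h) ?_
  have := (h'.mono_left (inf_le_left : X ⊓ Y ≤ X)).inf_self
  refine this.mono_right ?_
  exact le_inf (inf_le_left.trans inf_le_right) inf_le_right

theorem AlmostLE.trans {X Y Z : Submodule k V} (h : AlmostLE X Y) (h' : AlmostLE Y Z) :
    AlmostLE X Z :=
  (AlmostLE.of_map (Y := Y) (Z := Y ⊓ Z) LinearMap.id inf_le_left (by simpa using h)
    (h'.inf_self.mono_left (by simp))).mono_right inf_le_right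

theorem AlmostLE.sup {X X' Y : Submodule k V} (h : AlmostLE X Y) (h' : AlmostLE X' Y) :
    AlmostLE (X ⊔ X') Y := by
  rw [AlmostLE, Submodule.map_sup]
  have : Module.Finite k (X.map Y.mkQ) := h
  have : Module.Finite k (X'.map Y.mkQ) := h'
  infer_instance

theorem AlmostLE.iSup {ι : Type*} (s : Finset ι) {X : ι → Submodule k V} {Y : Submodule k V}
    (h : ∀ i ∈ s, AlmostLE (X i) Y) : AlmostLE (⨆ i ∈ s, X i) Y := by
  classical
  induction s using Finset.induction_on with
  | empty => simpa using almostLE_of_le bot_le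
  | insert a s _ ih =>
    rw [Finset.iSup_insert]
    exact (h a (by simp)).sup (ih fun i hi => h i (by simp [hi]))

theorem AlmostLE.map_sum {ι : Type*} (s : Finset ι) {f : ι → V →ₗ[k] W} {X : Submodule k V}
    {Y : Submodule k W} (h : ∀ i ∈ s, AlmostLE (X.map (f i)) Y) :
    AlmostLE (X.map (∑ i ∈ s, f i)) Y := by
  refine (AlmostLE.iSup s h).mono_left ?_
  rintro _ ⟨x, hx, rfl⟩
  rw [LinearMap.sum_apply]
  exact Submodule.sum_mem _ fun i hi =>
    Submodule.mem_iSup_of_mem i (Submodule.mem_iSup_of_mem hi ⟨x, hx, rfl⟩)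

theorem AlmostLE.of_map_injective {X Y : Submodule k V} {f : V →ₗ[k] W}
    (hf : Function.Injective f) (h : AlmostLE (X.map f) (Y.map f)) : AlmostLE X Y := by
  refine AlmostLE.of_map f (Submodule.le_comap_map f Y) h ?_
  rw [Submodule.comap_map_eq_of_injective hf]
  exact almostLE_of_le inf_le_right

theorem codim_map_of_injective (X Y : Submodule k V) {f : V →ₗ[k] W} (hf : Function.Injective f) :
    codim (X.map f) (Y.map f) = codim X Y := by
  rw [codim, codim, ← map_mkQ_map_mapQ X Y (Y.map f) f (Submodule.le_comap_map f Y)]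
  refine (Submodule.equivMapOfInjective _ ?_ _).symm.finrank_eq
  rw [← LinearMap.ker_eq_bot, Submodule.ker_mapQ, Submodule.comap_map_eq_of_injective hf,
    Submodule.mkQ_map_self]

theorem relIndex_map_of_injective (X Y : Submodule k V) {f : V →ₗ[k] W}
    (hf : Function.Injective f) : relIndex (X.map f) (Y.map f) = relIndex X Y := by
  rw [relIndex, relIndex, codim_map_of_injective _ _ hf, codim_map_of_injective _ _ hf]

theorem codim_tower {X Y Z : Submodule k V} (hZ : Z ≤ Y) (h : AlmostLE X Z) :
    codim X Y + codim (X ⊓ Y) Z = codim X Z := by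
  simpa using codim_map (Y := Y) LinearMap.id hZ h

/-- The relative index, computed with any subspace of finite codimension in `X` and `Y`. -/
theorem relIndex_eq {X Y Z : Submodule k V} (hX : Z ≤ X) (hY : Z ≤ Y) (hXZ : AlmostLE X Z)
    (hYZ : AlmostLE Y Z) : relIndex X Y = codim X Z - codim Y Z := by
  rw [relIndex, ← codim_tower hY hXZ, ← codim_tower hX hYZ, inf_comm Y X]
  push_cast
  ring

/-- Commensurability of subspaces. -/
def Commens (X Y : Submodule k V) : Prop := AlmostLE X Y ∧ AlmostLE Y X

theorem Commens.refl (X : Submodule k V) : Commens X X :=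
  ⟨almostLE_of_le le_rfl, almostLE_of_le le_rfl⟩

theorem Commens.symm {X Y : Submodule k V} (h : Commens X Y) : Commens Y X := ⟨h.2, h.1⟩

theorem Commens.trans {X Y Z : Submodule k V} (h : Commens X Y) (h' : Commens Y Z) :
    Commens X Z := ⟨h.1.trans h'.1, h'.2.trans h.2⟩

theorem Commens.map {X Y : Submodule k V} (h : Commens X Y) (f : V →ₗ[k] W) :
    Commens (X.map f) (Y.map f) := ⟨h.1.map f, h.2.map f⟩

theorem relIndex_self (X : Submodule k V) : relIndex X X = 0 := sub_self _

theorem relIndex_symm (X Y : Submodule k V) : relIndex Y X = -relIndex X Y := by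
  rw [relIndex, relIndex, neg_sub]

theorem relIndex_add {X Y Z : Submodule k V} (h : Commens X Y) (h' : Commens Y Z) :
    relIndex X Y + relIndex Y Z = relIndex X Z := by
  let T := X ⊓ Y ⊓ Z
  have hX : AlmostLE X T := ((almostLE_of_le le_rfl).inf h.1).inf (h.1.trans h'.1)
  have hY : AlmostLE Y T := (h.2.inf (almostLE_of_le le_rfl)).inf h'.1
  have hZ : AlmostLE Z T := ((h'.2.trans h.2).inf h'.2).inf (almostLE_of_le le_rfl)
  have h1 : T ≤ X := inf_le_left.trans inf_le_left
  have h2 : T ≤ Y := inf_le_left.trans inf_le_right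
  have h3 : T ≤ Z := inf_le_right
  rw [relIndex_eq h1 h2 hX hY, relIndex_eq h2 h3 hY hZ, relIndex_eq h1 h3 hX hZ]
  ring

theorem relIndex_of_le {X Y : Submodule k V} (h : Y ≤ X) : relIndex X Y = codim X Y := by
  rw [relIndex, codim_of_le h]
  simp

theorem AlmostLE.inf_ker {X Y : Submodule k V} (h : AlmostLE X Y) (f : V →ₗ[k] W) :
    AlmostLE (X ⊓ LinearMap.ker f) (Y ⊓ LinearMap.ker f) :=
  (h.mono_left inf_le_left).inf (almostLE_of_le inf_le_right)

/-- The relative index is additive in short exact sequences. -/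
theorem relIndex_inf_ker_add_map {X Y : Submodule k V} (h : Commens X Y) (f : V →ₗ[k] W) :
    relIndex (X ⊓ LinearMap.ker f) (Y ⊓ LinearMap.ker f) + relIndex (X.map f) (Y.map f) =
      relIndex X Y := by
  have key : ∀ X Z : Submodule k V, Z ≤ X → AlmostLE X Z →
      (codim X Z : ℤ) = codim (X ⊓ LinearMap.ker f) (Z ⊓ LinearMap.ker f) +
        codim (X.map f) (Z.map f) := by
    intro X Z hZ hXZ
    rw [← codim_map (Y := Z.map f) f (Submodule.le_comap_map f Z) hXZ, Submodule.comap_map_eq]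
    have h1 : codim (X ⊓ (Z ⊔ LinearMap.ker f)) Z = codim (X ⊓ LinearMap.ker f) Z := by
      rw [codim, codim, inf_comm, sup_inf_assoc_of_le _ hZ, Submodule.map_sup,
        Submodule.mkQ_map_self, bot_sup_eq, inf_comm]
    have h2 := codim_tower (X := X ⊓ LinearMap.ker f) (Y := Z) (Z := Z ⊓ LinearMap.ker f)
      inf_le_left (hXZ.inf_ker f)
    rw [codim_of_le (le_inf inf_le_right (inf_le_left.trans inf_le_right))] at h2
    rw [h1]
    push_cast
    omega
  have hX : AlmostLE X (X ⊓ Y) := (almostLE_of_le le_rfl).inf h.1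
  have hY : AlmostLE Y (X ⊓ Y) := h.2.inf (almostLE_of_le le_rfl)
  rw [relIndex_eq (Z := X ⊓ Y) inf_le_left inf_le_right hX hY,
    relIndex_eq (Z := X ⊓ Y ⊓ LinearMap.ker f) (inf_le_inf_right _ inf_le_left)
      (inf_le_inf_right _ inf_le_right) (hX.inf_ker f) (hY.inf_ker f),
    relIndex_eq (Z := (X ⊓ Y).map f) (Submodule.map_mono inf_le_left)
      (Submodule.map_mono inf_le_right) (hX.map f) (hY.map f),
    key X _ inf_le_left hX, key Y _ inf_le_right hY]
  ring

/-- Unipotent maps which almost preserve `X` do not change its size: they preserve the sum of the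
translates of `X` under the powers of the nilpotent part. -/
theorem relIndex_unipotent (ν : V →ₗ[k] V) (r : ℕ) (hν : ν ^ r = 0) {X : Submodule k V}
    (hX : AlmostLE (X.map ν) X) :
    Commens X (X.map (1 + ν)) ∧ relIndex X (X.map (1 + ν)) = 0 := by
  -- the smallest `ν`-stable subspace containing `X`; it is commensurable with `X` and preserved by
  -- `1 + ν`
  let Y : Submodule k V := ⨆ i ∈ Finset.range r, X.map (ν ^ i)
  have hpow : ∀ i, AlmostLE (X.map (ν ^ i)) X := by
    intro i
    induction i with
    | zero =>
      rw [pow_zero, Module.End.one_eq_id, Submodule.map_id]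
      exact almostLE_of_le le_rfl
    | succ i ih =>
      rw [pow_succ', Module.End.mul_eq_comp, Submodule.map_comp]
      exact (ih.map ν).trans hX
  have hmem : ∀ i, X.map (ν ^ i) ≤ Y := by
    intro i
    by_cases hi : i < r
    · exact le_iSup₂_of_le i (Finset.mem_range.2 hi) le_rfl
    · rw [pow_eq_zero_of_le (not_lt.1 hi) hν, Submodule.map_zero]
      exact bot_le
  have hXY : X ≤ Y := by simpa [Module.End.one_eq_id] using hmem 0
  have hYX : AlmostLE Y X := AlmostLE.iSup _ fun i _ => hpow i
  have hνY : ∀ y ∈ Y, ν y ∈ Y := by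
    intro y hy
    have : Y ≤ Y.comap ν := by
      refine iSup₂_le fun i _ => ?_
      rw [← Submodule.map_le_iff_le_comap, ← Submodule.map_comp, ← Module.End.mul_eq_comp,
        ← pow_succ']
      exact hmem (i + 1)
    exact this hy
  have hνi : ∀ i, ∀ y ∈ Y, (ν ^ i) y ∈ Y := by
    intro i
    induction i with
    | zero => intro y hy; simpa using hy
    | succ i ih => intro y hy; rw [pow_succ', Module.End.mul_apply]; exact hνY _ (ih y hy)
  have hmap : Y.map (1 + ν) = Y := by
    refine le_antisymm ?_ ?_
    · rintro _ ⟨y, hy, rfl⟩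
      exact Y.add_mem hy (hνY y hy)
    · intro y hy
      refine ⟨∑ i ∈ Finset.range r, ((-ν) ^ i) y, Submodule.sum_mem _ fun i _ => ?_, ?_⟩
      · rw [neg_pow, Module.End.mul_apply]
        rcases neg_one_pow_eq_or (Module.End k V) i with h | h <;> rw [h]
        · simpa using hνi i y hy
        · simpa using hνi i y hy
      · have := mul_neg_geom_sum (-ν) r
        rw [neg_pow ν r, hν, mul_zero, sub_zero, sub_neg_eq_add] at this
        have h2 := LinearMap.congr_fun this y
        simpa [LinearMap.sum_apply] using h2
  have hc : Commens X Y := ⟨almostLE_of_le hXY, hYX⟩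
  have hc' : Commens Y (X.map (1 + ν)) := by
    have := hc.symm.map (1 + ν)
    rwa [hmap] at this
  refine ⟨hc.trans hc', ?_⟩
  rw [← relIndex_add hc hc']
  have h3 : relIndex Y (X.map (1 + ν)) = relIndex Y X := by
    have hinj : Function.Injective (1 + ν : V →ₗ[k] V) := by
      have := geom_sum_mul_neg (-ν) r
      rw [neg_pow ν r, hν, mul_zero, sub_zero, sub_neg_eq_add] at this
      exact Function.LeftInverse.injective (g := (∑ i ∈ Finset.range r, (-ν) ^ i : V →ₗ[k] V))
        fun x => LinearMap.congr_fun this x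
    rw [← relIndex_map_of_injective Y X hinj, hmap]
  rw [h3, relIndex_symm X Y]
  ring

/-- The relative index of products, when the factors differ in only finitely many places. -/
theorem relIndex_pi {U : ℕ → Type*} [∀ i, AddCommGroup (U i)] [∀ i, Module k (U i)] (N : ℕ) :
    ∀ X Y : ∀ i, Submodule k (U i), (∀ i, N ≤ i → X i = Y i) → (∀ i, Commens (X i) (Y i)) →
    Commens (Submodule.pi Set.univ X) (Submodule.pi Set.univ Y) ∧
    relIndex (Submodule.pi Set.univ X) (Submodule.pi Set.univ Y) =
      ∑ i ∈ Finset.range N, relIndex (X i) (Y i) := by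
  classical
  induction N with
  | zero =>
    intro X Y h _
    rw [show X = Y from funext fun i => h i (Nat.zero_le i)]
    exact ⟨Commens.refl _, by simp [relIndex_self]⟩
  | succ N ih =>
    intro X Y h hc
    -- pass from `X` to `Y` by changing first the factor `N` and then the lower ones
    let X' : ∀ i, Submodule k (U i) := Function.update X N (Y N)
    have hX'N : X' N = Y N := Function.update_self ..
    have hX' : ∀ i, i ≠ N → X' i = X i := fun i hi => Function.update_of_ne hi ..
    obtain ⟨h1, h2⟩ := ih X' Y
      (fun i hi => by
        rcases eq_or_lt_of_le hi with rfl | hi'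
        · exact hX'N
        · rw [hX' i (by omega), h i hi'])
      (fun i => by
        by_cases hi : i = N
        · subst hi; rw [hX'N]; exact Commens.refl _
        · rw [hX' i hi]; exact hc i)
    have hker : ∀ A B : ∀ i, Submodule k (U i), (∀ i, i ≠ N → A i = B i) →
        Submodule.pi Set.univ A ⊓ LinearMap.ker (LinearMap.proj N : (∀ i, U i) →ₗ[k] U N) ≤
        Submodule.pi Set.univ B ⊓ LinearMap.ker (LinearMap.proj N : (∀ i, U i) →ₗ[k] U N) := by
      rintro A B hAB v ⟨hv, hv0⟩
      refine ⟨fun i _ => ?_, hv0⟩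
      by_cases hi : i = N
      · subst hi
        have h0 : v i = 0 := hv0
        change v i ∈ B i
        rw [h0]
        exact zero_mem _
      · change v i ∈ B i
        rw [← hAB i hi]
        exact hv i trivial
    have hmap : ∀ A : ∀ i, Submodule k (U i),
        (Submodule.pi Set.univ A).map (LinearMap.proj N : (∀ i, U i) →ₗ[k] U N) = A N := by
      intro A
      refine le_antisymm ?_ ?_
      · rintro _ ⟨v, hv, rfl⟩
        exact hv N trivial
      · intro x hx
        refine ⟨Pi.single N x, fun i _ => ?_, by simp⟩
        by_cases hi : i = N
        · subst hi; simpa using hx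
        · rw [Pi.single_eq_of_ne hi]; exact zero_mem _
    have hal : ∀ A B : ∀ i, Submodule k (U i), (∀ i, i ≠ N → A i = B i) →
        AlmostLE (A N) (B N) → AlmostLE (Submodule.pi Set.univ A) (Submodule.pi Set.univ B) := by
      intro A B hAB hN
      refine AlmostLE.of_map (Y := B N) (LinearMap.proj N : (∀ i, U i) →ₗ[k] U N)
        (fun v hv => hv N trivial) (by rwa [hmap]) ?_
      refine almostLE_of_le ?_
      rintro v ⟨hv, hvN⟩ i -
      by_cases hi : i = N
      · subst hi; exact hvN
      · change v i ∈ B i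
        rw [← hAB i hi]
        exact hv i trivial
    have hc1 : Commens (Submodule.pi Set.univ X) (Submodule.pi Set.univ X') :=
      ⟨hal X X' (fun i hi => (hX' i hi).symm) (by rw [hX'N]; exact (hc N).1),
        hal X' X hX' (by rw [hX'N]; exact (hc N).2)⟩
    refine ⟨hc1.trans h1, ?_⟩
    rw [← relIndex_add hc1 h1, h2, Finset.sum_range_succ, add_comm]
    congr 1
    · refine Finset.sum_congr rfl fun i hi => ?_
      rw [hX' i (by have := Finset.mem_range.1 hi; omega)]
    · rw [← relIndex_inf_ker_add_map hc1 (LinearMap.proj N : (∀ i, U i) →ₗ[k] U N), hmap, hmap,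
        hX'N, le_antisymm (hker X X' fun i hi => (hX' i hi).symm) (hker X' X hX'), relIndex_self,
        zero_add]

end RelIndex

/-! ### Lattices in spaces of columns and the Dieudonné determinant -/

section Lattice

variable {k F : Type*} [DivisionRing k] [DivisionRing F] [Module k F] [SMulCommClass k F F]

/-- Left multiplication by a matrix over `F`, as a `k`-linear map of columns. -/
def matLin (k : Type*) [DivisionRing k] [Module k F] [SMulCommClass k F F] {I J : Type*}
    [Fintype J] (A : Matrix I J F) : (J → F) →ₗ[k] (I → F) where
  toFun := A.mulVec
  map_add' := A.mulVec_add
  map_smul' c v := A.mulVec_smul c v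

@[simp]
theorem matLin_apply {I J : Type*} [Fintype J] (A : Matrix I J F) (v : J → F) :
    matLin k A v = A.mulVec v := rfl

theorem matLin_mul {I J L : Type*} [Fintype J] [Fintype L] (A : Matrix I J F)
    (B : Matrix J L F) : matLin k (A * B) = matLin k A ∘ₗ matLin k B :=
  LinearMap.ext fun v => (Matrix.mulVec_mulVec v A B).symm

theorem matLin_one {I : Type*} [Fintype I] [DecidableEq I] :
    matLin k (1 : Matrix I I F) = LinearMap.id :=
  LinearMap.ext fun v => Matrix.one_mulVec v

theorem matLin_add {I J : Type*} [Fintype J] (A B : Matrix I J F) :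
    matLin k (A + B) = matLin k A + matLin k B :=
  LinearMap.ext fun v => Matrix.add_mulVec A B v

/-- Left multiplication by a scalar of `F`. -/
def lmul (k : Type*) [DivisionRing k] [Module k F] [SMulCommClass k F F] (x : F) : F →ₗ[k] F where
  toFun y := x * y
  map_add' := mul_add x
  map_smul' c y := mul_smul_comm c x y

@[simp]
theorem lmul_apply (x y : F) : lmul k x y = x * y := rfl

/-- The columns with all entries in `Λ`. -/
def lat (Λ : Submodule k F) (J : Type*) : Submodule k (J → F) := Submodule.pi Set.univ fun _ => Λ

theorem mem_lat {Λ : Submodule k F} {J : Type*} {v : J → F} : v ∈ lat Λ J ↔ ∀ j, v j ∈ Λ := by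
  simp [lat]

/-- A subspace `Λ` of `F` which is almost preserved by left multiplications. Then `Λ` and `xΛ` are
commensurable for `x ≠ 0`, so that the index of `xΛ` in `Λ` makes sense. -/
def IsLattice (Λ : Submodule k F) : Prop := ∀ x : F, AlmostLE (Λ.map (lmul k x)) Λ

variable {Λ : Submodule k F}

theorem IsLattice.map_matLin (hΛ : IsLattice Λ) {I J : Type*} [Fintype I] [Fintype J]
    (A : Matrix I J F) : AlmostLE ((lat Λ J).map (matLin k A)) (lat Λ I) := by
  classical
  have h : matLin k A = ∑ i, ∑ j, LinearMap.single k (fun _ : I => F) i ∘ₗ lmul k (A i j) ∘ₗ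
      LinearMap.proj j := by
    refine LinearMap.ext fun v => funext fun i => ?_
    simp only [matLin_apply, Matrix.mulVec, dotProduct, LinearMap.sum_apply, Finset.sum_apply,
      LinearMap.comp_apply, LinearMap.single_apply, lmul_apply, LinearMap.proj_apply,
      Pi.single_apply]
    rw [Finset.sum_comm]
    simp
  rw [h]
  refine AlmostLE.map_sum _ fun i _ => AlmostLE.map_sum _ fun j _ => ?_
  rw [Submodule.map_comp, Submodule.map_comp]
  have h1 : (lat Λ J).map (LinearMap.proj j : (J → F) →ₗ[k] F) ≤ Λ := by
    rintro _ ⟨v, hv, rfl⟩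
    exact mem_lat.1 hv j
  have h2 : Λ.map (LinearMap.single k (fun _ : I => F) i) ≤ lat Λ I := by
    rintro _ ⟨x, hx, rfl⟩
    refine mem_lat.2 fun i' => ?_
    rw [LinearMap.single_apply, Pi.single_apply]
    split_ifs
    · exact hx
    · exact zero_mem _
  exact (((hΛ (A i j)).mono_left (Submodule.map_mono h1)).map _).mono_right h2

theorem IsLattice.commens (hΛ : IsLattice Λ) {I J : Type*} [Fintype I] [Fintype J] [DecidableEq I]
    {A : Matrix I J F} {B : Matrix J I F} (h : A * B = 1) :
    Commens (lat Λ I) ((lat Λ J).map (matLin k A)) := by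
  refine ⟨?_, hΛ.map_matLin A⟩
  have := (hΛ.map_matLin B).map (matLin k A)
  rwa [← Submodule.map_comp, ← matLin_mul, h, matLin_one, Submodule.map_id] at this

/-- The index `[Λ : xΛ]`. -/
def weight (Λ : Submodule k F) (x : F) : ℤ := relIndex Λ (Λ.map (lmul k x))

theorem IsLattice.commens_lmul (hΛ : IsLattice Λ) {x : F} (hx : x ≠ 0) :
    Commens Λ (Λ.map (lmul k x)) := by
  refine ⟨?_, hΛ x⟩
  have := (hΛ x⁻¹).map (lmul k x)
  rw [← Submodule.map_comp] at this
  convert this using 1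
  rw [show lmul k x ∘ₗ lmul k x⁻¹ = LinearMap.id from
    LinearMap.ext fun y => by simp [mul_inv_cancel_left₀ hx], Submodule.map_id]

theorem IsLattice.weight_mul (hΛ : IsLattice Λ) {x y : F} (hx : x ≠ 0) (hy : y ≠ 0) :
    weight Λ (x * y) = weight Λ x + weight Λ y := by
  have h : Λ.map (lmul k (x * y)) = (Λ.map (lmul k y)).map (lmul k x) := by
    rw [← Submodule.map_comp]
    congr 1
    exact LinearMap.ext fun z => by simp [mul_assoc]
  rw [weight, h, ← relIndex_add (hΛ.commens_lmul hx) ((hΛ.commens_lmul hy).map _),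
    relIndex_map_of_injective _ _ (f := lmul k x) fun a b hab => mul_left_cancel₀ hx hab]
  rfl

theorem weight_one (Λ : Submodule k F) : weight Λ 1 = 0 := by
  rw [weight, show lmul k (1 : F) = LinearMap.id from LinearMap.ext fun y => one_mul y,
    Submodule.map_id, relIndex_self]

theorem weight_neg_one (Λ : Submodule k F) : weight Λ (-1) = 0 := by
  rw [weight, show Λ.map (lmul k (-1 : F)) = Λ from ?_, relIndex_self]
  ext x
  simp only [Submodule.mem_map, lmul_apply, neg_mul, one_mul]
  exact ⟨by rintro ⟨y, hy, rfl⟩; exact neg_mem hy, fun hx => ⟨-x, neg_mem hx, neg_neg x⟩⟩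

theorem map_funLeft_lat (Λ : Submodule k F) {I I' : Type*} (e : I' ≃ I) :
    (lat Λ I).map (LinearMap.funLeft k F e) = lat Λ I' := by
  ext v
  simp only [Submodule.mem_map, mem_lat]
  constructor
  · rintro ⟨w, hw, rfl⟩ i
    exact hw _
  · intro hv
    exact ⟨fun i => v (e.symm i), fun i => hv _, by ext; simp [LinearMap.funLeft]⟩

theorem relIndex_lat_submatrix (Λ : Submodule k F) {I I' J J' : Type*} [Fintype J] [Fintype J']
    (A : Matrix I J F) (e : I' ≃ I) (f : J' ≃ J) :
    relIndex (lat Λ I') ((lat Λ J').map (matLin k (A.submatrix e f))) =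
      relIndex (lat Λ I) ((lat Λ J).map (matLin k A)) := by
  have hinj : Function.Injective (LinearMap.funLeft k F e) :=
    LinearMap.funLeft_injective_of_surjective _ _ _ e.surjective
  rw [← relIndex_map_of_injective _ _ hinj, map_funLeft_lat Λ e, ← Submodule.map_comp,
    ← map_funLeft_lat Λ f, ← Submodule.map_comp]
  congr 2
  refine LinearMap.ext fun v => funext fun i => ?_
  simp only [LinearMap.comp_apply, matLin_apply, LinearMap.funLeft_apply, Matrix.mulVec,
    dotProduct, Matrix.submatrix_apply]
  exact f.sum_comp fun j => A (e i) j * v j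

/-- Elementary block matrices do not change the index. -/
theorem IsLattice.relIndex_one_add (hΛ : IsLattice Λ) {I : Type*} [Fintype I] [DecidableEq I]
    (B : Matrix I I F) (hB : B * B = 0) :
    Commens (lat Λ I) ((lat Λ I).map (matLin k (1 + B))) ∧
      relIndex (lat Λ I) ((lat Λ I).map (matLin k (1 + B))) = 0 := by
  rw [matLin_add, matLin_one]
  refine relIndex_unipotent (matLin k B) 2 ?_ (hΛ.map_matLin B)
  rw [pow_two, Module.End.mul_eq_comp, ← matLin_mul, hB]
  exact LinearMap.ext fun v => Matrix.zero_mulVec v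

/-- The first block is the kernel of the projection to the second one, so this is additivity of the
index in short exact sequences. -/
theorem IsLattice.relIndex_fromBlocks (hΛ : IsLattice Λ) {I J : Type*} [Fintype I] [Fintype J]
    [DecidableEq I] [DecidableEq J] {A : Matrix I I F} {D : Matrix J J F}
    (hA : IsUnit A) (hD : IsUnit D) :
    relIndex (lat Λ (I ⊕ J)) ((lat Λ (I ⊕ J)).map (matLin k (Matrix.fromBlocks A 0 0 D))) =
      relIndex (lat Λ I) ((lat Λ I).map (matLin k A)) +
        relIndex (lat Λ J) ((lat Λ J).map (matLin k D)) := by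
  obtain ⟨A', hA, -⟩ := isUnit_iff_exists.1 hA
  obtain ⟨D', hD, hD'⟩ := isUnit_iff_exists.1 hD
  have hc : Commens (lat Λ (I ⊕ J))
      ((lat Λ (I ⊕ J)).map (matLin k (Matrix.fromBlocks A 0 0 D))) :=
    hΛ.commens (B := Matrix.fromBlocks A' 0 0 D') (by
      simp [Matrix.fromBlocks_multiply, hA, hD])
  let f : (I ⊕ J → F) →ₗ[k] (J → F) := LinearMap.funLeft k F Sum.inr
  let g : (I → F) →ₗ[k] (I ⊕ J → F) :=
    { toFun := fun v => Sum.elim v 0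
      map_add' := fun v w => by ext (i | j) <;> simp
      map_smul' := fun c v => by ext (i | j) <;> simp }
  have hg : Function.Injective g := fun v w h => funext fun i => congrFun h (Sum.inl i)
  have hfl : (lat Λ (I ⊕ J)).map f = lat Λ J := by
    ext v
    simp only [Submodule.mem_map, mem_lat]
    exact ⟨by rintro ⟨w, hw, rfl⟩ j; exact hw _, fun hv => ⟨Sum.elim 0 v, by
      rintro (i | j)
      · exact zero_mem _
      · exact hv j, rfl⟩⟩
  have hfc : f ∘ₗ matLin k (Matrix.fromBlocks A 0 0 D) = matLin k D ∘ₗ f := by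
    refine LinearMap.ext fun v => funext fun j => ?_
    simp [f, LinearMap.funLeft, Matrix.fromBlocks_mulVec]
  have hgl : lat Λ (I ⊕ J) ⊓ LinearMap.ker f = (lat Λ I).map g := by
    ext v
    simp only [Submodule.mem_inf, Submodule.mem_map, mem_lat, LinearMap.mem_ker]
    constructor
    · rintro ⟨hv, h0⟩
      refine ⟨fun i => v (Sum.inl i), fun i => hv _, ?_⟩
      ext (i | j)
      · rfl
      · exact (congrFun h0 j).symm
    · rintro ⟨w, hw, rfl⟩
      refine ⟨?_, rfl⟩
      rintro (i | j)
      · exact hw i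
      · exact zero_mem _
  have hgc : matLin k (Matrix.fromBlocks A 0 0 D) ∘ₗ g = g ∘ₗ matLin k A := by
    refine LinearMap.ext fun v => funext fun j => ?_
    rcases j with i | j <;> simp [g, Matrix.fromBlocks_mulVec]
  have hker : (lat Λ (I ⊕ J)).map (matLin k (Matrix.fromBlocks A 0 0 D)) ⊓ LinearMap.ker f =
      ((lat Λ I).map (matLin k A)).map g := by
    rw [← Submodule.map_comp, ← hgc, Submodule.map_comp, ← hgl]
    ext v
    simp only [Submodule.mem_inf, Submodule.mem_map, LinearMap.mem_ker]
    constructor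
    · rintro ⟨⟨w, hw, rfl⟩, h0⟩
      refine ⟨w, ⟨hw, ?_⟩, rfl⟩
      have h1 : (matLin k D') (f (matLin k (Matrix.fromBlocks A 0 0 D) w)) = 0 := by
        rw [h0, map_zero]
      rw [← LinearMap.comp_apply f, hfc, LinearMap.comp_apply, ← LinearMap.comp_apply,
        ← matLin_mul, hD', matLin_one] at h1
      exact h1
    · rintro ⟨w, ⟨hw, h0⟩, rfl⟩
      refine ⟨⟨w, hw, rfl⟩, ?_⟩
      rw [← LinearMap.comp_apply f, hfc, LinearMap.comp_apply, h0, map_zero]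
  rw [← relIndex_inf_ker_add_map hc f, hker, hgl, relIndex_map_of_injective _ _ hg, hfl,
    ← Submodule.map_comp, hfc, Submodule.map_comp, hfl]

theorem relIndex_lat_unique (Λ : Submodule k F) (x : F) :
    relIndex (lat Λ (Fin 1)) ((lat Λ (Fin 1)).map (matLin k (Matrix.of fun _ _ => x))) =
      weight Λ x := by
  let g : F →ₗ[k] (Fin 1 → F) := LinearMap.pi fun _ => LinearMap.id
  have hg : Function.Injective g := fun v w h => congrFun h 0
  have h1 : Λ.map g = lat Λ (Fin 1) := by
    ext v
    simp only [Submodule.mem_map, mem_lat]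
    refine ⟨by rintro ⟨w, hw, rfl⟩ j; exact hw, fun hv => ⟨v 0, hv 0, ?_⟩⟩
    ext i
    rw [Subsingleton.elim i 0]
    rfl
  rw [weight, ← relIndex_map_of_injective _ _ hg, ← h1, ← Submodule.map_comp,
    ← Submodule.map_comp]
  congr 2
  refine LinearMap.ext fun v => funext fun i => ?_
  simp [g, Matrix.mulVec, dotProduct]

/-- The block decomposition behind the recursive definition of the Dieudonné determinant. -/
theorem fromBlocks_schur {m : ℕ} (B : Matrix (Fin (m + 1)) (Fin (m + 1)) F)
    (hd : B (Fin.last m) (Fin.last m) ≠ 0) :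
    B.submatrix finSumFinEquiv finSumFinEquiv =
      (1 + Matrix.fromBlocks (0 : Matrix (Fin m) (Fin m) F) (Matrix.of fun i (_ : Fin 1) =>
        B i.castSucc (Fin.last m) * (B (Fin.last m) (Fin.last m))⁻¹) 0 0) *
      Matrix.fromBlocks (schur B) 0 0 (Matrix.of fun _ _ => B (Fin.last m) (Fin.last m)) *
      (1 + Matrix.fromBlocks (0 : Matrix (Fin m) (Fin m) F) 0 (Matrix.of fun (_ : Fin 1) i =>
        (B (Fin.last m) (Fin.last m))⁻¹ * B (Fin.last m) i.castSucc) 0) := by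
  rw [← Matrix.fromBlocks_one, Matrix.fromBlocks_add, Matrix.fromBlocks_add,
    Matrix.fromBlocks_multiply, Matrix.fromBlocks_multiply]
  ext (i | i) (j | j)
  · simp [Matrix.mul_apply, schur, hd]
    rw [← mul_assoc, sub_add_cancel]
    rfl
  · rw [Subsingleton.elim j 0]
    simp [Matrix.mul_apply, hd]
    rfl
  · rw [Subsingleton.elim i 0]
    simp [Matrix.mul_apply, hd]
    rfl
  · rw [Subsingleton.elim i 0, Subsingleton.elim j 0]
    simp
    rfl

theorem isUnit_one_add_of_sq_zero {I : Type*} [Fintype I] [DecidableEq I] (B : Matrix I I F)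
    (hB : B * B = 0) : IsUnit (1 + B) :=
  ⟨⟨1 + B, 1 - B, by noncomm_ring [hB], by noncomm_ring [hB]⟩, rfl⟩

open Classical in
/-- One step of the recursion defining `detRep`, with the choice of the pivot column hidden. -/
theorem exists_detRep_eq {m : ℕ} {A : Matrix (Fin (m + 1)) (Fin (m + 1)) F}
    (hA : ∃ j, A (Fin.last m) j ≠ 0) :
    ∃ j, A (Fin.last m) j ≠ 0 ∧ ∃ s : F, (s = 1 ∨ s = -1) ∧ detRep A =
      s * (detRep (schur (A.submatrix id (Equiv.swap j (Fin.last m)))) * A (Fin.last m) j) := by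
  obtain ⟨j, hj⟩ := hA
  have hne : (Finset.univ.filter fun j => A (Fin.last m) j ≠ 0).Nonempty := ⟨j, by simpa using hj⟩
  refine ⟨(Finset.univ.filter fun j => A (Fin.last m) j ≠ 0).max' hne,
    (Finset.mem_filter.1 (Finset.max'_mem _ hne)).2,
    if (Finset.univ.filter fun j => A (Fin.last m) j ≠ 0).max' hne = Fin.last m then 1 else -1,
    by split_ifs <;> simp, ?_⟩
  rw [detRep, dif_pos hne]
  simp only [Matrix.submatrix_apply, id, Equiv.swap_apply_right]

/-- The index of the image of the standard lattice under an invertible matrix is the weight of the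
Dieudonné determinant: the index is additive in products and unchanged by elementary matrices, so it
can be followed through the row reduction defining the determinant. -/
theorem IsLattice.relIndex_eq_weight_detRep (hΛ : IsLattice Λ) : ∀ {m : ℕ}
    (A : Matrix (Fin m) (Fin m) F), IsUnit A → detRep A ≠ 0 ∧
      relIndex (lat Λ (Fin m)) ((lat Λ (Fin m)).map (matLin k A)) = weight Λ (detRep A)
  | 0, A, _ => by
    refine ⟨by simp [detRep], ?_⟩
    have : (lat Λ (Fin 0)).map (matLin k A) = lat Λ (Fin 0) := Subsingleton.elim _ _
    rw [this, relIndex_self, detRep, weight_one]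
  | m + 1, A, hA => by
    have hne : ∃ j, A (Fin.last m) j ≠ 0 := by
      by_contra! h0
      obtain ⟨A', hA', -⟩ := isUnit_iff_exists.1 hA
      have := congrFun (congrFun hA' (Fin.last m)) (Fin.last m)
      rw [Matrix.mul_apply, Finset.sum_eq_zero fun j _ => by rw [h0, zero_mul]] at this
      simp at this
    obtain ⟨j, hj, s, hs, hdet⟩ := exists_detRep_eq hne
    set B := A.submatrix id (Equiv.swap j (Fin.last m)) with hB
    have hd : B (Fin.last m) (Fin.last m) ≠ 0 := by simpa [hB] using hj
    set C := B.submatrix (finSumFinEquiv : Fin m ⊕ Fin 1 ≃ Fin (m + 1))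
      (finSumFinEquiv : Fin m ⊕ Fin 1 ≃ Fin (m + 1)) with hC
    have hCu : IsUnit C := by
      obtain ⟨A', h1, h2⟩ := isUnit_iff_exists.1 hA
      refine isUnit_iff_exists.2 ⟨(A'.submatrix (Equiv.swap j (Fin.last m)) id).submatrix
        finSumFinEquiv finSumFinEquiv, ?_, ?_⟩
      · rw [hC, Matrix.submatrix_mul_equiv, hB, ← Equiv.coe_refl, Matrix.submatrix_mul_equiv, h1]
        simp
      · rw [hC, Matrix.submatrix_mul_equiv, hB, ← Equiv.coe_refl, Matrix.submatrix_mul_equiv, h2]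
        simp
    set N₁ := Matrix.fromBlocks (0 : Matrix (Fin m) (Fin m) F) (Matrix.of fun i (_ : Fin 1) =>
        B i.castSucc (Fin.last m) * (B (Fin.last m) (Fin.last m))⁻¹) 0 0
    set N₂ := Matrix.fromBlocks (0 : Matrix (Fin m) (Fin m) F) 0 (Matrix.of fun (_ : Fin 1) i =>
        (B (Fin.last m) (Fin.last m))⁻¹ * B (Fin.last m) i.castSucc) 0
    set E := Matrix.fromBlocks (schur B) 0 0
      (Matrix.of fun (_ _ : Fin 1) => B (Fin.last m) (Fin.last m)) with hE
    have hdec : C = (1 + N₁) * E * (1 + N₂) := fromBlocks_schur B hd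
    have hN₁ : N₁ * N₁ = 0 := by simp [N₁, Matrix.fromBlocks_multiply]
    have hN₂ : N₂ * N₂ = 0 := by simp [N₂, Matrix.fromBlocks_multiply]
    have hu₁ := isUnit_one_add_of_sq_zero N₁ hN₁
    have hu₂ := isUnit_one_add_of_sq_zero N₂ hN₂
    have hEu : IsUnit E := by
      rw [hdec] at hCu
      exact hu₁.mul_left_iff.1 (hu₂.mul_right_iff.1 hCu)
    have hSu : IsUnit (schur B) := by
      obtain ⟨X, h1, h2⟩ := isUnit_iff_exists.1 hEu
      rw [← Matrix.fromBlocks_toBlocks X, hE, Matrix.fromBlocks_multiply,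
        ← Matrix.fromBlocks_one, Matrix.fromBlocks_inj] at h1 h2
      exact isUnit_iff_exists.2 ⟨X.toBlocks₁₁, by simpa using h1.1, by simpa using h2.1⟩
    have hDu : IsUnit (Matrix.of fun (_ _ : Fin 1) => B (Fin.last m) (Fin.last m)) := by
      refine isUnit_iff_exists.2 ⟨Matrix.of fun _ _ => (B (Fin.last m) (Fin.last m))⁻¹, ?_, ?_⟩ <;>
      · ext i i'
        rw [Subsingleton.elim i 0, Subsingleton.elim i' 0]
        simp [Matrix.mul_apply, hd]
    obtain ⟨ih1, ih2⟩ := hΛ.relIndex_eq_weight_detRep (schur B) hSu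
    have hs0 : s ≠ 0 := by rcases hs with rfl | rfl <;> simp
    have hsw : weight Λ s = 0 := by
      rcases hs with rfl | rfl
      · exact weight_one Λ
      · exact weight_neg_one Λ
    refine ⟨by rw [hdet]; exact mul_ne_zero hs0 (mul_ne_zero ih1 hj), ?_⟩
    have hBj : B (Fin.last m) (Fin.last m) = A (Fin.last m) j := by simp [hB]
    obtain ⟨c₁, r₁⟩ := hΛ.relIndex_one_add N₁ hN₁
    obtain ⟨c₂, r₂⟩ := hΛ.relIndex_one_add N₂ hN₂
    obtain ⟨E', hE', -⟩ := isUnit_iff_exists.1 hEu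
    have cE := hΛ.commens hE'
    have hinj : ∀ {X : Matrix (Fin m ⊕ Fin 1) (Fin m ⊕ Fin 1) F}, IsUnit X →
        Function.Injective (matLin k X) := by
      intro X hX
      obtain ⟨X', -, hX'⟩ := isUnit_iff_exists.1 hX
      refine Function.LeftInverse.injective (g := matLin k X') fun v => ?_
      rw [← LinearMap.comp_apply, ← matLin_mul, hX', matLin_one]
      rfl
    -- permuting the columns preserves the lattice
    have hA' : relIndex (lat Λ (Fin (m + 1))) ((lat Λ (Fin (m + 1))).map (matLin k A)) =
        relIndex (lat Λ (Fin m ⊕ Fin 1)) ((lat Λ (Fin m ⊕ Fin 1)).map (matLin k C)) := by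
      rw [hC, relIndex_lat_submatrix, hB, ← Equiv.coe_refl, relIndex_lat_submatrix]
    rw [hA', hdec, matLin_mul, matLin_mul, Submodule.map_comp, Submodule.map_comp,
      ← relIndex_add c₁ ((cE.trans (c₂.map _)).map _), r₁,
      relIndex_map_of_injective _ _ (hinj hu₁), ← relIndex_add cE (c₂.map _),
      relIndex_map_of_injective _ _ (hinj hEu), r₂, hE, hΛ.relIndex_fromBlocks hSu hDu,
      relIndex_lat_unique, ih2, hdet, hΛ.weight_mul hs0 (mul_ne_zero ih1 hj),
      hΛ.weight_mul ih1 hj, hsw, hBj]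
    ring

end Lattice

theorem schur_map {K F : Type*} [DivisionRing K] [DivisionRing F] (f : K →+* F) {m : ℕ}
    (A : Matrix (Fin (m + 1)) (Fin (m + 1)) K) : schur (A.map f) = (schur A).map f := by
  ext i j
  simp [schur]

open Classical in
theorem detRep_map {K F : Type*} [DivisionRing K] [DivisionRing F] (f : K →+* F) : ∀ {m : ℕ}
    (A : Matrix (Fin m) (Fin m) K), detRep (A.map f) = f (detRep A)
  | 0, A => by simp [detRep]
  | m + 1, A => by
    have hS : (Finset.univ.filter fun j => (A.map f) (Fin.last m) j ≠ 0) =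
        Finset.univ.filter fun j => A (Fin.last m) j ≠ 0 := by
      simp only [Matrix.map_apply, map_ne_zero]
    rw [detRep, detRep]
    rw [hS]
    split_ifs with h
    · simp only [map_mul]
      congr 1
      · split_ifs <;> simp
      · rw [← detRep_map f, ← schur_map]
        rfl
    · simp

/-! ### Laurent polynomials over a skew field -/

section Laurent

variable {K : Type*} [DivisionRing K]

/-- The ring `K[u, u⁻¹]` of Laurent polynomials in a central variable `u`. -/
abbrev Laurent (K : Type*) [DivisionRing K] : Type _ := MonoidAlgebra K (Multiplicative ℤ)

namespace Laurent

/-- The monomial `c uⁱ`. -/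
def mono (i : ℤ) (c : K) : Laurent K := MonoidAlgebra.single (Multiplicative.ofAdd i) c

/-- The coefficient of `uⁱ`. -/
def cf (f : Laurent K) (i : ℤ) : K := f.coeff (Multiplicative.ofAdd i)

theorem ext_cf {f g : Laurent K} (h : ∀ i, cf f i = cf g i) : f = g := by
  ext i
  exact h (Multiplicative.toAdd i)

theorem cf_mono (i j : ℤ) (c : K) : cf (mono i c) j = if i = j then c else 0 := by
  simp [cf, mono, Finsupp.single_apply]

theorem cf_mul_mono (f : Laurent K) (i j : ℤ) (c : K) : cf (f * mono i c) j = cf f (j - i) * c := by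
  rw [cf, mono, MonoidAlgebra.coeff_mul_single_apply]
  rfl

theorem mono_mul_mono (i j : ℤ) (c d : K) : mono i c * mono j d = mono (i + j) (c * d) :=
  MonoidAlgebra.single_mul_single ..

theorem cf_add (f g : Laurent K) (i : ℤ) : cf (f + g) i = cf f i + cf g i := rfl

theorem cf_sub (f g : Laurent K) (i : ℤ) : cf (f - g) i = cf f i - cf g i := by
  simp [cf]

theorem cf_smul (c : Kᵐᵒᵖ) (f : Laurent K) (i : ℤ) : cf (c • f) i = cf f i * c.unop := rfl

theorem cf_sum {ι : Type*} (s : Finset ι) (f : ι → Laurent K) (i : ℤ) :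
    cf (∑ j ∈ s, f j) i = ∑ j ∈ s, cf (f j) i := by
  simp [cf, MonoidAlgebra.coeff_sum, Finsupp.finsetSum_apply]

theorem op_smul_eq_mul (c : K) (f : Laurent K) : MulOpposite.op c • f = f * mono 0 c :=
  ext_cf fun i => by rw [cf_smul, cf_mul_mono, sub_zero, MulOpposite.unop_op]

/-- All exponents occurring in `f` lie between `a` and `b`. -/
def Within (f : Laurent K) (a b : ℤ) : Prop := ∀ i, cf f i ≠ 0 → a ≤ i ∧ i ≤ b

theorem exists_bounds {f : Laurent K} (hf : f ≠ 0) :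
    ∃ a b, cf f a ≠ 0 ∧ cf f b ≠ 0 ∧ Within f a b := by
  have hne : f.coeff.support.Nonempty := Finsupp.support_nonempty_iff.2 (by simpa using hf)
  refine ⟨Multiplicative.toAdd (f.coeff.support.min' hne),
    Multiplicative.toAdd (f.coeff.support.max' hne),
    Finsupp.mem_support_iff.1 (Finset.min'_mem _ hne),
    Finsupp.mem_support_iff.1 (Finset.max'_mem _ hne), fun i hi => ?_⟩
  have : Multiplicative.ofAdd i ∈ f.coeff.support := Finsupp.mem_support_iff.2 hi
  exact ⟨Finset.min'_le _ _ this, Finset.le_max' _ _ this⟩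

theorem cf_mul_of_unique {f g : Laurent K} {a c : ℤ}
    (h : ∀ i j, cf f i ≠ 0 → cf g j ≠ 0 → i + j = a + c → i = a) :
    cf (f * g) (a + c) = cf f a * cf g c := by
  rw [cf, ofAdd_add]
  refine MonoidAlgebra.coeff_mul_mul_of_uniqueMul ?_
  intro i j hi hj hij
  have h1 := h (Multiplicative.toAdd i) (Multiplicative.toAdd j) (Finsupp.mem_support_iff.1 hi)
    (Finsupp.mem_support_iff.1 hj) hij
  have h2 : i = Multiplicative.ofAdd a := h1
  refine ⟨h2, ?_⟩
  rw [h2] at hij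
  exact mul_left_cancel hij

/-- A multiple of `f` whose exponents span less than the width of `f` vanishes. -/
theorem eq_zero_of_mul_within {f g : Laurent K} {a b : ℤ} (ha : cf f a ≠ 0) (hb : cf f b ≠ 0)
    (hf : Within f a b) {l r : ℤ} (hfg : Within (f * g) l r) (hlr : r - l < b - a) : g = 0 := by
  by_contra hg
  obtain ⟨c, d, hc, hd, hgw⟩ := exists_bounds hg
  have h1 : cf (f * g) (a + c) ≠ 0 := by
    rw [cf_mul_of_unique]
    · exact mul_ne_zero ha hc
    · intro i j hi hj hij
      have := (hf i hi).1
      have := (hgw j hj).1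
      omega
  have h2 : cf (f * g) (b + d) ≠ 0 := by
    rw [cf_mul_of_unique]
    · exact mul_ne_zero hb hd
    · intro i j hi hj hij
      have := (hf i hi).2
      have := (hgw j hj).2
      omega
  have := (hfg _ h1).1
  have := (hfg _ h2).2
  have := (hgw _ hc).2
  omega

/-- Left multiplication by a Laurent polynomial, as a map of right `K`-vector spaces. -/
def mulLin (f : Laurent K) : Laurent K →ₗ[Kᵐᵒᵖ] Laurent K where
  toFun g := f * g
  map_add' := mul_add f
  map_smul' c g := by
    obtain ⟨c, rfl⟩ := MulOpposite.op_surjective c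
    rw [op_smul_eq_mul, RingHom.id_apply, op_smul_eq_mul, mul_assoc]

theorem mem_span_of_within {f : Laurent K} {d : ℕ} (hf : Within f 0 ((d : ℤ) - 1)) :
    f ∈ Submodule.span Kᵐᵒᵖ (Set.range fun i : Fin d => mono (i : ℤ) (1 : K)) := by
  have : f = ∑ i : Fin d, MulOpposite.op (cf f i) • mono (i : ℤ) (1 : K) := by
    refine ext_cf fun j => ?_
    rw [cf_sum]
    simp only [cf_smul, cf_mono, MulOpposite.unop_op, ite_mul, one_mul, zero_mul]
    by_cases hj : cf f j = 0
    · rw [hj, Finset.sum_eq_zero]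
      intro i _
      split_ifs with h
      · rw [h, hj]
      · rfl
    · obtain ⟨h1, h2⟩ := hf j hj
      have hjd : j.toNat < d := by omega
      rw [Finset.sum_eq_single ⟨j.toNat, hjd⟩]
      · rw [if_pos (by simpa using h1)]
        simp [h1]
      · intro i _ hi
        rw [if_neg]
        intro hij
        exact hi (Fin.ext (by simp [← hij]))
      · simp
  rw [this]
  exact Submodule.sum_mem _ fun i _ => Submodule.smul_mem _ _ (Submodule.subset_span ⟨i, rfl⟩)

/-- The monomials `1, u, …, u^(d-1)` span a complement of `f K[u, u⁻¹]`, where `d` is the width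
of `f`. -/
theorem span_sup_range_mulLin {f : Laurent K} {a : ℤ} {d : ℕ} (ha : cf f a ≠ 0)
    (hb : cf f (a + d) ≠ 0) (hf : Within f a (a + d)) :
    Submodule.span Kᵐᵒᵖ (Set.range fun i : Fin d => mono (i : ℤ) (1 : K)) ⊔
      LinearMap.range (mulLin f) = ⊤ := by
  set S := Submodule.span Kᵐᵒᵖ (Set.range fun i : Fin d => mono (i : ℤ) (1 : K))
  set W := S ⊔ LinearMap.range (mulLin f)
  have hS : ∀ i : ℤ, 0 ≤ i → i < d → mono i (1 : K) ∈ W := fun i h0 hi =>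
    le_sup_left (a := S) (Submodule.subset_span ⟨⟨i.toNat, by omega⟩, by simp [h0]⟩)
  -- An element of the image which differs from a monomial by something in the span.
  have hmono : ∀ (i j : ℤ) (c : K), Within (mono i 1 - f * mono j c) 0 ((d : ℤ) - 1) →
      mono i (1 : K) ∈ W := by
    intro i j c h
    rw [← sub_add_cancel (mono i (1 : K)) (f * mono j c)]
    exact W.add_mem (le_sup_left (a := S) (mem_span_of_within h))
      (le_sup_right (a := S) ⟨mono j c, rfl⟩)
  have hd : mono (d : ℤ) (1 : K) ∈ W := by
    refine hmono d (-a) (cf f (a + d))⁻¹ fun i hi => ?_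
    rw [cf_sub, cf_mono, cf_mul_mono, sub_neg_eq_add] at hi
    have hid : i ≠ d := by
      rintro rfl
      rw [if_pos rfl, add_comm, mul_inv_cancel₀ hb, sub_self] at hi
      exact hi rfl
    rw [if_neg hid.symm, zero_sub, neg_ne_zero] at hi
    have := hf _ (left_ne_zero_of_mul hi)
    omega
  have hm1 : mono (-1 : ℤ) (1 : K) ∈ W := by
    refine hmono (-1) (-a - 1) (cf f a)⁻¹ fun i hi => ?_
    rw [cf_sub, cf_mono, cf_mul_mono] at hi
    have hid : i ≠ -1 := by
      rintro rfl
      rw [if_pos rfl, show -1 - (-a - 1) = a by ring, mul_inv_cancel₀ ha, sub_self] at hi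
      exact hi rfl
    rw [if_neg hid.symm, zero_sub, neg_ne_zero] at hi
    have := hf _ (left_ne_zero_of_mul hi)
    omega
  let mulR : ℤ → (Laurent K →ₗ[Kᵐᵒᵖ] Laurent K) := fun j =>
    { toFun := fun g => g * mono j 1
      map_add' := fun g h => add_mul g h _
      map_smul' := fun c g => by
        obtain ⟨c, rfl⟩ := MulOpposite.op_surjective c
        rw [op_smul_eq_mul, RingHom.id_apply, op_smul_eq_mul, mul_assoc, mul_assoc,
          mono_mul_mono, mono_mul_mono, add_comm, one_mul, mul_one] }
  have hstab : ∀ j : ℤ, (∀ i : ℤ, 0 ≤ i → i < d → mono (i + j) (1 : K) ∈ W) →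
      ∀ g ∈ W, g * mono j 1 ∈ W := by
    intro j hj
    have : W ≤ W.comap (mulR j) := by
      refine sup_le (Submodule.span_le.2 ?_) ?_
      · rintro _ ⟨i, rfl⟩
        change mono (i : ℤ) (1 : K) * mono j 1 ∈ W
        rw [mono_mul_mono, one_mul]
        exact hj i (by omega) (by omega)
      · rintro _ ⟨g, rfl⟩
        refine le_sup_right (a := S) ⟨g * mono j 1, ?_⟩
        exact (mul_assoc f g _).symm
    exact this
  have hup : ∀ g ∈ W, g * mono 1 1 ∈ W := hstab 1 fun i h0 hi => by
    by_cases h : i + 1 < d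
    · exact hS _ (by omega) h
    · rwa [show i + 1 = d by omega]
  have hdown : ∀ g ∈ W, g * mono (-1) 1 ∈ W := hstab (-1) fun i h0 hi => by
    by_cases h : 0 ≤ i + -1
    · exact hS _ h (by omega)
    · rwa [show i + -1 = -1 by omega]
  have h0 : mono 0 (1 : K) ∈ W := by
    have := hup _ hm1
    rwa [mono_mul_mono, one_mul] at this
  have hall : ∀ i : ℤ, mono i (1 : K) ∈ W := by
    intro i
    induction i using Int.induction_on with
    | zero => exact h0
    | succ i ih =>
      have := hup _ ih
      rwa [mono_mul_mono, one_mul] at this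
    | pred i ih =>
      have := hdown _ ih
      rwa [mono_mul_mono, one_mul] at this
  rw [eq_top_iff]
  intro g _
  induction g using MonoidAlgebra.induction_linear with
  | zero => exact W.zero_mem
  | add x y hx hy => exact W.add_mem (hx trivial) (hy trivial)
  | single m r =>
    have : MonoidAlgebra.single m r = MulOpposite.op r • mono (Multiplicative.toAdd m) (1 : K) := by
      rw [op_smul_eq_mul, mono_mul_mono, one_mul, add_zero]
      rfl
    rw [this]
    exact W.smul_mem _ (hall _)

/-- The cokernel of multiplication by `f` has dimension the width of `f`. -/
theorem codim_range_mulLin {f : Laurent K} {a : ℤ} {d : ℕ} (ha : cf f a ≠ 0)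
    (hb : cf f (a + d) ≠ 0) (hf : Within f a (a + d)) :
    AlmostLE ⊤ (LinearMap.range (mulLin f)) ∧ codim ⊤ (LinearMap.range (mulLin f)) = d := by
  set R := LinearMap.range (mulLin f)
  let v : Fin d → Laurent K := fun i => mono (i : ℤ) (1 : K)
  have hspan : (⊤ : Submodule Kᵐᵒᵖ (Laurent K)).map R.mkQ =
      Submodule.span Kᵐᵒᵖ (Set.range (R.mkQ ∘ v)) := by
    rw [← span_sup_range_mulLin ha hb hf, Submodule.map_sup, Submodule.mkQ_map_self, sup_bot_eq,
      Submodule.map_span, Set.range_comp]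
  have hli : LinearIndependent Kᵐᵒᵖ (R.mkQ ∘ v) := by
    rw [Fintype.linearIndependent_iff]
    intro c hc
    have hmem : ∑ i, c i • v i ∈ R := by
      rw [← Submodule.Quotient.mk_eq_zero, ← Submodule.mkQ_apply, map_sum]
      simpa using hc
    obtain ⟨g, hg⟩ := hmem
    have hcf : ∀ j : ℤ, cf (∑ i, c i • v i) j =
        ∑ i : Fin d, if (i : ℤ) = j then (c i).unop else 0 := by
      intro j
      rw [cf_sum]
      simp only [v, cf_smul, cf_mono, ite_mul, one_mul, zero_mul]
    have hg0 : g = 0 := by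
      refine eq_zero_of_mul_within (l := 0) (r := (d : ℤ) - 1) ha hb hf ?_ (by omega)
      intro j hj
      change cf (mulLin f g) j ≠ 0 at hj
      rw [hg, hcf] at hj
      obtain ⟨i, -, hi⟩ := Finset.exists_ne_zero_of_sum_ne_zero hj
      have : (i : ℤ) = j := by
        by_contra h
        rw [if_neg h] at hi
        exact hi rfl
      omega
    intro i
    have := hcf i
    rw [← hg, hg0, map_zero, Finset.sum_eq_single i] at this
    · simpa [cf] using this.symm
    · intro i' _ hi'
      rw [if_neg]
      exact fun h => hi' (Fin.ext (by exact_mod_cast h))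
    · simp
  refine ⟨?_, ?_⟩
  · rw [AlmostLE, hspan]
    exact Module.Finite.span_of_finite _ (Set.finite_range _)
  · rw [codim, hspan, finrank_span_eq_card hli, Fintype.card_fin]

end Laurent

end Laurent

/-! ### The field of fractions of the Laurent polynomials -/

section LaurentField

/-- The skew field of fractions of `K[u, u⁻¹]`. -/
abbrev LaurentField (K : Type*) [DivisionRing K] : Type _ := OreField K (Multiplicative ℤ)

variable {K : Type*} [DivisionRing K]

theorem toOre_injective (D H : Type*) [DivisionRing D] [CommGroup H] [IsMulTorsionFree H] :
    Function.Injective (toOre D H) :=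
  OreLocalization.numeratorHom_inj fun _ h => h.1

theorem toOre_ne_zero {D H : Type*} [DivisionRing D] [CommGroup H] [IsMulTorsionFree H]
    {p : MonoidAlgebra D H} (hp : p ≠ 0) : toOre D H p ≠ 0 :=
  (map_ne_zero_iff _ (toOre_injective D H)).2 hp

theorem exists_toOre_eq {D H : Type*} [DivisionRing D] [CommGroup H] [IsMulTorsionFree H]
    (x : OreField D H) : ∃ p q : MonoidAlgebra D H, q ≠ 0 ∧ x = (toOre D H q)⁻¹ * toOre D H p := by
  induction x using OreLocalization.ind with
  | _ r s =>
    refine ⟨r, s, nonZeroDivisors.coe_ne_zero s, ?_⟩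
    rw [eq_inv_mul_iff_mul_eq₀ (toOre_ne_zero (nonZeroDivisors.coe_ne_zero s))]
    exact OreLocalization.mul_cancel

/-- The inclusion of the constants. -/
def constHom (K : Type*) [DivisionRing K] : K →+* LaurentField K :=
  (toOre K (Multiplicative ℤ)).comp MonoidAlgebra.singleOneRingHom

/-- `Frac(K[u, u⁻¹])` as a right vector space over the constants. -/
instance : Module Kᵐᵒᵖ (LaurentField K) := Module.compHom _ (RingHom.op (constHom K))

instance : SMulCommClass Kᵐᵒᵖ (LaurentField K) (LaurentField K) :=
  ⟨fun c x y => (mul_assoc x y (constHom K c.unop))⟩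

/-- The embedding of the Laurent polynomials into their field of fractions, as a map of right
`K`-vector spaces. -/
def laurentLin (K : Type*) [DivisionRing K] : Laurent K →ₗ[Kᵐᵒᵖ] LaurentField K where
  toFun := toOre K (Multiplicative ℤ)
  map_add' := map_add _
  map_smul' c f := by
    obtain ⟨c, rfl⟩ := MulOpposite.op_surjective c
    rw [Laurent.op_smul_eq_mul, map_mul]
    rfl

theorem laurentLin_injective : Function.Injective (laurentLin K) := toOre_injective _ _

/-- The Laurent polynomials as a lattice in their field of fractions. -/
def laurentLattice (K : Type*) [DivisionRing K] : Submodule Kᵐᵒᵖ (LaurentField K) :=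
  LinearMap.range (laurentLin K)

theorem map_lmul_laurentLattice (f : Laurent K) :
    (laurentLattice K).map (lmul Kᵐᵒᵖ (toOre K _ f)) =
      (LinearMap.range (Laurent.mulLin f)).map (laurentLin K) := by
  rw [laurentLattice, ← LinearMap.range_comp, ← LinearMap.range_comp]
  congr 1
  exact LinearMap.ext fun g => (map_mul (toOre K (Multiplicative ℤ)) f g).symm

theorem almostLE_map_lmul {f : Laurent K} (hf : f ≠ 0) :
    AlmostLE (laurentLattice K) ((laurentLattice K).map (lmul Kᵐᵒᵖ (toOre K _ f))) := by
  obtain ⟨a, b, ha, hb, h⟩ := Laurent.exists_bounds hf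
  obtain ⟨d, rfl⟩ := Int.le.dest (h a ha).2
  have := (Laurent.codim_range_mulLin ha hb h).1.map (laurentLin K)
  rwa [Submodule.map_top, ← map_lmul_laurentLattice] at this

/-- For `x = q⁻¹ p` the lattice is mapped by `p` into itself, and by `q⁻¹` into a lattice in which
it has finite codimension, since multiplication by `q` has a finite-dimensional cokernel. -/
theorem isLattice_laurentLattice : IsLattice (laurentLattice K) := by
  intro x
  obtain ⟨p, q, hq, rfl⟩ := exists_toOre_eq x
  have h1 : ∀ y z : LaurentField K, lmul Kᵐᵒᵖ (y * z) = lmul Kᵐᵒᵖ y ∘ₗ lmul Kᵐᵒᵖ z :=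
    fun y z => LinearMap.ext fun w => mul_assoc y z w
  have h2 : (laurentLattice K).map (lmul Kᵐᵒᵖ (toOre K _ p)) ≤ laurentLattice K := by
    rw [map_lmul_laurentLattice, Submodule.map_le_iff_le_comap]
    rintro g -
    exact ⟨g, rfl⟩
  have h3 := (almostLE_map_lmul hq).map (lmul Kᵐᵒᵖ (toOre K (Multiplicative ℤ) q)⁻¹)
  rw [← Submodule.map_comp, ← h1, inv_mul_cancel₀ (toOre_ne_zero hq),
    show lmul Kᵐᵒᵖ (1 : LaurentField K) = LinearMap.id from LinearMap.ext fun y => one_mul y,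
    Submodule.map_id] at h3
  rw [h1, Submodule.map_comp]
  exact h3.mono_left (Submodule.map_mono h2)

/-- The weight of a Laurent polynomial is its width. -/
theorem weight_toOre {f : Laurent K} {a b : ℤ} (ha : Laurent.cf f a ≠ 0)
    (hb : Laurent.cf f b ≠ 0) (h : Laurent.Within f a b) :
    weight (laurentLattice K) (toOre K (Multiplicative ℤ) f) = b - a := by
  obtain ⟨d, rfl⟩ := Int.le.dest (h a ha).2
  have hle : (LinearMap.range (Laurent.mulLin f)).map (laurentLin K) ≤ laurentLattice K := by
    rw [Submodule.map_le_iff_le_comap]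
    rintro g -
    exact ⟨g, rfl⟩
  rw [weight, map_lmul_laurentLattice, relIndex_of_le hle, laurentLattice,
    LinearMap.range_eq_map (laurentLin K), codim_map_of_injective _ _ laurentLin_injective,
    (Laurent.codim_range_mulLin ha hb h).2]
  ring

end LaurentField

/-! ### The deformation of the coefficient field along a character -/

section Deform

theorem realExtension_latticePoint {H : Type*} [CommGroup H] (χ : H →* Multiplicative ℤ) (h : H) :
    realExtension χ (latticePoint h) = ((Multiplicative.toAdd (χ h) : ℤ) : ℝ) := by
  simp [realExtension, latticePoint]

variable {D H : Type*} [DivisionRing D] [CommGroup H] [IsMulTorsionFree H]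

/-- The homomorphism `H → K[u, u⁻¹]^×`, `h ↦ h u^{χ(h)}`, where `K = Ore(DH)`. -/
def deformMonoidHom (D : Type*) [DivisionRing D] (χ : H →* Multiplicative ℤ) :
    H →* Laurent (OreField D H) where
  toFun h := MonoidAlgebra.single (χ h) (toOre D H (MonoidAlgebra.single h 1))
  map_one' := by rw [map_one, ← MonoidAlgebra.one_def, map_one, ← MonoidAlgebra.one_def]
  map_mul' g h := by
    rw [MonoidAlgebra.single_mul_single, ← map_mul, ← map_mul, MonoidAlgebra.single_mul_single,
      mul_one]

/-- The constants `D → K[u, u⁻¹]`. -/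
def deformConst (D H : Type*) [DivisionRing D] [CommGroup H] [IsMulTorsionFree H] :
    D →+* Laurent (OreField D H) :=
  MonoidAlgebra.singleOneRingHom.comp ((toOre D H).comp MonoidAlgebra.singleOneRingHom)

theorem deformConst_apply (d : D) : deformConst D H d =
    MonoidAlgebra.single 1 (toOre D H (MonoidAlgebra.single 1 d)) := rfl

theorem deformMonoidHom_apply (χ : H →* Multiplicative ℤ) (h : H) : deformMonoidHom D χ h =
    MonoidAlgebra.single (χ h) (toOre D H (MonoidAlgebra.single h 1)) := rfl

theorem commute_deform (χ : H →* Multiplicative ℤ) (d : D) (h : H) :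
    Commute (deformConst D H d) (deformMonoidHom D χ h) := by
  rw [deformConst_apply, deformMonoidHom_apply]
  refine MonoidAlgebra.single_commute_single (Commute.one_left _) ?_
  refine Commute.map (f := toOre D H) (x := MonoidAlgebra.single 1 d) ?_
  exact MonoidAlgebra.single_commute_single (Commute.one_left _) (Commute.one_right _)

/-- The homomorphism `DH → K[u, u⁻¹]`, `d h ↦ d h u^{χ(h)}`, where `K = Ore(DH)`. -/
def deformLaurent (χ : H →* Multiplicative ℤ) : MonoidAlgebra D H →+* Laurent (OreField D H) :=
  MonoidAlgebra.liftNCRingHom (deformConst D H) (deformMonoidHom D χ) (commute_deform χ)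

theorem deformLaurent_single (χ : H →* Multiplicative ℤ) (h : H) (d : D) :
    deformLaurent χ (MonoidAlgebra.single h d) =
      MonoidAlgebra.single (χ h) (toOre D H (MonoidAlgebra.single h d)) := by
  rw [deformLaurent, MonoidAlgebra.liftNCRingHom_single, deformConst_apply, deformMonoidHom_apply,
    MonoidAlgebra.single_mul_single, one_mul, ← map_mul, MonoidAlgebra.single_mul_single, one_mul,
    mul_one]

open Classical in
theorem cf_deformLaurent (χ : H →* Multiplicative ℤ) (p : MonoidAlgebra D H) (i : ℤ) :
    Laurent.cf (deformLaurent χ p) i = toOre D H (MonoidAlgebra.ofCoeff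
      (p.coeff.filter fun h => χ h = Multiplicative.ofAdd i)) := by
  induction p using MonoidAlgebra.induction_linear with
  | zero => simp [Laurent.cf, Finsupp.filter_zero]
  | add x y hx hy =>
    rw [map_add, Laurent.cf_add, hx, hy, MonoidAlgebra.coeff_add, Finsupp.filter_add,
      MonoidAlgebra.ofCoeff_add, map_add]
  | single h d =>
    rw [deformLaurent_single, Laurent.cf, MonoidAlgebra.coeff_single, MonoidAlgebra.coeff_single,
      Finsupp.single_apply]
    split_ifs with hh
    · rw [Finsupp.filter_single_of_pos (fun h => χ h = Multiplicative.ofAdd i) hh,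
        MonoidAlgebra.ofCoeff_single]
    · rw [Finsupp.filter_single_of_neg (fun h => χ h = Multiplicative.ofAdd i) hh,
        MonoidAlgebra.ofCoeff_zero, map_zero]

/-- Since elements of `H` are linearly independent in `K` over `D`, the terms of `p` in one degree
cannot cancel. -/
theorem cf_deformLaurent_ne_zero (χ : H →* Multiplicative ℤ) (p : MonoidAlgebra D H) (i : ℤ) :
    Laurent.cf (deformLaurent χ p) i ≠ 0 ↔
      ∃ h, p.coeff h ≠ 0 ∧ χ h = Multiplicative.ofAdd i := by
  classical
  rw [cf_deformLaurent, map_ne_zero_iff _ (toOre_injective D H), Ne, MonoidAlgebra.ofCoeff_eq_zero,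
    Finsupp.filter_eq_zero_iff]
  push Not
  exact exists_congr fun h => and_comm

theorem deformLaurent_ne_zero (χ : H →* Multiplicative ℤ) {p : MonoidAlgebra D H} (hp : p ≠ 0) :
    deformLaurent χ p ≠ 0 := by
  have : p.coeff ≠ 0 := by simpa using hp
  obtain ⟨h, hh⟩ := Finsupp.ne_iff.1 this
  intro h0
  refine (cf_deformLaurent_ne_zero χ p (Multiplicative.toAdd (χ h))).2 ⟨h, hh, rfl⟩ ?_
  rw [h0]
  rfl

/-- The extension of `deformLaurent` to a homomorphism `K → Frac(K[u, u⁻¹])`. -/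
def deform (χ : H →* Multiplicative ℤ) : OreField D H →+* LaurentField (OreField D H) :=
  OreLocalization.universalHom ((toOre _ _).comp (deformLaurent χ))
    { toFun := fun s => Units.mk0 (toOre _ _ (deformLaurent χ s))
        (toOre_ne_zero (deformLaurent_ne_zero χ (nonZeroDivisors.coe_ne_zero s)))
      map_one' := by ext; simp
      map_mul' := fun s t => by ext; simp }
    (fun _ => rfl)

theorem deform_toOre (χ : H →* Multiplicative ℤ) (p : MonoidAlgebra D H) :
    deform χ (toOre D H p) = toOre _ _ (deformLaurent χ p) :=
  OreLocalization.universalHom_commutes _ _ _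

theorem isGreatest_convexHull {s : Set ℝ} {b : ℝ} (h : IsGreatest s b) :
    IsGreatest (convexHull ℝ s) b :=
  ⟨subset_convexHull ℝ s h.1, convexHull_min h.2 (convex_Iic b)⟩

theorem isLeast_convexHull {s : Set ℝ} {b : ℝ} (h : IsLeast s b) :
    IsLeast (convexHull ℝ s) b :=
  ⟨subset_convexHull ℝ s h.1, convexHull_min h.2 (convex_Ici b)⟩

/-- The width of the Newton polytope of `p` is the dimension of the cokernel of the deformation
of `p`. -/
theorem polytopeWidth_newtonPolytope (χ : H →* Multiplicative ℤ) {p : MonoidAlgebra D H}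
    (hp : p ≠ 0) : polytopeWidth (realExtension χ) (newtonPolytope p hp) =
      (weight (laurentLattice (OreField D H)) (deform χ (toOre D H p)) : ℝ) := by
  obtain ⟨a, b, ha, hb, hab⟩ := Laurent.exists_bounds (deformLaurent_ne_zero χ hp)
  rw [deform_toOre, weight_toOre ha hb hab]
  obtain ⟨h₁, hh₁, ha⟩ := (cf_deformLaurent_ne_zero χ p a).1 ha
  obtain ⟨h₂, hh₂, hb⟩ := (cf_deformLaurent_ne_zero χ p b).1 hb
  have hall : ∀ h, p.coeff h ≠ 0 →
      a ≤ Multiplicative.toAdd (χ h) ∧ Multiplicative.toAdd (χ h) ≤ b :=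
    fun h hh => hab _ ((cf_deformLaurent_ne_zero χ p _).2 ⟨h, hh, rfl⟩)
  have himg : realExtension χ '' (newtonPolytope p hp : Set (RealSpan H)) =
      convexHull ℝ ((fun h => ((Multiplicative.toAdd (χ h) : ℤ) : ℝ)) ''
        (p.coeff.support : Set H)) := by
    rw [newtonPolytope, LinearMap.image_convexHull, Set.image_image]
    simp_rw [realExtension_latticePoint]
  have hmax := isGreatest_convexHull (s := (fun h => ((Multiplicative.toAdd (χ h) : ℤ) : ℝ)) ''
      (p.coeff.support : Set H)) (b := (b : ℝ)) ⟨⟨h₂, by simpa using hh₂, by simp [hb]⟩, by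
        rintro _ ⟨h, hh, rfl⟩
        exact Int.cast_le.2 (hall h (by simpa using hh)).2⟩
  have hmin := isLeast_convexHull (s := (fun h => ((Multiplicative.toAdd (χ h) : ℤ) : ℝ)) ''
      (p.coeff.support : Set H)) (b := (a : ℝ)) ⟨⟨h₁, by simpa using hh₁, by simp [ha]⟩, by
        rintro _ ⟨h, hh, rfl⟩
        exact Int.cast_le.2 (hall h (by simpa using hh)).1⟩
  change sSup (realExtension χ '' (newtonPolytope p hp : Set (RealSpan H))) -
    sInf (realExtension χ '' (newtonPolytope p hp : Set (RealSpan H))) = _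
  rw [himg, hmax.csSup_eq, hmin.csInf_eq]
  push_cast
  rfl

/-- The weight of the deformation, as a homomorphism on the units of `K`. -/
def weightHom (χ : H →* Multiplicative ℤ) : (OreField D H)ˣ →* Multiplicative ℤ where
  toFun x :=
    Multiplicative.ofAdd (weight (laurentLattice (OreField D H)) (deform χ (x : OreField D H)))
  map_one' := by
    rw [Units.val_one, map_one, weight_one, ofAdd_zero]
  map_mul' x y := by
    rw [Units.val_mul, map_mul, isLattice_laurentLattice.weight_mul, ofAdd_add] <;> simp

/-- The `χ`-width of the polytope of a class in `K^×_ab` is the weight of any representative: both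
are homomorphisms to an abelian group, and they agree on `DH ∖ {0}`. -/
theorem width_of_isPolytope (χ : H →* Multiplicative ℤ) {x : OreField D H}
    {P : PolytopeGroup H} (h : IsPolytope (toAb x) P) :
    width χ P = (weight (laurentLattice (OreField D H)) (deform χ x) : ℝ) := by
  obtain ⟨p, q, hp, hq, hx, rfl⟩ := h
  have hp' := toOre_ne_zero hp
  have hq' := toOre_ne_zero hq
  have hy : (toOre D H q)⁻¹ * toOre D H p ≠ 0 := mul_ne_zero (inv_ne_zero hq') hp'
  have hx0 : x ≠ 0 := by
    rintro rfl
    rw [toAb, toAb, dif_pos rfl, dif_neg hy] at hx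
    exact WithZero.coe_ne_zero hx.symm
  rw [toAb, toAb, dif_neg hx0, dif_neg hy, WithZero.coe_inj] at hx
  have h1 := congrArg (Abelianization.lift (weightHom χ)) hx
  rw [Abelianization.lift_apply_of, Abelianization.lift_apply_of] at h1
  have h2 : weight (laurentLattice (OreField D H)) (deform χ x) =
      weight (laurentLattice (OreField D H)) (deform χ ((toOre D H q)⁻¹ * toOre D H p)) :=
    congrArg Multiplicative.toAdd h1
  have h3 : weight (laurentLattice (OreField D H)) (deform χ (toOre D H p)) =
      weight (laurentLattice (OreField D H)) (deform χ (toOre D H q)) +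
      weight (laurentLattice (OreField D H)) (deform χ ((toOre D H q)⁻¹ * toOre D H p)) := by
    rw [← isLattice_laurentLattice.weight_mul (by simpa using hq') (by simpa using ⟨hq', hp'⟩),
      ← map_mul, mul_inv_cancel_left₀ hq']
  have hof : ∀ Q : integralPolytopes H, width χ (Algebra.GrothendieckAddGroup.of Q) =
      polytopeWidth (realExtension χ) Q := fun Q =>
    DFunLike.congr_fun
      (Algebra.GrothendieckAddGroup.lift.symm_apply_apply (polytopeWidth (realExtension χ))) Q
  rw [map_sub, hof, hof, polytopeWidth_newtonPolytope, polytopeWidth_newtonPolytope, h2, h3]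
  push_cast
  ring

theorem exists_isPolytope {x : OreField D H} (hx : x ≠ 0) : ∃ P, IsPolytope (toAb x) P := by
  obtain ⟨p, q, hq, rfl⟩ := exists_toOre_eq x
  have hp : p ≠ 0 := by
    rintro rfl
    simp at hx
  exact ⟨_, p, q, hp, hq, rfl, rfl⟩

end Deform

/-! ### Matrices and linear maps of right vector spaces -/

section Matrices

variable {F : Type*} [DivisionRing F] {I J : Type*} [Fintype J] [DecidableEq J]

/-- The matrix of a linear map between right vector spaces of columns. -/
def matOf (s : (J → F) →ₗ[Fᵐᵒᵖ] (I → F)) : Matrix I J F := Matrix.of fun i j => s (Pi.single j 1) i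

theorem matOf_mulVec (s : (J → F) →ₗ[Fᵐᵒᵖ] (I → F)) (v : J → F) : (matOf s).mulVec v = s v := by
  have hv : v = ∑ j, MulOpposite.op (v j) • (Pi.single j 1 : J → F) := by
    ext j
    simp [Finset.sum_apply, Pi.single_apply]
  conv_rhs => rw [hv]
  ext i
  simp [Matrix.mulVec, dotProduct, matOf]

theorem matLin_injective {k : Type*} [DivisionRing k] [Module k F] [SMulCommClass k F F] :
    Function.Injective (matLin k : Matrix I J F → _) := by
  intro A B h
  ext i j
  have := congrFun (LinearMap.congr_fun h (Pi.single j 1)) i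
  simpa using this

theorem isUnit_of_mulVec_injective {A : Matrix J J F} (h : ∀ v, A.mulVec v = 0 → v = 0) :
    IsUnit A := by
  have hfin : Module.Finite Fᵐᵒᵖ F := ⟨⟨{1}, by
    rw [eq_top_iff]
    intro x _
    rw [show x = MulOpposite.op x • (1 : F) by simp]
    exact Submodule.smul_mem _ _ (Submodule.subset_span (by simp))⟩⟩
  let e := LinearEquiv.ofInjectiveEndo (matLin Fᵐᵒᵖ A)
    ((injective_iff_map_eq_zero (matLin Fᵐᵒᵖ A)).2 h)
  refine isUnit_iff_exists.2 ⟨matOf e.symm.toLinearMap, ?_, ?_⟩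
  · apply matLin_injective (k := Fᵐᵒᵖ)
    rw [matLin_mul, matLin_one]
    refine LinearMap.ext fun v => ?_
    simp only [LinearMap.comp_apply, matLin_apply, matOf_mulVec]
    exact e.apply_symm_apply v
  · apply matLin_injective (k := Fᵐᵒᵖ)
    rw [matLin_mul, matLin_one]
    refine LinearMap.ext fun v => ?_
    simp only [LinearMap.comp_apply, matLin_apply, matOf_mulVec]
    exact e.symm_apply_apply v

/-- An injective linear map between spaces of columns does not decrease the dimension. -/
theorem card_le_of_injective_columns [Fintype I] (s : (J → F) →ₗ[Fᵐᵒᵖ] (I → F))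
    (hs : Function.Injective s) : Fintype.card J ≤ Fintype.card I := by
  have hfin : Module.Finite Fᵐᵒᵖ F := ⟨⟨{1}, by
    rw [eq_top_iff]
    intro x _
    rw [show x = MulOpposite.op x • (1 : F) by simp]
    exact Submodule.smul_mem _ _ (Submodule.subset_span (by simp))⟩⟩
  have h := LinearMap.finrank_le_finrank_of_injective hs
  rw [Module.finrank_pi_fintype, Module.finrank_pi_fintype, Finset.sum_const, Finset.sum_const,
    Finset.card_univ, Finset.card_univ, smul_eq_mul, smul_eq_mul] at h
  exact Nat.le_of_mul_le_mul_right h Module.finrank_pos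

end Matrices

/-! ### The total complex and its contraction -/

theorem AlmostLE.map_add {k V W : Type*} [DivisionRing k] [AddCommGroup V] [Module k V]
    [AddCommGroup W] [Module k W] {X : Submodule k V} {Y : Submodule k W} {f g : V →ₗ[k] W}
    (hf : AlmostLE (X.map f) Y) (hg : AlmostLE (X.map g) Y) : AlmostLE (X.map (f + g)) Y := by
  refine (hf.sup hg).mono_left ?_
  rintro _ ⟨x, hx, rfl⟩
  exact Submodule.add_mem_sup ⟨x, hx, rfl⟩ ⟨x, hx, rfl⟩

theorem AlmostLE.map_mul {k V : Type*} [DivisionRing k] [AddCommGroup V] [Module k V]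
    {X Y Z : Submodule k V} {f g : Module.End k V} (hf : AlmostLE (X.map f) Y)
    (hg : AlmostLE (Y.map g) Z) : AlmostLE (X.map (g * f)) Z := by
  rw [Module.End.mul_eq_comp, Submodule.map_comp]
  exact (hf.map g).trans hg

namespace BasedComplex

variable {R : Type*} [Ring R] {k F : Type*} [DivisionRing k] [DivisionRing F] [Module k F]
  [SMulCommClass k F F] {n : ℕ}

/-- The total space of the complex `C ⊗_R F^n`. -/
abbrev Tot (C : BasedComplex R) (n : ℕ) (F : Type*) : Type _ := ∀ l, C.Idx n l → F

/-- The differential of the total space. -/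
def totD (k : Type*) [DivisionRing k] [Module k F] [SMulCommClass k F F] (C : BasedComplex R)
    (ρ : R →+* Matrix (Fin n) (Fin n) F) : Module.End k (C.Tot n F) :=
  LinearMap.pi fun l => matLin k (C.tensorD ρ l (l + 1)) ∘ₗ LinearMap.proj (l + 1)

/-- The action on the total space of maps of degree one, such as a contraction `γ`. -/
def totC (k : Type*) [DivisionRing k] [Module k F] [SMulCommClass k F F] (C : BasedComplex R)
    (γ : ∀ k l, Matrix (C.Idx n k) (C.Idx n l) F) : Module.End k (C.Tot n F) :=
  LinearMap.pi fun l => match l with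
    | 0 => 0
    | l + 1 => matLin k (γ (l + 1) l) ∘ₗ LinearMap.proj l

variable {C : BasedComplex R} {ρ : R →+* Matrix (Fin n) (Fin n) F}
  {γ : ∀ k l, Matrix (C.Idx n k) (C.Idx n l) F}

theorem totD_apply (w : C.Tot n F) (l : ℕ) :
    totD k C ρ w l = (C.tensorD ρ l (l + 1)).mulVec (w (l + 1)) := rfl

theorem totC_zero (w : C.Tot n F) : totC k C γ w 0 = 0 := rfl

theorem totC_succ (w : C.Tot n F) (l : ℕ) :
    totC k C γ w (l + 1) = (γ (l + 1) l).mulVec (w l) := rfl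

theorem tensorD_mul_tensorD (C : BasedComplex R) (ρ : R →+* Matrix (Fin n) (Fin n) F)
    (i j l : ℕ) : C.tensorD ρ i j * C.tensorD ρ j l = 0 := by
  have h : ((C.d i j).map ρ) * ((C.d j l).map ρ) = 0 := by
    rw [← Matrix.map_mul, C.d_comp_d, Matrix.map_zero _ (map_zero ρ)]
  ext ⟨a, b⟩ ⟨c, d⟩
  have h1 := congrFun (congrFun (congrFun (congrFun h a) c) b) d
  simpa [tensorD, Matrix.mul_apply, Matrix.comp_apply, Matrix.sum_apply,
    Fintype.sum_prod_type] using h1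

theorem tensorD_shape (C : BasedComplex R) (ρ : R →+* Matrix (Fin n) (Fin n) F) {i j : ℕ}
    (h : j ≠ i + 1) : C.tensorD ρ i j = 0 := by
  ext ⟨a, b⟩ ⟨c, d⟩
  simp [tensorD, C.shape i j h, Matrix.comp_apply]

theorem totD_mul_totD : totD k C ρ * totD k C ρ = 0 := by
  refine LinearMap.ext fun w => funext fun l => ?_
  rw [Module.End.mul_apply, totD_apply, totD_apply, Matrix.mulVec_mulVec, tensorD_mul_tensorD,
    Matrix.zero_mulVec]
  rfl

theorem totD_mul_totC (hγ : C.IsContraction ρ γ) :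
    totD k C ρ * totC k C γ + totC k C γ * totD k C ρ = 1 := by
  refine LinearMap.ext fun w => funext fun l => ?_
  rw [LinearMap.add_apply, Pi.add_apply, Module.End.mul_apply, Module.End.mul_apply, totD_apply,
    totC_succ, Matrix.mulVec_mulVec]
  cases l with
  | zero =>
    rw [totC_zero, add_zero, hγ.zero, Matrix.one_mulVec]
    rfl
  | succ l =>
    rw [totC_succ, totD_apply, Matrix.mulVec_mulVec, ← Matrix.add_mulVec, hγ.succ,
      Matrix.one_mulVec]
    rfl

/-- The matrix entries of `d + γ` on the total space. -/
theorem totD_add_totC_single (hγ : C.IsContraction ρ γ) (j : ℕ) (y : C.Idx n j → F) (l : ℕ) :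
    (totD k C ρ + totC k C γ) (Pi.single j y) l = (C.tensorD ρ l j + γ l j).mulVec y := by
  rw [LinearMap.add_apply, Pi.add_apply, Matrix.add_mulVec]
  congr 1
  · rw [totD_apply]
    by_cases h : j = l + 1
    · subst h
      rw [Pi.single_eq_same]
    · rw [Pi.single_eq_of_ne (Ne.symm h), Matrix.mulVec_zero, tensorD_shape C ρ h,
        Matrix.zero_mulVec]
  · cases l with
    | zero => rw [totC_zero, hγ.shape 0 j (by omega), Matrix.zero_mulVec]
    | succ l =>
      rw [totC_succ]
      by_cases h : j = l
      · subst h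
        rw [Pi.single_eq_same]
      · rw [Pi.single_eq_of_ne (Ne.symm h), Matrix.mulVec_zero, hγ.shape (l + 1) j (by omega),
          Matrix.zero_mulVec]

/-- Endomorphisms of the total space of a finite complex which raise the degree are nilpotent. -/
theorem pow_eq_zero_of_shift {N : ℕ} (hN : ∀ l, N ≤ l → C.rank l = 0)
    {ν : Module.End k (C.Tot n F)}
    (hν : ∀ i (w : C.Tot n F), (∀ j < i, w j = 0) → ∀ j < i + 1, ν w j = 0) :
    ν ^ N = 0 := by
  have key : ∀ r (w : C.Tot n F), ∀ j < r, (ν ^ r) w j = 0 := by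
    intro r
    induction r with
    | zero => intro w j hj; omega
    | succ r ih =>
      intro w
      rw [pow_succ', Module.End.mul_apply]
      exact hν r _ (ih w)
  refine LinearMap.ext fun w => funext fun j => ?_
  by_cases hj : j < N
  · exact key N w j hj
  · have : IsEmpty (Fin (C.rank j)) := by
      rw [hN j (not_lt.1 hj)]
      infer_instance
    exact Subsingleton.elim _ _

theorem totC_shift (i : ℕ) (w : C.Tot n F) (h : ∀ j < i, w j = 0) :
    ∀ j < i + 1, totC k C γ w j = 0 := by
  intro j hj
  cases j with
  | zero => rfl
  | succ j => rw [totC_succ, h j (by omega), Matrix.mulVec_zero]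

theorem totD_shift (i : ℕ) (w : C.Tot n F) (h : ∀ j < i + 1, w j = 0) :
    ∀ j < i, totD k C ρ w j = 0 := by
  intro j hj
  rw [totD_apply, h _ (by omega), Matrix.mulVec_zero]

/-- Products of `γ` with `γ` or `γ d γ` are nilpotent. -/
theorem isNilpotent_totC {N : ℕ} (hN : ∀ l, N ≤ l → C.rank l = 0) :
    (totC k C γ * totC k C γ) ^ N = 0 ∧
    (totC k C γ * totD k C ρ * totC k C γ * totC k C γ) ^ N = 0 := by
  refine ⟨pow_eq_zero_of_shift hN fun i w h j hj => ?_,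
    pow_eq_zero_of_shift hN fun i w h j hj => ?_⟩
  · exact totC_shift (i + 1) _ (totC_shift i w h) j (by omega)
  · exact totC_shift _ _ (totD_shift _ _ (totC_shift _ _ (totC_shift i w h))) j (by omega)

theorem injective_one_add {V : Type*} [AddCommGroup V] [Module k V] {ν : Module.End k V} {r : ℕ}
    (hν : ν ^ r = 0) : Function.Injective (1 + ν : Module.End k V) := by
  have := geom_sum_mul_neg (-ν) r
  rw [neg_pow ν r, hν, mul_zero, sub_zero, sub_neg_eq_add] at this
  exact Function.LeftInverse.injective (g := (∑ i ∈ Finset.range r, (-ν) ^ i : Module.End k V))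
    fun x => LinearMap.congr_fun this x

/-- The square of `d + γ` is the unipotent map `1 + γ²`. -/
theorem totD_add_totC_injective (hγ : C.IsContraction ρ γ) :
    Function.Injective (totD k C ρ + totC k C γ) := by
  obtain ⟨N, hN⟩ := C.finite
  have h : (totD k C ρ + totC k C γ) * (totD k C ρ + totC k C γ) =
      1 + totC k C γ * totC k C γ := by
    have h1 := totD_mul_totD (k := k) (C := C) (ρ := ρ)
    have h2 := totD_mul_totC (k := k) hγ
    rw [add_mul, mul_add, mul_add, h1, zero_add, ← add_assoc, h2]
  have h3 := injective_one_add (isNilpotent_totC (k := k) (γ := γ) (ρ := ρ) hN).1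
  rw [← h] at h3
  exact Function.Injective.of_comp (f := (totD k C ρ + totC k C γ : Module.End k (C.Tot n F))) h3

/-- The inclusion into the total space of the part with degrees in `p`, in terms of an enumeration
of its basis. -/
def incl (k : Type*) [DivisionRing k] [Module k F] {J : Type*} {p : ℕ → Prop} [DecidablePred p]
    (o : J ≃ {x : Σ l, C.Idx n l // p x.1}) : (J → F) →ₗ[k] C.Tot n F where
  toFun v l i := if h : p l then v (o.symm ⟨⟨l, i⟩, h⟩) else 0
  map_add' v w := by
    ext l i
    by_cases h : p l <;> simp [h]
  map_smul' c v := by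
    ext l i
    by_cases h : p l <;> simp [h]

section Incl

variable {J : Type*} {p : ℕ → Prop} [DecidablePred p] (o : J ≃ {x : Σ l, C.Idx n l // p x.1})

theorem incl_apply_of_pos (v : J → F) {l : ℕ} (h : p l) (i : C.Idx n l) :
    incl k o v l i = v (o.symm ⟨⟨l, i⟩, h⟩) := dif_pos h

theorem incl_apply_of_neg (v : J → F) {l : ℕ} (h : ¬ p l) : incl k o v l = 0 :=
  funext fun _ => dif_neg h

theorem incl_apply (v : J → F) (j : J) : incl k o v (o j).1.1 (o j).1.2 = v j := by
  rw [incl_apply_of_pos o v (o j).2]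
  exact congrArg v (o.symm_apply_apply j)

theorem incl_injective : Function.Injective (incl k o : (J → F) →ₗ[k] C.Tot n F) := by
  intro v w h
  ext j
  rw [← incl_apply (k := k) o v j, h, incl_apply]

theorem exists_incl_eq {w : C.Tot n F} (hw : ∀ l, ¬ p l → w l = 0) :
    incl k o (fun j => w (o j).1.1 (o j).1.2) = w := by
  ext l i
  by_cases h : p l
  · rw [incl_apply_of_pos o _ h, Equiv.apply_symm_apply]
  · rw [incl_apply_of_neg o _ h, hw l h]

theorem incl_single [DecidableEq J] (j : J) (x : F) :
    incl k o (Pi.single j x) = Pi.single (o j).1.1 (Pi.single (o j).1.2 x) := by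
  ext l i
  by_cases h : p l
  · rw [incl_apply_of_pos o _ h]
    by_cases hj : o.symm ⟨⟨l, i⟩, h⟩ = j
    · subst hj
      rw [Pi.single_eq_same, Equiv.apply_symm_apply, Pi.single_eq_same, Pi.single_eq_same]
    · rw [Pi.single_eq_of_ne hj]
      have hne : (⟨l, i⟩ : Σ l, C.Idx n l) ≠ (o j).1 := fun he =>
        hj (by rw [Equiv.symm_apply_eq]; exact Subtype.ext he)
      by_cases hl : l = (o j).1.1
      · subst hl
        rw [Pi.single_eq_same, Pi.single_eq_of_ne]
        rintro rfl
        exact hne rfl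
      · rw [Pi.single_eq_of_ne hl]
        rfl
  · rw [incl_apply_of_neg o _ h, Pi.single_eq_of_ne]
    rintro rfl
    exact h (o j).2

end Incl

/-- The part of the total space over a parity is mapped by `d + γ` to the other parity. -/
theorem totD_add_totC_parity {p q : ℕ → Prop}
    (hpq : ∀ l, p (l + 1) → q l) (hqp : ∀ l, p l → q (l + 1)) {w : C.Tot n F}
    (hw : ∀ l, ¬ p l → w l = 0) : ∀ l, ¬ q l → (totD k C ρ + totC k C γ) w l = 0 := by
  intro l hl
  rw [LinearMap.add_apply, Pi.add_apply, totD_apply, hw _ fun h => hl (hpq l h),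
    Matrix.mulVec_zero, zero_add]
  cases l with
  | zero => rfl
  | succ l => rw [totC_succ, hw _ fun h => hl (hqp l h), Matrix.mulVec_zero]

/-- The injective map `d + γ` bounds the number of basis elements of one parity by that of the
other. -/
theorem card_parity_le (hγ : C.IsContraction ρ γ) {p q : ℕ → Prop} [DecidablePred p]
    [DecidablePred q] (hpq : ∀ l, p (l + 1) → q l) (hqp : ∀ l, p l → q (l + 1))
    [Fintype {x : Σ l, C.Idx n l // p x.1}] [Fintype {x : Σ l, C.Idx n l // q x.1}] :
    Fintype.card {x : Σ l, C.Idx n l // p x.1} ≤ Fintype.card {x : Σ l, C.Idx n l // q x.1} := by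
  classical
  let s : ({x : Σ l, C.Idx n l // p x.1} → F) →ₗ[Fᵐᵒᵖ] ({x : Σ l, C.Idx n l // q x.1} → F) :=
    (LinearMap.pi fun x => LinearMap.proj x.1.2 ∘ₗ LinearMap.proj x.1.1 :
      C.Tot n F →ₗ[Fᵐᵒᵖ] _) ∘ₗ (totD Fᵐᵒᵖ C ρ + totC Fᵐᵒᵖ C γ) ∘ₗ incl Fᵐᵒᵖ (Equiv.refl _)
  refine card_le_of_injective_columns s ?_
  have h1 : ∀ v, incl Fᵐᵒᵖ (Equiv.refl _) (s v) =
      (totD Fᵐᵒᵖ C ρ + totC Fᵐᵒᵖ C γ) (incl Fᵐᵒᵖ (Equiv.refl _) v) := fun v =>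
    exists_incl_eq (k := Fᵐᵒᵖ) (Equiv.refl {x : Σ l, C.Idx n l // q x.1})
      (totD_add_totC_parity hpq hqp fun l hl => incl_apply_of_neg _ v hl)
  intro v w h
  refine incl_injective (k := Fᵐᵒᵖ) (Equiv.refl _) (totD_add_totC_injective (k := Fᵐᵒᵖ) hγ ?_)
  rw [← h1, ← h1, h]

/-- The torsion matrix is the matrix of `d + γ`. -/
theorem incl_torsionMatrix (hγ : C.IsContraction ρ γ) {m : ℕ} (o : Fin m ≃ C.OddIdx n)
    (e : Fin m ≃ C.EvenIdx n) (v : Fin m → F) :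
    incl k o (((C.torsionMatrix ρ γ).submatrix o e).mulVec v) =
      (totD k C ρ + totC k C γ) (incl k e v) := by
  have : incl k o ∘ₗ matLin k ((C.torsionMatrix ρ γ).submatrix o e) =
      (totD k C ρ + totC k C γ) ∘ₗ incl k e := by
    refine LinearMap.pi_ext fun s x => ?_
    rw [LinearMap.comp_apply, LinearMap.comp_apply, incl_single, matLin_apply]
    ext l i
    rw [totD_add_totC_single hγ]
    by_cases h : Odd l
    · rw [incl_apply_of_pos o _ h]
      simp [torsionMatrix]
    · rw [incl_apply_of_neg o _ h, tensorD_shape, hγ.shape, add_zero, Matrix.zero_mulVec]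
      · intro hl
        exact h (by rw [hl]; exact (e s).2.add_one)
      · intro hl
        have := (e s).2
        rw [hl, Nat.even_add_one] at this
        exact h (Nat.not_even_iff_odd.1 this)
  exact LinearMap.congr_fun this v

theorem isUnit_torsionMatrix (hγ : C.IsContraction ρ γ) {m : ℕ} (o : Fin m ≃ C.OddIdx n)
    (e : Fin m ≃ C.EvenIdx n) : IsUnit ((C.torsionMatrix ρ γ).submatrix o e) := by
  refine isUnit_of_mulVec_injective fun v hv => ?_
  have h := incl_torsionMatrix (k := Fᵐᵒᵖ) hγ o e v
  rw [hv, map_zero, ← map_zero (totD Fᵐᵒᵖ C ρ + totC Fᵐᵒᵖ C γ)] at h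
  have h2 := totD_add_totC_injective hγ h
  rw [← map_zero (incl Fᵐᵒᵖ e)] at h2
  exact (incl_injective e h2).symm

/-- The even and the odd part of an acyclic finite complex have bases of the same size. -/
theorem exists_orderings (hγ : C.IsContraction ρ γ) :
    ∃ m, Nonempty (Fin m ≃ C.OddIdx n) ∧ Nonempty (Fin m ≃ C.EvenIdx n) := by
  classical
  obtain ⟨N, hN⟩ := C.finite
  have hfin : Finite (Σ l, C.Idx n l) := by
    refine Finite.of_injective (β := Σ l : Fin N, C.Idx n l)
      (fun x => ⟨⟨x.1, ?_⟩, x.2⟩) ?_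
    · by_contra h
      have h0 := hN x.1 (not_lt.1 h)
      exact absurd x.2.1.2 (by omega)
    · rintro ⟨l, i⟩ ⟨l', i'⟩ h
      simp only [Sigma.mk.injEq, Fin.mk.injEq] at h
      obtain ⟨rfl, h⟩ := h
      rw [eq_of_heq h]
  have : Fintype (C.OddIdx n) := Fintype.ofFinite _
  have : Fintype (C.EvenIdx n) := Fintype.ofFinite _
  have h1 : Fintype.card (C.EvenIdx n) ≤ Fintype.card (C.OddIdx n) :=
    card_parity_le (p := Even) (q := Odd) hγ
      (fun l h => Nat.not_even_iff_odd.1 (Nat.even_add_one.1 h)) (fun l h => h.add_one)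
  have h2 : Fintype.card (C.OddIdx n) ≤ Fintype.card (C.EvenIdx n) :=
    card_parity_le (p := Odd) (q := Even) hγ
      (fun l h => Nat.not_odd_iff_even.1 (Nat.odd_add_one.1 h)) (fun l h => h.add_one)
  exact ⟨Fintype.card (C.OddIdx n), ⟨(Fintype.equivFin _).symm⟩,
    ⟨(Fintype.equivFinOfCardEq (le_antisymm h1 h2)).symm⟩⟩

end BasedComplex

/-! ### The torsion as an Euler characteristic -/

namespace BasedComplex

variable {R : Type*} [Ring R] {k F : Type*} [DivisionRing k] [DivisionRing F] [Module k F]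
  [SMulCommClass k F F] {n : ℕ} {C : BasedComplex R} {ρ : R →+* Matrix (Fin n) (Fin n) F}
  {γ : ∀ k l, Matrix (C.Idx n k) (C.Idx n l) F} {Λ : Submodule k F}

/-- The cycles of the lattice `C ⊗_R Λ^n`. -/
def latCycles (C : BasedComplex R) (ρ : R →+* Matrix (Fin n) (Fin n) F) (Λ : Submodule k F) :
    ∀ l, Submodule k (C.Idx n l → F)
  | 0 => lat Λ _
  | l + 1 => lat Λ _ ⊓ LinearMap.ker (matLin k (C.tensorD ρ l (l + 1)))

/-- The boundaries of the lattice `C ⊗_R Λ^n`. -/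
def latBoundaries (C : BasedComplex R) (ρ : R →+* Matrix (Fin n) (Fin n) F) (Λ : Submodule k F)
    (l : ℕ) : Submodule k (C.Idx n l → F) :=
  (lat Λ (C.Idx n (l + 1))).map (matLin k (C.tensorD ρ l (l + 1)))

/-- The differentials preserve the lattices of columns with entries in `Λ`. -/
def Preserves (C : BasedComplex R) (ρ : R →+* Matrix (Fin n) (Fin n) F) (Λ : Submodule k F) :
    Prop :=
  ∀ l, latBoundaries C ρ Λ l ≤ lat Λ (C.Idx n l)

/-- The lattice `B ⊕ γ B` adapted to the decomposition of the total space given by a contraction;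
here `B` denotes the boundaries of `C ⊗_R Λ^n`. -/
def adapted (C : BasedComplex R) (ρ : R →+* Matrix (Fin n) (Fin n) F)
    (γ : ∀ k l, Matrix (C.Idx n k) (C.Idx n l) F) (Λ : Submodule k F) :
    ∀ l, Submodule k (C.Idx n l → F)
  | 0 => latBoundaries C ρ Λ 0
  | l + 1 => latBoundaries C ρ Λ (l + 1) ⊔
      (latBoundaries C ρ Λ l).map (matLin k (γ (l + 1) l))

theorem latBoundaries_le_latCycles (hd : Preserves C ρ Λ) (l : ℕ) :
    latBoundaries C ρ Λ l ≤ latCycles C ρ Λ l := by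
  cases l with
  | zero => exact hd 0
  | succ l =>
    refine le_inf (hd _) ?_
    rintro _ ⟨v, -, rfl⟩
    rw [LinearMap.mem_ker, matLin_apply, matLin_apply, Matrix.mulVec_mulVec, tensorD_mul_tensorD,
      Matrix.zero_mulVec]

theorem contract_boundary (hγ : C.IsContraction ρ γ) {l : ℕ} {b : C.Idx n l → F}
    (hb : b ∈ latBoundaries C ρ Λ l) :
    (C.tensorD ρ l (l + 1)).mulVec ((γ (l + 1) l).mulVec b) = b := by
  cases l with
  | zero => rw [Matrix.mulVec_mulVec, hγ.zero, Matrix.one_mulVec]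
  | succ l =>
    obtain ⟨v, -, rfl⟩ := hb
    have h := hγ.succ l
    rw [← eq_sub_iff_add_eq] at h
    rw [Matrix.mulVec_mulVec, h, Matrix.sub_mulVec, Matrix.one_mulVec, matLin_apply,
      ← Matrix.mulVec_mulVec, Matrix.mulVec_mulVec _ (C.tensorD ρ l (l + 1)), tensorD_mul_tensorD,
      Matrix.zero_mulVec, Matrix.mulVec_zero, sub_zero]

/-- The summand `γ B` of the adapted lattice is killed by `d γ`. -/
theorem contract_contract_boundary (hγ : C.IsContraction ρ γ) {l : ℕ} {b : C.Idx n l → F}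
    (hb : b ∈ latBoundaries C ρ Λ l) :
    (C.tensorD ρ (l + 1) (l + 2)).mulVec
      ((γ (l + 2) (l + 1)).mulVec ((γ (l + 1) l).mulVec b)) = 0 := by
  have h := hγ.succ l
  rw [← eq_sub_iff_add_eq] at h
  rw [Matrix.mulVec_mulVec, h, Matrix.sub_mulVec, Matrix.one_mulVec, ← Matrix.mulVec_mulVec,
    contract_boundary hγ hb, sub_self]

theorem contract_adapted (hγ : C.IsContraction ρ γ) {l : ℕ} {w : C.Idx n l → F}
    (hw : w ∈ adapted C ρ γ Λ l) :
    (C.tensorD ρ l (l + 1)).mulVec ((γ (l + 1) l).mulVec w) ∈ latBoundaries C ρ Λ l := by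
  cases l with
  | zero => rw [contract_boundary hγ hw]; exact hw
  | succ l =>
    obtain ⟨b, hb, _, ⟨c, hc, rfl⟩, rfl⟩ := Submodule.mem_sup.1 hw
    rw [matLin_apply, Matrix.mulVec_add, Matrix.mulVec_add, contract_boundary hγ hb,
      contract_contract_boundary hγ hc, add_zero]
    exact hb

theorem mulVec_adapted (hγ : C.IsContraction ρ γ) {l : ℕ} {w : C.Idx n (l + 1) → F}
    (hw : w ∈ adapted C ρ γ Λ (l + 1)) :
    (C.tensorD ρ l (l + 1)).mulVec w ∈ latBoundaries C ρ Λ l := by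
  obtain ⟨b, ⟨v, -, rfl⟩, _, ⟨c, hc, rfl⟩, rfl⟩ := Submodule.mem_sup.1 hw
  rw [matLin_apply, matLin_apply, Matrix.mulVec_add, contract_boundary hγ hc,
    Matrix.mulVec_mulVec, tensorD_mul_tensorD, Matrix.zero_mulVec, zero_add]
  exact hc

theorem latBoundaries_le_adapted (l : ℕ) : latBoundaries C ρ Λ l ≤ adapted C ρ γ Λ l := by
  cases l with
  | zero => exact le_rfl
  | succ l => exact le_sup_left

/-- By the formula `1 = d γ + γ d`, every column is the sum of one in `d γ Λ^n`, which lies almost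
in the boundaries `B`, and one in `γ d Λ^n = γ B`. -/
theorem commens_adapted (hΛ : IsLattice Λ) (hγ : C.IsContraction ρ γ) (hd : Preserves C ρ Λ)
    (l : ℕ) : Commens (lat Λ (C.Idx n l)) (adapted C ρ γ Λ l) := by
  have h1 : ∀ l, AlmostLE ((lat Λ (C.Idx n l)).map
      (matLin k (C.tensorD ρ l (l + 1) * γ (l + 1) l))) (latBoundaries C ρ Λ l) := by
    intro l
    rw [matLin_mul, Submodule.map_comp]
    exact (hΛ.map_matLin _).map _
  cases l with
  | zero =>
    refine ⟨?_, almostLE_of_le (hd 0)⟩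
    have := h1 0
    rwa [hγ.zero, matLin_one, Submodule.map_id] at this
  | succ l =>
    refine ⟨?_, (almostLE_of_le (hd _)).sup ?_⟩
    · -- the identity is `d γ + γ d`
      have h2 := ((h1 (l + 1)).mono_right (le_sup_left (b := (latBoundaries C ρ Λ l).map
        (matLin k (γ (l + 1) l))))).map_add
        (g := matLin k (γ (l + 1) l * C.tensorD ρ l (l + 1))) (by
          rw [matLin_mul, Submodule.map_comp]
          exact almostLE_of_le le_sup_right)
      rwa [← matLin_add, hγ.succ, matLin_one, Submodule.map_id] at h2
    · exact ((almostLE_of_le (hd l)).map _).trans (hΛ.map_matLin _)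

/-- The homology of `C ⊗_R Λ^n` is finite-dimensional, and its dimension is the index of the
adapted lattice. -/
theorem relIndex_adapted (hΛ : IsLattice Λ) (hγ : C.IsContraction ρ γ) (hd : Preserves C ρ Λ)
    (l : ℕ) : AlmostLE (latCycles C ρ Λ l) (latBoundaries C ρ Λ l) ∧
      relIndex (lat Λ (C.Idx n l)) (adapted C ρ γ Λ l) =
        codim (latCycles C ρ Λ l) (latBoundaries C ρ Λ l) := by
  have hc := commens_adapted hΛ hγ hd l
  cases l with
  | zero => exact ⟨hc.1, relIndex_of_le (hd 0)⟩
  | succ l =>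
    set f := matLin k (C.tensorD ρ l (l + 1))
    have hker : adapted C ρ γ Λ (l + 1) ⊓ LinearMap.ker f = latBoundaries C ρ Λ (l + 1) := by
      refine le_antisymm ?_ (le_inf (latBoundaries_le_adapted _)
        ((latBoundaries_le_latCycles hd (l + 1)).trans inf_le_right))
      rintro _ ⟨hw, h0⟩
      obtain ⟨b, hb, _, ⟨c, hc, rfl⟩, rfl⟩ := Submodule.mem_sup.1 hw
      have hb0 : f b = 0 := ((latBoundaries_le_latCycles hd (l + 1)).trans inf_le_right) hb
      have h0' : f (b + matLin k (γ (l + 1) l) c) = 0 := h0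
      rw [map_add, hb0, zero_add] at h0'
      have hc0 : c = 0 := by rw [← contract_boundary hγ hc]; exact h0'
      rw [hc0, map_zero, add_zero]
      exact hb
    have hmap : (adapted C ρ γ Λ (l + 1)).map f = (lat Λ _).map f := by
      refine le_antisymm ?_ ?_
      · rintro _ ⟨w, hw, rfl⟩
        exact mulVec_adapted hγ hw
      · intro b hb
        exact ⟨matLin k (γ (l + 1) l) b, Submodule.mem_sup_right ⟨b, hb, rfl⟩,
          contract_boundary hγ hb⟩
    have h1 := relIndex_inf_ker_add_map hc f
    have h2 := (hc.1.inf_ker f)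
    rw [hker] at h1 h2
    rw [hmap, relIndex_self, add_zero] at h1
    refine ⟨h2, ?_⟩
    rw [← h1]
    exact relIndex_of_le (latBoundaries_le_latCycles hd (l + 1))

open Classical in
/-- The part of a graded subspace of the total space with degrees in `p`. -/
def part (p : ℕ → Prop) (X : ∀ l, Submodule k (C.Idx n l → F)) : Submodule k (C.Tot n F) :=
  Submodule.pi Set.univ fun l => if p l then X l else ⊥

theorem mem_part {p : ℕ → Prop} {X : ∀ l, Submodule k (C.Idx n l → F)} {w : C.Tot n F} :
    w ∈ part p X ↔ (∀ l, p l → w l ∈ X l) ∧ ∀ l, ¬ p l → w l = 0 := by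
  classical
  simp only [part, Submodule.mem_pi, Set.mem_univ, true_implies]
  refine ⟨fun h => ⟨fun l hl => by simpa [hl] using h l, fun l hl => by simpa [hl] using h l⟩,
    fun h l => ?_⟩
  by_cases hl : p l
  · simpa [hl] using h.1 l hl
  · simpa [hl] using h.2 l hl

theorem totD_part (hd : Preserves C ρ Λ) {p q : ℕ → Prop} (hpq : ∀ l, p (l + 1) ↔ q l) :
    (part p fun l => lat Λ (C.Idx n l)).map (totD k C ρ) ≤ part q fun l => lat Λ (C.Idx n l) := by
  rintro _ ⟨w, hw, rfl⟩
  rw [SetLike.mem_coe, mem_part] at hw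
  refine mem_part.2 ⟨fun l hl => ?_, fun l hl => ?_⟩
  · exact hd l ⟨w (l + 1), hw.1 _ ((hpq l).2 hl), rfl⟩
  · rw [totD_apply, hw.2 _ (fun h => hl ((hpq l).1 h)), Matrix.mulVec_zero]

/-- A contraction almost preserves the lattice, up to the shift of degrees. -/
theorem totC_part (hΛ : IsLattice Λ) {p q : ℕ → Prop} (hpq : ∀ l, p l ↔ q (l + 1)) :
    AlmostLE ((part p fun l => lat Λ (C.Idx n l)).map (totC k C γ))
      (part q fun l => lat Λ (C.Idx n l)) := by
  classical
  obtain ⟨N, hN⟩ := C.finite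
  let X : ℕ → Submodule k (C.Tot n F) := fun l =>
    ((if p l then lat Λ (C.Idx n l) else ⊥).map (matLin k (γ (l + 1) l))).map
      (LinearMap.single k (fun l => C.Idx n l → F) (l + 1))
  have hX : ∀ l, AlmostLE (X l) (part q fun l => lat Λ (C.Idx n l)) := by
    intro l
    by_cases hl : p l
    · simp only [X, if_pos hl]
      refine ((hΛ.map_matLin (γ (l + 1) l)).map _).mono_right ?_
      rintro _ ⟨v, hv, rfl⟩
      refine mem_part.2 ⟨fun j hj => ?_, fun j hj => ?_⟩
      · by_cases h : j = l + 1
        · subst h; simpa using hv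
        · rw [LinearMap.single_apply, Pi.single_eq_of_ne h]; exact zero_mem _
      · rw [LinearMap.single_apply, Pi.single_eq_of_ne]
        rintro rfl
        exact hj ((hpq l).1 hl)
    · simp only [X, if_neg hl, Submodule.map_bot]
      exact almostLE_of_le bot_le
  refine (AlmostLE.iSup (Finset.range N) fun l _ => hX l).mono_left ?_
  rintro _ ⟨w, hw, rfl⟩
  rw [SetLike.mem_coe, mem_part] at hw
  have hsum : totC k C γ w = ∑ l ∈ Finset.range N,
      LinearMap.single k (fun l => C.Idx n l → F) (l + 1) ((γ (l + 1) l).mulVec (w l)) := by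
    ext j i
    rw [Finset.sum_apply, Finset.sum_apply]
    cases j with
    | zero =>
      rw [totC_zero, Finset.sum_eq_zero]
      · rfl
      · intro l _
        rw [LinearMap.single_apply, Pi.single_eq_of_ne (by omega)]
        rfl
    | succ j =>
      rw [totC_succ, Finset.sum_eq_single j]
      · rw [LinearMap.single_apply, Pi.single_eq_same]
      · intro l _ hl
        rw [LinearMap.single_apply, Pi.single_eq_of_ne (by omega)]
        rfl
      · intro hj
        rw [Finset.mem_range, not_lt] at hj
        have : IsEmpty (Fin (C.rank j)) := by
          rw [hN j hj]
          infer_instance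
        rw [show w j = 0 from Subsingleton.elim _ _, Matrix.mulVec_zero, map_zero]
        rfl
  rw [hsum]
  refine Submodule.sum_mem _ fun l hl =>
    Submodule.mem_iSup_of_mem l (Submodule.mem_iSup_of_mem hl ⟨_, ⟨w l, ?_, rfl⟩, rfl⟩)
  by_cases h : p l
  · simpa [h] using hw.1 l h
  · simpa [h] using hw.2 l h

/-- With `γ' = γ d γ`, the involution `d + γ'` interchanges the even and the odd part of the
adapted lattice. -/
theorem map_part_adapted_le (hγ : C.IsContraction ρ γ) {p q : ℕ → Prop}
    (hpq : ∀ l, p (l + 1) ↔ q l) (hqp : ∀ l, p l ↔ q (l + 1)) :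
    (part p (adapted C ρ γ Λ)).map
      (totD k C ρ + totC k C γ * totD k C ρ * totC k C γ) ≤ part q (adapted C ρ γ Λ) := by
  rintro _ ⟨w, hw, rfl⟩
  rw [SetLike.mem_coe, mem_part] at hw
  have key : ∀ l, (totD k C ρ + totC k C γ * totD k C ρ * totC k C γ) w (l + 1) =
      (C.tensorD ρ (l + 1) (l + 2)).mulVec (w (l + 2)) +
      (γ (l + 1) l).mulVec ((C.tensorD ρ l (l + 1)).mulVec ((γ (l + 1) l).mulVec (w l))) :=
    fun l => rfl
  have key0 : (totD k C ρ + totC k C γ * totD k C ρ * totC k C γ) w 0 =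
      (C.tensorD ρ 0 1).mulVec (w 1) + 0 := rfl
  refine mem_part.2 ⟨fun l hl => ?_, fun l hl => ?_⟩
  · cases l with
    | zero =>
      rw [key0, add_zero]
      exact mulVec_adapted hγ (hw.1 1 ((hpq 0).2 hl))
    | succ l =>
      rw [key]
      exact Submodule.add_mem_sup (mulVec_adapted hγ (hw.1 _ ((hpq _).2 hl)))
        ⟨_, contract_adapted hγ (hw.1 l ((hqp l).2 hl)), rfl⟩
  · cases l with
    | zero => rw [key0, hw.2 1 (fun h => hl ((hpq 0).1 h)), Matrix.mulVec_zero, add_zero]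
    | succ l =>
      rw [key, hw.2 _ (fun h => hl ((hpq _).1 h)), hw.2 l (fun h => hl ((hqp l).1 h))]
      simp only [Matrix.mulVec_zero, add_zero]

theorem relIndex_part_adapted (hΛ : IsLattice Λ) (hγ : C.IsContraction ρ γ)
    (hd : Preserves C ρ Λ) {N : ℕ} (hN : ∀ l, N ≤ l → C.rank l = 0) (p : ℕ → Prop)
    [DecidablePred p] :
    Commens (part p fun l => lat Λ (C.Idx n l)) (part p (adapted C ρ γ Λ)) ∧
    relIndex (part p fun l => lat Λ (C.Idx n l)) (part p (adapted C ρ γ Λ)) =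
      ∑ l ∈ Finset.range N,
        if p l then (codim (latCycles C ρ Λ l) (latBoundaries C ρ Λ l) : ℤ) else 0 := by
  classical
  obtain ⟨h1, h2⟩ := relIndex_pi N (fun l => if p l then lat Λ (C.Idx n l) else ⊥)
    (fun l => if p l then adapted C ρ γ Λ l else ⊥)
    (fun l hl => by
      have : IsEmpty (Fin (C.rank l)) := by
        rw [hN l hl]
        infer_instance
      exact Subsingleton.elim _ _)
    (fun l => by
      split_ifs
      · exact commens_adapted hΛ hγ hd l
      · exact Commens.refl _)
  have e1 : (part p fun l => lat Λ (C.Idx n l)) =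
      Submodule.pi Set.univ fun l => if p l then lat Λ (C.Idx n l) else ⊥ := by
    unfold part; congr!
  have e2 : part p (adapted C ρ γ Λ) =
      Submodule.pi Set.univ fun l => if p l then adapted C ρ γ Λ l else ⊥ := by
    unfold part; congr!
  rw [e1, e2]
  refine ⟨h1, h2.trans (Finset.sum_congr rfl fun l _ => ?_)⟩
  split_ifs
  · exact (relIndex_adapted hΛ hγ hd l).2
  · exact relIndex_self _

/-- The index of the image of the even part of the lattice `C ⊗_R Λ^n` under `d + γ` in the odd part
is minus the Euler characteristic of `C ⊗_R Λ^n`. The involution `M' = d + γ d γ` differs from `d +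
γ` by a unipotent factor, which does not affect the index, and it interchanges the two parts of the
adapted lattice. Hence the index is that of the adapted lattice in the odd part minus that in the
even part. -/
theorem relIndex_totD_add_totC (hΛ : IsLattice Λ) (hγ : C.IsContraction ρ γ)
    (hd : Preserves C ρ Λ) {N : ℕ} (hN : ∀ l, N ≤ l → C.rank l = 0) :
    relIndex (part Odd fun l => lat Λ (C.Idx n l))
      ((part Even fun l => lat Λ (C.Idx n l)).map (totD k C ρ + totC k C γ)) =
      -∑ l ∈ Finset.range N,
        (-1) ^ l * (codim (latCycles C ρ Λ l) (latBoundaries C ρ Λ l) : ℤ) := by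
  set d := totD k C ρ
  set g := totC k C γ
  have hdd : d * d = 0 := totD_mul_totD
  have hdg : d * g + g * d = 1 := totD_mul_totC hγ
  -- `γ d γ` is a contraction with square zero
  set M' := d + g * d * g with hM'
  have hdg' : d * g = 1 - g * d := eq_sub_of_add_eq hdg
  have hdgd : d * g * d = d := by
    rw [hdg', sub_mul, one_mul, mul_assoc, hdd, mul_zero, sub_zero]
  have hgdg : g * d * g * (g * d * g) = 0 := by
    have h1 : d * g * (g * d) = 0 := by
      rw [hdg', sub_mul, one_mul, ← mul_assoc (g * d), mul_assoc g d g, mul_assoc g (d * g) d,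
        hdgd, sub_self]
    rw [show g * d * g * (g * d * g) = g * (d * g * (g * d)) * g by simp only [mul_assoc], h1,
      mul_zero, zero_mul]
  have hM'M' : M' * M' = 1 := by
    rw [hM', add_mul, mul_add, mul_add, hdd, hgdg, zero_add, add_zero]
    rw [show d * (g * d * g) = d * g * d * g by simp only [mul_assoc], hdgd,
      show g * d * g * d = g * (d * g * d) by simp only [mul_assoc], hdgd, hdg]
  have hM'M : M' * (d + g) = 1 + g * d * g * g := by
    rw [hM', add_mul, mul_add, mul_add, hdd, zero_add,
      show g * d * g * d = g * (d * g * d) by simp only [mul_assoc], hdgd, ← add_assoc, hdg]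
  have hinj : Function.Injective M' := by
    refine Function.LeftInverse.injective (g := M') fun x => ?_
    rw [← Module.End.mul_apply, hM'M']
    rfl
  set Lo := part Odd fun l => lat Λ (C.Idx n l)
  set Le := part Even fun l => lat Λ (C.Idx n l)
  have odd_iff : ∀ l, Odd (l + 1) ↔ Even l := fun l => by
    rw [Nat.odd_add_one, Nat.not_odd_iff_even]
  have even_iff : ∀ l, Even (l + 1) ↔ Odd l := fun l => by
    rw [Nat.even_add_one, Nat.not_even_iff_odd]
  have dE : AlmostLE (Le.map d) Lo := almostLE_of_le (totD_part hd even_iff)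
  have dO : AlmostLE (Lo.map d) Le := almostLE_of_le (totD_part hd odd_iff)
  have gE : AlmostLE (Le.map g) Lo := totC_part hΛ fun l => (odd_iff l).symm
  have gO : AlmostLE (Lo.map g) Le := totC_part hΛ fun l => (even_iff l).symm
  have mE : AlmostLE (Le.map M') Lo := dE.map_add (gE.map_mul (dO.map_mul gE))
  have mO : AlmostLE (Lo.map M') Le := dO.map_add (gO.map_mul (dE.map_mul gO))
  have hLe : (Le.map M').map M' = Le := by
    rw [← Submodule.map_comp, ← Module.End.mul_eq_comp, hM'M', Module.End.one_eq_id,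
      Submodule.map_id]
  have cO : Commens (Lo.map M') Le := ⟨mO, by have := mE.map M'; rwa [hLe] at this⟩
  obtain ⟨u1, u2⟩ := relIndex_unipotent (X := Le) (g * d * g * g) N
    (isNilpotent_totC (ρ := ρ) (γ := γ) hN).2 (gE.map_mul (gO.map_mul (dE.map_mul gO)))
  obtain ⟨co, io⟩ := relIndex_part_adapted hΛ hγ hd hN Odd
  obtain ⟨ce, ie⟩ := relIndex_part_adapted hΛ hγ hd hN Even
  have hadO : (part Odd (adapted C ρ γ Λ)).map M' = part Even (adapted C ρ γ Λ) := by
    refine le_antisymm (map_part_adapted_le hγ odd_iff fun l => (even_iff l).symm) ?_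
    have := Submodule.map_mono (f := M') (map_part_adapted_le (Λ := Λ) hγ even_iff
      fun l => (odd_iff l).symm)
    rwa [← Submodule.map_comp, ← Module.End.mul_eq_comp, hM'M', Module.End.one_eq_id,
      Submodule.map_id] at this
  have co' : Commens (Lo.map M') (part Even (adapted C ρ γ Λ)) := by
    rw [← hadO]
    exact co.map M'
  have io' : relIndex (Lo.map M') (part Even (adapted C ρ γ Λ)) =
      relIndex Lo (part Odd (adapted C ρ γ Λ)) := by
    rw [← hadO]
    exact relIndex_map_of_injective _ _ hinj
  rw [← relIndex_map_of_injective _ _ hinj, ← Submodule.map_comp, ← Module.End.mul_eq_comp, hM'M,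
    ← relIndex_add cO u1, u2, add_zero, ← relIndex_add co' ce.symm, io', io, relIndex_symm, ie,
    ← sub_eq_add_neg, ← Finset.sum_sub_distrib, ← Finset.sum_neg_distrib]
  refine Finset.sum_congr rfl fun l _ => ?_
  rcases Nat.even_or_odd l with h | h
  · rw [if_neg (Nat.not_odd_iff_even.2 h), if_pos h, h.neg_one_pow]
    ring
  · rw [if_pos h, if_neg (Nat.not_even_iff_odd.2 h), h.neg_one_pow]
    ring

theorem map_incl_lat {J : Type*} {p : ℕ → Prop} [DecidablePred p]
    (o : J ≃ {x : Σ l, C.Idx n l // p x.1}) :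
    (lat Λ J).map (incl k o) = part p fun l => lat Λ (C.Idx n l) := by
  ext w
  rw [mem_part, Submodule.mem_map]
  constructor
  · rintro ⟨v, hv, rfl⟩
    refine ⟨fun l hl => mem_lat.2 fun i => ?_, fun l hl => incl_apply_of_neg o v hl⟩
    rw [incl_apply_of_pos o v hl]
    exact mem_lat.1 hv _
  · rintro ⟨h1, h2⟩
    exact ⟨_, mem_lat.2 fun j => mem_lat.1 (h1 _ (o j).2) _, exists_incl_eq o h2⟩

/-- The weight of the torsion is minus the Euler characteristic of `C ⊗_R Λ^n`. -/
theorem weight_detRep_torsionMatrix (hΛ : IsLattice Λ) (hγ : C.IsContraction ρ γ)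
    (hd : Preserves C ρ Λ) {N : ℕ} (hN : ∀ l, N ≤ l → C.rank l = 0) {m : ℕ}
    (o : Fin m ≃ C.OddIdx n) (e : Fin m ≃ C.EvenIdx n) :
    weight Λ (detRep ((C.torsionMatrix ρ γ).submatrix o e)) =
      -∑ l ∈ Finset.range N,
        (-1) ^ l * (codim (latCycles C ρ Λ l) (latBoundaries C ρ Λ l) : ℤ) := by
  rw [← (hΛ.relIndex_eq_weight_detRep _ (isUnit_torsionMatrix hγ o e)).2,
    ← relIndex_map_of_injective _ _ (incl_injective (k := k) o), ← Submodule.map_comp,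
    show incl k o ∘ₗ matLin k ((C.torsionMatrix ρ γ).submatrix o e) =
      (totD k C ρ + totC k C γ) ∘ₗ incl k e from
      LinearMap.ext fun v => incl_torsionMatrix hγ o e v, Submodule.map_comp, map_incl_lat,
    map_incl_lat]
  exact relIndex_totD_add_totC hΛ hγ hd hN

end BasedComplex

/-! ### Derived functors computed from explicit resolutions -/

section Derived

variable {A : Type u} [Ring A]

/-- A complex of projective modules, exact in positive degrees and augmented onto `Z`, is a
projective resolution of `Z`. -/
theorem exists_projectiveResolution {Z : ModuleCat.{u} A} (Y : ChainComplex (ModuleCat.{u} A) ℕ)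
    (ε : Y.X 0 ⟶ Z) (sq₀ : Y.d 1 0 ≫ ε = 0)
    (hproj : ∀ l, Projective (Y.X l)) (hε : Function.Surjective ε.hom)
    (h₀ : ∀ x, ε.hom x = 0 → ∃ y, (Y.d 1 0).hom y = x)
    (h : ∀ l x, (Y.d (l + 1) l).hom x = 0 → ∃ y, (Y.d (l + 2) (l + 1)).hom y = x) :
    ∃ P : ProjectiveResolution Z, P.complex = Y := by
  let π := (Y.toSingle₀Equiv Z).symm ⟨ε, sq₀⟩
  have hπ : π.f 0 = ε := by simp [π, ChainComplex.toSingle₀Equiv]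
  have hq : QuasiIso π := ⟨fun m => by
    cases m with
    | zero =>
      rw [ChainComplex.quasiIsoAt₀_iff, ShortComplex.quasiIso_iff_of_zeros' _ ?_ rfl rfl]
      · constructor
        · rw [ShortComplex.moduleCat_exact_iff]
          intro x hx
          exact h₀ x (by
            rw [← hπ]
            exact hx)
        · change Epi (π.f 0)
          rw [hπ]
          exact (ModuleCat.epi_iff_surjective ε).2 hε
      · exact Y.shape 0 0 (by simp)
    | succ m =>
      rw [quasiIsoAt_iff_exactAt' (hL := ChainComplex.exactAt_succ_single_obj ..),
        HomologicalComplex.exactAt_iff' _ (m + 2) (m + 1) m (by simp) (by simp),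
        ShortComplex.moduleCat_exact_iff]
      exact h m⟩
  exact ⟨{ complex := Y, projective := hproj, π := π, quasiIso := hq }, rfl⟩

/-- The homology of a short complex of vector spaces, in terms of an embedding of its middle
term. -/
theorem nonempty_homology_equiv {k : Type*} [DivisionRing k] (S : ShortComplex (ModuleCat.{w} k))
    {V : Type*} [AddCommGroup V] [Module k V] (j : S.X₂ →ₗ[k] V) (hj : Function.Injective j) :
    Nonempty (S.homology ≃ₗ[k] ((LinearMap.ker S.g.hom).map j).map
      ((LinearMap.range S.f.hom).map j).mkQ) := by
  let B := (LinearMap.range S.f.hom).map j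
  let ψ : LinearMap.ker S.g.hom →ₗ[k] V ⧸ B := B.mkQ ∘ₗ j ∘ₗ (LinearMap.ker S.g.hom).subtype
  have hr : LinearMap.range ψ = ((LinearMap.ker S.g.hom).map j).map B.mkQ := by
    rw [LinearMap.range_comp, LinearMap.range_comp, Submodule.range_subtype]
  have hk : LinearMap.ker ψ = LinearMap.range S.moduleCatToCycles := by
    ext ⟨x, hx⟩
    simp only [ψ, LinearMap.mem_ker, LinearMap.comp_apply, Submodule.mkQ_apply,
      Submodule.Quotient.mk_eq_zero, Submodule.subtype_apply, B, Submodule.mem_map,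
      LinearMap.mem_range, Subtype.ext_iff]
    constructor
    · rintro ⟨_, ⟨y, rfl⟩, hy⟩
      exact ⟨y, hj hy⟩
    · rintro ⟨y, hy⟩
      exact ⟨_, ⟨y, rfl⟩, congrArg j hy⟩
  exact ⟨S.moduleCatHomologyIso.toLinearEquiv ≪≫ₗ (Submodule.quotEquivOfEq _ _ hk.symm ≪≫ₗ
    ψ.quotKerEquivRange ≪≫ₗ LinearEquiv.ofEq _ _ hr)⟩

/-- A left derived functor with values in vector spaces, computed from a projective resolution and
an embedding of the terms of the resulting complex. -/
theorem nonempty_leftDerived_equiv {k : Type*} [DivisionRing k] {Z : ModuleCat.{u} A}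
    (T : ModuleCat.{u} A ⥤ ModuleCat.{w} k) [T.Additive] (P : ProjectiveResolution Z)
    {Y : ChainComplex (ModuleCat.{u} A) ℕ} (hP : P.complex = Y) (l m : ℕ)
    (hm : (ComplexShape.down ℕ).next l = m)
    {V : Type*} [AddCommGroup V] [Module k V] (j : T.obj (Y.X l) →ₗ[k] V)
    (hj : Function.Injective j) {c b : Submodule k V}
    (hc : ∀ v, v ∈ c ↔ ∃ z, (T.map (Y.d l m)).hom z = 0 ∧ j z = v)
    (hb : ∀ v, v ∈ b ↔ ∃ z, j ((T.map (Y.d (l + 1) l)).hom z) = v) :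
    Nonempty ((T.leftDerived l).obj Z ≃ₗ[k] c.map b.mkQ) := by
  subst hP
  have hc' : c = (LinearMap.ker (T.map (P.complex.d l m)).hom).map j := by
    ext v
    rw [hc, Submodule.mem_map]
    rfl
  have hb' : b = (LinearMap.range (T.map (P.complex.d (l + 1) l)).hom).map j := by
    ext v
    rw [hb, Submodule.mem_map]
    exact ⟨fun ⟨z, hz⟩ => ⟨_, ⟨z, rfl⟩, hz⟩, fun ⟨_, ⟨z, hz⟩, h⟩ => ⟨z, by rw [hz, h]⟩⟩
  let Y := (T.mapHomologicalComplex (ComplexShape.down ℕ)).obj P.complex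
  obtain ⟨e⟩ := nonempty_homology_equiv (Y.sc' (l + 1) l m) j hj
  rw [hc', hb']
  exact ⟨((P.isoLeftDerivedObj T l).trans
    (Y.homologyIsoSc' (l + 1) l m (by simp) hm)).toLinearEquiv ≪≫ₗ e⟩

end Derived

/-! ### Restriction of a based resolution to a subgroup -/

section Restriction

variable {R S : Type u} [Ring R] [Ring S]

/-- The ring `R` as a right module over `S`, by restriction along `f : S → R`. -/
def Res (_ : S →+* R) : Type u := R

instance (f : S →+* R) : AddCommGroup (Res f) := inferInstanceAs (AddCommGroup R)

instance (f : S →+* R) : Module Sᵐᵒᵖ (Res f) := Module.compHom R (RingHom.op f)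

theorem op_smul_res (f : S →+* R) (s : S) (x : R) :
    (MulOpposite.op s • (show Res f from x)) = (show Res f from x * f s) := rfl

/-- Left multiplication by a matrix over `R`, as a map of right `S`-modules. -/
def colMap (f : S →+* R) {I J : Type*} [Fintype J] (A : Matrix I J R) :
    (J → Res f) →ₗ[Sᵐᵒᵖ] (I → Res f) where
  toFun v := A.mulVec (show J → R from v)
  map_add' := A.mulVec_add
  map_smul' c v := A.mulVec_smul (f.op c) (show J → R from v)

/-- The complex of right `S`-modules underlying a based complex. -/
def resComplex (f : S →+* R) (C : BasedComplex R) : ChainComplex (ModuleCat.{u} Sᵐᵒᵖ) ℕ where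
  X l := ModuleCat.of Sᵐᵒᵖ (Fin (C.rank l) → Res f)
  d l k := ModuleCat.ofHom (colMap f (C.d k l))
  shape l k h := by
    refine ModuleCat.hom_ext (LinearMap.ext fun v => ?_)
    have : C.d k l = 0 := C.shape k l fun h' => h (by simp [h'])
    change (C.d k l).mulVec _ = 0
    rw [this]
    exact Matrix.zero_mulVec _
  d_comp_d' l k j _ _ := by
    refine ModuleCat.hom_ext (LinearMap.ext fun v => ?_)
    change (C.d j k).mulVec ((C.d k l).mulVec _) = 0
    rw [Matrix.mulVec_mulVec, C.d_comp_d]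
    exact Matrix.zero_mulVec _

end Restriction

section Group

variable {G H : Type u} [Group G] [Group H]

/-- The homomorphism of group rings induced by a homomorphism of groups. -/
abbrev ringMap {G H : Type*} [Group G] [Group H] (ι : H →* G) :
    MonoidAlgebra ℤ H →+* MonoidAlgebra ℤ G :=
  MonoidAlgebra.mapDomainRingHom ℤ ι

theorem ringMap_single {G H : Type*} [Group G] [Group H] (ι : H →* G) (h : H) (z : ℤ) :
    ringMap ι (MonoidAlgebra.single h z) = MonoidAlgebra.single (ι h) z := by
  simp [ringMap]

theorem augmentation_single {G : Type*} [Group G] (g : G) (z : ℤ) :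
    augmentation G (MonoidAlgebra.single g z) = z := by
  simp [augmentation]

theorem augmentation_ringMap {G H : Type*} [Group G] [Group H] (ι : H →* G)
    (x : MonoidAlgebra ℤ H) :
    augmentation G (ringMap ι x) = augmentation H x := by
  induction x using MonoidAlgebra.induction_linear with
  | zero => simp
  | add x y hx hy => rw [map_add, map_add, map_add, hx, hy]
  | single h z => rw [ringMap_single, augmentation_single, augmentation_single]

/-- The group ring is projective over the group ring of a subgroup, since it is free on a set of
representatives of the cosets. -/
theorem projective_res (ι : H →* G) (hι : Function.Injective ι) :
    Module.Projective (MonoidAlgebra ℤ H)ᵐᵒᵖ (Res (ringMap ι)) := by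
  let t : G → G := fun g => (QuotientGroup.mk (s := ι.range) g).out
  have ht : ∀ g, ∃ h, ι h = (t g)⁻¹ * g := fun g =>
    QuotientGroup.eq.1 (Quotient.out_eq (QuotientGroup.mk (s := ι.range) g))
  choose h hh using ht
  have htm : ∀ g x, t (g * ι x) = t g := fun g x => by
    have : (QuotientGroup.mk (s := ι.range) (g * ι x)) = QuotientGroup.mk (s := ι.range) g :=
      QuotientGroup.eq.2 (by simp)
    simp only [t, this]
  have hhm : ∀ g x, h (g * ι x) = h g * x := fun g x => hι (by
    rw [hh, htm, map_mul, hh, mul_assoc])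
  let P : (G →₀ (MonoidAlgebra ℤ H)ᵐᵒᵖ) →ₗ[(MonoidAlgebra ℤ H)ᵐᵒᵖ] Res (ringMap ι) :=
    Finsupp.linearCombination _ fun g => (MonoidAlgebra.single g 1 : MonoidAlgebra ℤ G)
  let s₀ : MonoidAlgebra ℤ G →+ (G →₀ (MonoidAlgebra ℤ H)ᵐᵒᵖ) :=
    (Finsupp.liftAddHom fun g => (Finsupp.singleAddHom (t g)).comp
      (MulOpposite.opAddEquiv.toAddMonoidHom.comp (MonoidAlgebra.singleAddHom (h g)))).comp
      MonoidAlgebra.coeffAddEquiv.toAddMonoidHom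
  have hs₀ : ∀ g z, s₀ (MonoidAlgebra.single g z) =
      Finsupp.single (t g) (MulOpposite.op (MonoidAlgebra.single (h g) z)) := fun g z => by
    simp [s₀]
  have hlin : ∀ (y : MonoidAlgebra ℤ H) (x : MonoidAlgebra ℤ G),
      s₀ (x * ringMap ι y) = MulOpposite.op y • s₀ x := by
    intro y x
    induction x using MonoidAlgebra.induction_linear with
    | zero => simp
    | add x x' hx hx' => rw [add_mul, map_add, map_add, hx, hx', smul_add]
    | single g z =>
      induction y using MonoidAlgebra.induction_linear with
      | zero => simp
      | add y y' hy hy' => rw [map_add, mul_add, map_add, hy, hy', MulOpposite.op_add, add_smul]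
      | single x w =>
        rw [ringMap_single, MonoidAlgebra.single_mul_single, hs₀, hs₀, htm, hhm,
          Finsupp.smul_single, smul_eq_mul, ← MulOpposite.op_mul, MonoidAlgebra.single_mul_single]
  let s : Res (ringMap ι) →ₗ[(MonoidAlgebra ℤ H)ᵐᵒᵖ] (G →₀ (MonoidAlgebra ℤ H)ᵐᵒᵖ) :=
    { toFun := s₀
      map_add' := s₀.map_add
      map_smul' := fun c x => hlin c.unop x }
  refine Module.Projective.of_split s P (LinearMap.ext fun x => ?_)
  change P (s₀ x) = x
  induction (show MonoidAlgebra ℤ G from x) using MonoidAlgebra.induction_linear with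
  | zero => rw [map_zero, map_zero]; rfl
  | add x x' hx hx' => rw [map_add, map_add, hx, hx']; rfl
  | single g z =>
    rw [hs₀]
    refine (Finsupp.linearCombination_single _ _ _).trans ((op_smul_res (ringMap ι) _ _).trans ?_)
    have e : MonoidAlgebra.single (t g) 1 * ringMap ι (MonoidAlgebra.single (h g) z) =
        MonoidAlgebra.single g z := by
      rw [ringMap_single, hh, MonoidAlgebra.single_mul_single, mul_inv_cancel_left, one_mul]
    exact e

theorem projective_resColumn (ι : H →* G) (hι : Function.Injective ι) (J : Type) [Fintype J] :
    Module.Projective (MonoidAlgebra ℤ H)ᵐᵒᵖ (J → Res (ringMap ι)) := by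
  classical
  have := projective_res ι hι
  exact Module.Projective.of_equiv
    (DFinsupp.linearEquivFunOnFintype (R := (MonoidAlgebra ℤ H)ᵐᵒᵖ)
      (M := fun _ : J => Res (ringMap ι)))

theorem sum_augmentation_add {J : Type*} [Fintype J] (e : J → ℤ) (v w : J → MonoidAlgebra ℤ G) :
    ∑ i, e i * augmentation G (v i + w i) =
      ∑ i, e i * augmentation G (v i) + ∑ i, e i * augmentation G (w i) := by
  simp only [map_add, mul_add, Finset.sum_add_distrib]

theorem sum_augmentation_mul {J : Type*} [Fintype J] (e : J → ℤ) (ι : H →* G)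
    (v : J → MonoidAlgebra ℤ G) (y : MonoidAlgebra ℤ H) :
    ∑ i, e i * augmentation G (v i * ringMap ι y) =
      augmentation H y * ∑ i, e i * augmentation G (v i) := by
  simp only [map_mul, augmentation_ringMap, Finset.mul_sum]
  exact Finset.sum_congr rfl fun i _ => by ring

/-- A based resolution of `ℤ` over `ℤG` restricts to a projective resolution over a subgroup. -/
theorem exists_projectiveResolution_resComplex (ι : H →* G) (hι : Function.Injective ι)
    {C : BasedComplex (MonoidAlgebra ℤ G)} (hC : C.IsResolution) :
    ∃ P : ProjectiveResolution (trivialModule H), P.complex = resComplex (ringMap ι) C := by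
  obtain ⟨⟨e, he, h₀⟩, h⟩ := hC
  let ε : (Fin (C.rank 0) → Res (ringMap ι)) →ₗ[(MonoidAlgebra ℤ H)ᵐᵒᵖ] trivialModule H :=
    { toFun := fun v => ULift.up (∑ i, e i * augmentation G (v i))
      map_add' := fun v w => by
        exact ULift.ext _ _ (sum_augmentation_add e v w)
      map_smul' := fun c v => by
        exact ULift.ext _ _ (sum_augmentation_mul e ι v c.unop) }
  have hε : ∀ v, ε v = 0 ↔ ∑ i, e i * augmentation G (v i) = 0 := fun v =>
    ⟨fun h => congrArg ULift.down h, fun h => ULift.ext _ _ h⟩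
  refine exists_projectiveResolution (resComplex (ringMap ι) C)
    (@ModuleCat.ofHom _ _ _ (trivialModule H) _ _ _ _ ε) ?_ ?_ ?_ ?_ ?_
  · exact ModuleCat.hom_ext (LinearMap.ext fun w => (hε _).2 ((h₀ _).2 ⟨w, rfl⟩))
  · intro l
    have := projective_resColumn ι hι (Fin (C.rank l))
    exact (IsProjective.iff_projective _).1 this
  · rintro ⟨z⟩
    obtain ⟨v, hv⟩ := he z
    exact ⟨v, ULift.ext _ _ hv⟩
  · exact fun x hx => (h₀ x).1 ((hε x).1 hx)
  · exact fun l x hx => (h l x).1 hx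

end Group

/-! ### Homology of the kernel of a character -/

section KernelHomology

variable {G : Type u} [Group G] {K : Type w} [DivisionRing K] {n : ℕ}

/-- The homomorphism `K → K[u, u⁻¹]` onto the monomials of degree `i`. -/
def monoHom (K : Type*) [DivisionRing K] (i : ℤ) : K →+ Laurent K :=
  MonoidAlgebra.singleAddHom (Multiplicative.ofAdd i)

theorem monoHom_apply (i : ℤ) (c : K) : monoHom K i c = Laurent.mono i c := rfl

theorem mono_smul (i : ℤ) (c : Kᵐᵒᵖ) (x : K) : Laurent.mono i (c • x) = c • Laurent.mono i x := by
  obtain ⟨c, rfl⟩ := MulOpposite.op_surjective c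
  rw [Laurent.op_smul_eq_mul, Laurent.mono_mul_mono, add_zero]
  rfl

/-- The representation of `ℤG` over `K[u, u⁻¹]` given by `g ↦ ρ(g) u^{φ(g)}`. -/
def laurentTwist (ρ : MonoidAlgebra ℤ G →+* Matrix (Fin n) (Fin n) K) (φ : G →* Multiplicative ℤ) :
    MonoidAlgebra ℤ G →+* Matrix (Fin n) (Fin n) (Laurent K) :=
  (MonoidAlgebra.lift ℤ (Matrix (Fin n) (Fin n) (Laurent K)) G
    { toFun := fun g => (ρ (MonoidAlgebra.single g 1)).map (Laurent.mono (φ g).toAdd)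
      map_one' := by
        rw [← MonoidAlgebra.one_def, map_one, map_one]
        exact Matrix.map_one _ ((monoHom K 0).map_zero) rfl
      map_mul' := fun g h => by
        ext a b : 1
        rw [← mul_one (1 : ℤ), ← MonoidAlgebra.single_mul_single, map_mul, Matrix.map_apply,
          Matrix.mul_apply, Matrix.mul_apply, ← monoHom_apply, map_sum]
        refine Finset.sum_congr rfl fun c _ => ?_
        rw [monoHom_apply, Matrix.map_apply, Matrix.map_apply, Laurent.mono_mul_mono, mul_one,
          map_mul, toAdd_mul] }).toRingHom

variable (ρ : MonoidAlgebra ℤ G →+* Matrix (Fin n) (Fin n) K) (φ : G →* Multiplicative ℤ)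

theorem laurentTwist_single (g : G) (z : ℤ) : laurentTwist ρ φ (MonoidAlgebra.single g z) =
    (ρ (MonoidAlgebra.single g z)).map (Laurent.mono (φ g).toAdd) := by
  have h : (MonoidAlgebra.single g z : MonoidAlgebra ℤ G) = z • MonoidAlgebra.single g 1 := by
    rw [MonoidAlgebra.smul_single, smul_eq_mul, mul_one]
  rw [h, map_zsmul, map_zsmul]
  have : laurentTwist ρ φ (MonoidAlgebra.single g 1) =
      (ρ (MonoidAlgebra.single g 1)).map (monoHom K (φ g).toAdd) := by
    simp [laurentTwist]
    rfl
  rw [this]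
  ext a b : 1
  exact (map_zsmul (monoHom K (φ g).toAdd) z _).symm

/-- On the kernel of `φ` the deformed representation is the original one. -/
theorem laurentTwist_ringMap (y : MonoidAlgebra ℤ φ.ker) :
    laurentTwist ρ φ (ringMap φ.ker.subtype y) =
      (ρ (ringMap φ.ker.subtype y)).map (Laurent.mono 0) := by
  induction y using MonoidAlgebra.induction_linear with
  | zero =>
    rw [map_zero, map_zero, map_zero]
    exact (Matrix.map_zero _ (monoHom K 0).map_zero).symm
  | add x y hx hy =>
    rw [map_add, map_add, map_add, hx, hy]
    exact (Matrix.map_add _ (monoHom K 0).map_add _ _).symm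
  | single h z =>
    have : φ (φ.ker.subtype h) = 1 := h.2
    rw [ringMap_single, laurentTwist_single, this, toAdd_one]

theorem map_mono_mulVec (i : ℤ) (A : Matrix (Fin n) (Fin n) K) (x : Fin n → K) :
    (A.map (Laurent.mono i)).mulVec (fun b => Laurent.mono 0 (x b)) =
      fun a => Laurent.mono i (A.mulVec x a) := by
  ext a : 1
  rw [Matrix.mulVec, dotProduct, Matrix.mulVec, dotProduct, ← monoHom_apply, map_sum]
  refine Finset.sum_congr rfl fun b _ => ?_
  rw [Matrix.map_apply, Laurent.mono_mul_mono, add_zero, monoHom_apply]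

variable {J : Type} [Fintype J]

/-- The comparison map `(ℤG)^J ⊗_{ℤ ker φ} K^n → (K[u, u⁻¹]^n)^J`, sending `m ⊗ x` to the columns
`m_j x`, where `g ∈ G` acts as `ρ(g) u^{φ(g)}`. -/
def compare (J : Type) [Fintype J] :
    TensorObj (ρ.comp (ringMap φ.ker.subtype)) (J → Res (ringMap φ.ker.subtype)) →ₗ[Kᵐᵒᵖ]
      (J × Fin n → Laurent K) :=
  Submodule.liftQ _ (TensorProduct.AlgebraTensorModule.lift
    { toFun := fun x => AddMonoidHom.toIntLinearMap
        { toFun := fun m p => (laurentTwist ρ φ (m p.1)).mulVec (fun b => Laurent.mono 0 (x b)) p.2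
          map_zero' := by
            ext p : 1
            exact (congrFun (congrArg (Matrix.mulVec · _) (map_zero (laurentTwist ρ φ))) p.2).trans
              (congrFun (Matrix.zero_mulVec _) p.2)
          map_add' := fun m m' => by
            ext p : 1
            exact (congrFun (congrArg (Matrix.mulVec · _) (map_add (laurentTwist ρ φ) _ _))
              p.2).trans (congrFun (Matrix.add_mulVec _ _ _) p.2) }
      map_add' := fun x y => by
        ext m p : 2
        refine Eq.trans ?_ (congrFun (Matrix.mulVec_add _ _ _) p.2)
        refine congrFun (congrArg (laurentTwist ρ φ (m p.1)).mulVec (funext fun b => ?_)) p.2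
        exact (monoHom K 0).map_add _ _
      map_smul' := fun c x => by
        ext m p : 2
        refine Eq.trans ?_ (congrFun (Matrix.mulVec_smul _ c _) p.2)
        exact congrFun (congrArg (laurentTwist ρ φ (m p.1)).mulVec
          (funext fun b => mono_smul 0 c _)) p.2 }) <| by
    rw [balanced, Submodule.span_le]
    rintro _ ⟨r, x, m, rfl⟩
    rw [SetLike.mem_coe, LinearMap.mem_ker, map_sub, sub_eq_zero,
      TensorProduct.AlgebraTensorModule.lift_tmul, TensorProduct.AlgebraTensorModule.lift_tmul]
    ext p : 1
    change (laurentTwist ρ φ (m p.1)).mulVec (fun b => Laurent.mono 0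
      ((ρ (ringMap φ.ker.subtype r)).mulVec x b)) p.2 =
      (laurentTwist ρ φ ((show MonoidAlgebra ℤ G from m p.1) * ringMap φ.ker.subtype r)).mulVec
        (fun b => Laurent.mono 0 (x b)) p.2
    rw [map_mul, ← Matrix.mulVec_mulVec, laurentTwist_ringMap, map_mono_mulVec]

/-- The class of `x ⊗ m`, as an additive function of `x`. -/
def pureTensor (m : J → MonoidAlgebra ℤ G) : (Fin n → K) →+
    TensorObj (ρ.comp (ringMap φ.ker.subtype)) (J → Res (ringMap φ.ker.subtype)) where
  toFun x := Submodule.Quotient.mk (x ⊗ₜ[ℤ] (id m : J → Res (ringMap φ.ker.subtype)))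
  map_zero' := by rw [TensorProduct.zero_tmul, Submodule.Quotient.mk_zero]
  map_add' x y := by rw [TensorProduct.add_tmul, Submodule.Quotient.mk_add]

theorem pureTensor_zero (x : Fin n → K) :
    pureTensor ρ φ (0 : J → MonoidAlgebra ℤ G) x = 0 :=
  congrArg Submodule.Quotient.mk (TensorProduct.tmul_zero _ x)

theorem pureTensor_add (m m' : J → MonoidAlgebra ℤ G) (x : Fin n → K) :
    pureTensor ρ φ (m + m') x = pureTensor ρ φ m x + pureTensor ρ φ m' x :=
  congrArg Submodule.Quotient.mk (TensorProduct.tmul_add x _ _)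

theorem pureTensor_balanced (m : J → MonoidAlgebra ℤ G) (x : Fin n → K)
    (r : MonoidAlgebra ℤ φ.ker) :
    pureTensor ρ φ m ((ρ (ringMap φ.ker.subtype r)).mulVec x) =
      pureTensor ρ φ (fun j => m j * ringMap φ.ker.subtype r) x :=
  (Submodule.Quotient.eq _).2 (Submodule.subset_span ⟨r, x, m, rfl⟩)

theorem pureTensor_induction {motive : TensorObj (ρ.comp (ringMap φ.ker.subtype))
    (J → Res (ringMap φ.ker.subtype)) → Prop} (h0 : motive 0)
    (ha : ∀ y z, motive y → motive z → motive (y + z)) (hp : ∀ m x, motive (pureTensor ρ φ m x))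
    (z) : motive z := by
  obtain ⟨z, rfl⟩ := Submodule.Quotient.mk_surjective _ z
  induction z with
  | zero => exact h0
  | add x y hx hy => exact ha _ _ hx hy
  | tmul x m => exact hp m x

theorem compare_pureTensor (x : Fin n → K) (m : J → MonoidAlgebra ℤ G) (p : J × Fin n) :
    compare ρ φ J (pureTensor ρ φ m x) p =
      (laurentTwist ρ φ (m p.1)).mulVec (fun b => Laurent.mono 0 (x b)) p.2 := rfl

theorem compare_colMap {I : Type} [Fintype I] (A : Matrix I J (MonoidAlgebra ℤ G))
    (z : TensorObj (ρ.comp (ringMap φ.ker.subtype)) (J → Res (ringMap φ.ker.subtype))) :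
    compare ρ φ I
        (tensorMap (ρ.comp (ringMap φ.ker.subtype)) (colMap (ringMap φ.ker.subtype) A) z) =
      (Matrix.comp _ _ _ _ _ (A.map (laurentTwist ρ φ))).mulVec (compare ρ φ J z) := by
  induction z using pureTensor_induction with
  | h0 => rw [map_zero, map_zero, map_zero, Matrix.mulVec_zero]
  | ha x y hx hy => rw [map_add, map_add, map_add, hx, hy, Matrix.mulVec_add]
  | hp m x =>
    ext p : 1
    have h1 : laurentTwist ρ φ (A.mulVec m p.1) =
        ∑ j, laurentTwist ρ φ (A p.1 j) * laurentTwist ρ φ (m j) := by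
      rw [Matrix.mulVec, dotProduct, map_sum]
      exact Finset.sum_congr rfl fun j _ => map_mul _ _ _
    refine (compare_pureTensor ρ φ x (A.mulVec m) p).trans ?_
    rw [h1, Matrix.sum_mulVec, Finset.sum_apply]
    refine Eq.trans ?_ (Fintype.sum_prod_type _).symm
    refine Finset.sum_congr rfl fun j _ => ?_
    rw [← Matrix.mulVec_mulVec]
    rfl

theorem compare_single [DecidableEq J] (x : Fin n → K) (i : J) (g : G) (z : ℤ) :
    compare ρ φ J (pureTensor ρ φ (Pi.single i (MonoidAlgebra.single g z)) x) = fun p =>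
      if p.1 = i then Laurent.mono (φ g).toAdd ((ρ (MonoidAlgebra.single g z)).mulVec x p.2)
      else 0 := by
  ext p : 1
  rw [compare_pureTensor]
  split_ifs with h
  · rw [h, Pi.single_eq_same, laurentTwist_single, map_mono_mulVec]
  · rw [Pi.single_eq_of_ne h, map_zero, Matrix.zero_mulVec, Pi.zero_apply]

/-- The inverse of `compare`, where `t` is an element with `φ(t) = 1`: it sends the column `y uᵏ` in
place `i` to `t^k e_i ⊗ ρ(t)^(-k) y`. -/
def compareInv (J : Type) [Fintype J] [DecidableEq J] (t : G) :
    (J × Fin n → Laurent K) →+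
      TensorObj (ρ.comp (ringMap φ.ker.subtype)) (J → Res (ringMap φ.ker.subtype)) :=
  ∑ p : J × Fin n, ((Finsupp.liftAddHom fun k : Multiplicative ℤ =>
    (pureTensor ρ φ (Pi.single p.1 (MonoidAlgebra.single (t ^ k.toAdd) 1))).comp
    ((mulVecRight (ρ (MonoidAlgebra.single (t ^ (-k.toAdd)) 1))).toAddMonoidHom.comp
      (AddMonoidHom.single (fun _ : Fin n => K) p.2))).comp
    MonoidAlgebra.coeffAddEquiv.toAddMonoidHom).comp (Pi.evalAddMonoidHom _ p)

theorem compareInv_apply [DecidableEq J] (t : G) (i : J) (k : ℤ) (y : Fin n → K) :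
    compareInv ρ φ J t (fun p => if p.1 = i then Laurent.mono k (y p.2) else 0) =
      pureTensor ρ φ (Pi.single i (MonoidAlgebra.single (t ^ k) 1))
        ((ρ (MonoidAlgebra.single (t ^ (-k)) 1)).mulVec y) := by
  have hy : y = ∑ a, Pi.single a (y a) := (Finset.univ_sum_single y).symm
  rw [compareInv, AddMonoidHom.finsetSum_apply, Fintype.sum_prod_type, Finset.sum_eq_single i]
  · conv_rhs => rw [hy, Matrix.mulVec_sum, map_sum]
    refine Finset.sum_congr rfl fun a _ => ?_
    simp [Laurent.mono, mulVecRight]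
  · intro i' _ h
    refine Finset.sum_eq_zero fun a _ => ?_
    simp [h]
  · simp

theorem compareInv_compare [DecidableEq J] {t : G} (ht : φ t = Multiplicative.ofAdd 1)
    (z : TensorObj (ρ.comp (ringMap φ.ker.subtype)) (J → Res (ringMap φ.ker.subtype))) :
    compareInv ρ φ J t (compare ρ φ J z) = z := by
  induction z using pureTensor_induction with
  | h0 => rw [map_zero, map_zero]
  | ha x y hx hy => rw [map_add, map_add, hx, hy]
  | hp m x =>
    rw [← Finset.univ_sum_single m]
    induction (Finset.univ : Finset J) using Finset.induction_on with
    | empty => rw [Finset.sum_empty, pureTensor_zero, map_zero, map_zero]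
    | insert i s hi ih =>
      rw [Finset.sum_insert hi, pureTensor_add, map_add, map_add, ih]
      congr 1
      induction m i using MonoidAlgebra.induction_linear with
      | zero => rw [Pi.single_zero, pureTensor_zero, map_zero, map_zero]
      | add a b ha hb => rw [Pi.single_add, pureTensor_add, map_add, map_add, ha, hb]
      | single g z =>
        rw [compare_single, compareInv_apply, Matrix.mulVec_mulVec, ← map_mul,
          MonoidAlgebra.single_mul_single, one_mul]
        -- the element `t ^ (-φ(g)) * g` of the kernel moves across the tensor product
        have hk : t ^ (-(φ g).toAdd) * g ∈ φ.ker := by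
          rw [MonoidHom.mem_ker, map_mul, map_zpow, ht, ← ofAdd_zsmul, smul_eq_mul, mul_one,
            ofAdd_neg, ofAdd_toAdd, inv_mul_cancel]
        have := pureTensor_balanced ρ φ (Pi.single i (MonoidAlgebra.single (t ^ (φ g).toAdd) 1))
          x (MonoidAlgebra.single (⟨_, hk⟩ : φ.ker) z)
        rw [ringMap_single, Subgroup.subtype_apply, Subgroup.coe_mk] at this
        rw [this]
        congr 1
        congr 1
        ext j : 1
        by_cases h : j = i
        · subst h
          rw [Pi.single_eq_same, Pi.single_eq_same, MonoidAlgebra.single_mul_single, one_mul,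
            zpow_neg, mul_inv_cancel_left]
        · rw [Pi.single_eq_of_ne h, Pi.single_eq_of_ne h, zero_mul]

theorem compare_compareInv [DecidableEq J] {t : G} (ht : φ t = Multiplicative.ofAdd 1)
    (w : J × Fin n → Laurent K) :
    compare ρ φ J (compareInv ρ φ J t w) = w := by
  rw [← Finset.univ_sum_single w]
  induction (Finset.univ : Finset (J × Fin n)) using Finset.induction_on with
  | empty => rw [Finset.sum_empty, map_zero, map_zero]
  | insert p s hp ih =>
    rw [Finset.sum_insert hp, map_add, map_add, ih]
    congr 1
    obtain ⟨i, a⟩ := p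
    induction w (i, a) using MonoidAlgebra.induction_linear with
    | zero => rw [Pi.single_zero, map_zero, map_zero]
    | add x y hx hy => rw [Pi.single_add, map_add, map_add, hx, hy]
    | single k c =>
      have h : (Pi.single (i, a) (MonoidAlgebra.single k c) : J × Fin n → Laurent K) =
          fun p => if p.1 = i then Laurent.mono k.toAdd ((Pi.single a c : Fin n → K) p.2)
            else 0 := by
        ext p : 1
        rcases p with ⟨j, b⟩
        by_cases h1 : j = i
        · by_cases h2 : b = a
          · subst h1 h2
            simp [Laurent.mono]
          · rw [Pi.single_eq_of_ne (by simp [h2])]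
            simp [h1, Pi.single_eq_of_ne h2, Laurent.mono]
        · rw [Pi.single_eq_of_ne (by simp [h1])]
          simp [h1]
      rw [h, compareInv_apply, compare_single]
      ext p : 1
      have ht' : (φ (t ^ k.toAdd)).toAdd = k.toAdd := by
        rw [map_zpow, ht, ← ofAdd_zsmul, smul_eq_mul, mul_one, toAdd_ofAdd]
      rw [ht', Matrix.mulVec_mulVec, ← map_mul, MonoidAlgebra.single_mul_single, one_mul,
        ← zpow_add, add_neg_cancel, zpow_zero, ← MonoidAlgebra.one_def, map_one, Matrix.one_mulVec]

/-- The representation `g ↦ ρ(g) u^{φ(g)}` over the field `Frac(K[u, u⁻¹])`. -/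
def fieldTwist : MonoidAlgebra ℤ G →+* Matrix (Fin n) (Fin n) (LaurentField K) :=
  (toOre K (Multiplicative ℤ)).mapMatrix.comp (laurentTwist ρ φ)

/-- The comparison map, with values in columns over `Frac(K[u, u⁻¹])`. -/
def compareField (J : Type) [Fintype J] :
    TensorObj (ρ.comp (ringMap φ.ker.subtype)) (J → Res (ringMap φ.ker.subtype)) →ₗ[Kᵐᵒᵖ]
      (J × Fin n → LaurentField K) :=
  (laurentLin K).compLeft (J × Fin n) ∘ₗ compare ρ φ J

variable {φ}

theorem compareField_injective (hφ : Function.Surjective φ) :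
    Function.Injective (compareField ρ φ J) := by
  classical
  obtain ⟨t, ht⟩ := hφ (Multiplicative.ofAdd 1)
  intro v w h
  exact (Function.LeftInverse.injective (g := compareInv ρ φ J t) (compareInv_compare ρ φ ht))
    (funext fun p => laurentLin_injective (congrFun h p))

/-- The comparison map identifies `(ℤG)^J ⊗_{ℤ ker φ} K^n` with the lattice of Laurent columns. -/
theorem range_compareField (hφ : Function.Surjective φ) :
    LinearMap.range (compareField ρ φ J) = lat (laurentLattice K) (J × Fin n) := by
  classical
  obtain ⟨t, ht⟩ := hφ (Multiplicative.ofAdd 1)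
  ext v
  rw [mem_lat]
  constructor
  · rintro ⟨z, rfl⟩ p
    exact ⟨_, rfl⟩
  · intro h
    choose w hw using h
    refine ⟨compareInv ρ φ J t w, ?_⟩
    ext p : 1
    rw [← hw p]
    exact congrArg (laurentLin K) (congrFun (compare_compareInv ρ φ ht w) p)

theorem compareField_colMap {I : Type} [Fintype I] (A : Matrix I J (MonoidAlgebra ℤ G))
    (z : TensorObj (ρ.comp (ringMap φ.ker.subtype)) (J → Res (ringMap φ.ker.subtype))) :
    compareField ρ φ I (tensorMap (ρ.comp (ringMap φ.ker.subtype))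
      (colMap (ringMap φ.ker.subtype) A) z) =
      matLin Kᵐᵒᵖ (Matrix.comp _ _ _ _ _ (A.map (fieldTwist ρ φ))) (compareField ρ φ J z) := by
  ext p : 1
  refine (congrArg (laurentLin K) (congrFun (compare_colMap ρ φ A z) p)).trans ?_
  exact RingHom.map_mulVec (toOre K (Multiplicative ℤ)) _ _ p

theorem map_range_compareField (hφ : Function.Surjective φ) {I : Type} [Fintype I]
    (A : Matrix I J (MonoidAlgebra ℤ G)) :
    (LinearMap.range (tensorMap (ρ.comp (ringMap φ.ker.subtype))
      (colMap (ringMap φ.ker.subtype) A))).map (compareField ρ φ I) =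
      (lat (laurentLattice K) (J × Fin n)).map
        (matLin Kᵐᵒᵖ (Matrix.comp _ _ _ _ _ (A.map (fieldTwist ρ φ)))) := by
  rw [← range_compareField ρ hφ, ← LinearMap.range_comp, ← LinearMap.range_comp]
  congr 1
  exact LinearMap.ext fun z => compareField_colMap ρ A z

theorem map_ker_compareField (hφ : Function.Surjective φ) {I : Type} [Fintype I]
    (A : Matrix I J (MonoidAlgebra ℤ G)) :
    (LinearMap.ker (tensorMap (ρ.comp (ringMap φ.ker.subtype))
      (colMap (ringMap φ.ker.subtype) A))).map (compareField ρ φ J) =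
      lat (laurentLattice K) (J × Fin n) ⊓ LinearMap.ker
        (matLin Kᵐᵒᵖ (Matrix.comp _ _ _ _ _ (A.map (fieldTwist ρ φ)))) := by
  rw [← range_compareField ρ hφ]
  ext v
  constructor
  · rintro ⟨z, hz, rfl⟩
    refine ⟨⟨z, rfl⟩, ?_⟩
    rw [SetLike.mem_coe, LinearMap.mem_ker, ← compareField_colMap, LinearMap.mem_ker.1 hz, map_zero]
  · rintro ⟨⟨z, rfl⟩, hz⟩
    refine ⟨z, compareField_injective ρ hφ ?_, rfl⟩
    rw [compareField_colMap, LinearMap.mem_ker.1 hz, map_zero]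

theorem latCycles_eq (C : BasedComplex (MonoidAlgebra ℤ G))
    (τ : MonoidAlgebra ℤ G →+* Matrix (Fin n) (Fin n) (LaurentField K)) (l m : ℕ)
    (hm : (ComplexShape.down ℕ).next l = m) :
    BasedComplex.latCycles C τ (laurentLattice K) l = lat (laurentLattice K) (C.Idx n l) ⊓
      LinearMap.ker (matLin Kᵐᵒᵖ (C.tensorD τ m l)) := by
  cases l with
  | zero =>
    obtain rfl : 0 = m := by simpa using hm
    have h0 : C.d 0 0 = 0 := C.shape _ _ (by simp)
    have : C.tensorD τ 0 0 = 0 := by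
      rw [BasedComplex.tensorD, h0]
      ext p q : 2
      simp
    rw [this, BasedComplex.latCycles]
    refine (inf_eq_left.2 fun v _ => ?_).symm
    rw [LinearMap.mem_ker, matLin_apply, Matrix.zero_mulVec]
  | succ l =>
    obtain rfl : l = m := by simpa using hm
    rfl

/-- The homology of `ker φ` with coefficients in `K^n` is the homology of the lattices of
`K[u, u⁻¹]`-columns in `C ⊗ Frac(K[u, u⁻¹])^n`, for any based resolution `C` over `ℤG`. -/
theorem nonempty_groupHomologySpace_equiv (hφ : Function.Surjective φ)
    {C : BasedComplex (MonoidAlgebra ℤ G)} (hC : C.IsResolution) (l : ℕ) :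
    Nonempty (groupHomologySpace (ρ.comp (ringMap φ.ker.subtype)) l ≃ₗ[Kᵐᵒᵖ]
      (BasedComplex.latCycles C (fieldTwist ρ φ) (laurentLattice K) l).map
        (BasedComplex.latBoundaries C (fieldTwist ρ φ) (laurentLattice K) l).mkQ) := by
  obtain ⟨P, hP⟩ := exists_projectiveResolution_resComplex φ.ker.subtype
    φ.ker.subtype_injective hC
  have hb := map_range_compareField ρ hφ (C.d l (l + 1))
  have hc := map_ker_compareField ρ hφ (C.d ((ComplexShape.down ℕ).next l) l)
  rw [latCycles_eq C _ l _ rfl, BasedComplex.latBoundaries]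
  refine nonempty_leftDerived_equiv
    (tensorFunctor.{u, w} (ρ.comp (ringMap φ.ker.subtype))) P hP l _ rfl
    (compareField ρ φ (Fin (C.rank l))) (compareField_injective ρ hφ) ?_ ?_
  · intro v
    exact (SetLike.ext_iff.1 hc v).symm
  · intro v
    refine (SetLike.ext_iff.1 hb v).symm.trans ?_
    constructor
    · rintro ⟨_, ⟨z, rfl⟩, rfl⟩
      exact ⟨z, rfl⟩
    · rintro ⟨z, rfl⟩
      exact ⟨_, ⟨z, rfl⟩, rfl⟩

end KernelHomology

/-! ### Acyclicity -/

section Finiteness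

variable {H : Type u} [Group H] {K : Type w} [DivisionRing K] {n : ℕ}

instance : Module.Finite Kᵐᵒᵖ K :=
  ⟨⟨{1}, eq_top_iff.2 fun x _ => by
    rw [show x = MulOpposite.op x • (1 : K) by simp]
    exact Submodule.smul_mem _ _ (Submodule.subset_span (by simp))⟩⟩

/-- The space `(ℤH)^J ⊗_{ℤH} K^n` is spanned by the classes of `e_j ⊗ x`, hence finite-dimensional.
-/
theorem finite_tensorObj (ρ : MonoidAlgebra ℤ H →+* Matrix (Fin n) (Fin n) K) (J : Type)
    [Fintype J] :
    Module.Finite Kᵐᵒᵖ (TensorObj ρ (J → Res (ringMap (MonoidHom.id H)))) := by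
  classical
  let b : J → J → MonoidAlgebra ℤ H := fun j => Pi.single j 1
  let s : (J → Fin n → K) →ₗ[Kᵐᵒᵖ] TensorObj ρ (J → Res (ringMap (MonoidHom.id H))) :=
    { toFun := fun v => Submodule.Quotient.mk
        (∑ j, v j ⊗ₜ[ℤ] (id (b j) : J → Res (ringMap (MonoidHom.id H))))
      map_add' := fun v w => by
        simp only [Pi.add_apply, TensorProduct.add_tmul, Finset.sum_add_distrib,
          Submodule.Quotient.mk_add]
      map_smul' := fun c v => by
        simp only [Pi.smul_apply, ← TensorProduct.smul_tmul', ← Finset.smul_sum,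
          Submodule.Quotient.mk_smul, RingHom.id_apply] }
  refine Module.Finite.of_surjective s fun z => ?_
  obtain ⟨z, rfl⟩ := Submodule.Quotient.mk_surjective _ z
  induction z with
  | zero => exact ⟨0, map_zero s⟩
  | add x y hx hy =>
    obtain ⟨v, hv⟩ := hx
    obtain ⟨w, hw⟩ := hy
    exact ⟨v + w, by rw [map_add, hv, hw, Submodule.Quotient.mk_add]⟩
  | tmul x m =>
    refine ⟨fun j => (ρ (m j)).mulVec x, ?_⟩
    have hm : m = ∑ j, MulOpposite.op (show MonoidAlgebra ℤ H from m j) •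
        (id (b j) : J → Res (ringMap (MonoidHom.id H))) := by
      ext i
      rw [Finset.sum_apply, Finset.sum_eq_single i]
      · refine Eq.trans ?_ (op_smul_res (ringMap (MonoidHom.id H)) _ _).symm
        have e : (Pi.single i (1 : MonoidAlgebra ℤ H) : J → MonoidAlgebra ℤ H) i *
            ringMap (MonoidHom.id H) (m i) = m i := by
          rw [Pi.single_eq_same, one_mul]
          simp [ringMap]
          rfl
        exact e.symm
      · intro j _ h
        refine (op_smul_res (ringMap (MonoidHom.id H)) _ _).trans ?_
        have e : (Pi.single j (1 : MonoidAlgebra ℤ H) : J → MonoidAlgebra ℤ H) i *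
            ringMap (MonoidHom.id H) (m j) = 0 := by
          rw [Pi.single_eq_of_ne h.symm, zero_mul]
        exact e
      · simp
    conv_rhs => rw [hm, TensorProduct.tmul_sum]
    refine (Submodule.Quotient.eq _).2 ?_
    rw [← Finset.sum_sub_distrib]
    exact Submodule.sum_mem _ fun j _ => Submodule.subset_span ⟨_, _, _, rfl⟩

/-- The homology of a group with a finite based resolution is finite-dimensional. -/
theorem finite_groupHomologySpace (ρ : MonoidAlgebra ℤ H →+* Matrix (Fin n) (Fin n) K)
    {C : BasedComplex (MonoidAlgebra ℤ H)} (hC : C.IsResolution) (l : ℕ) :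
    Module.Finite Kᵐᵒᵖ (groupHomologySpace.{u, w} ρ l) := by
  obtain ⟨P, hP⟩ := exists_projectiveResolution_resComplex (MonoidHom.id H)
    Function.injective_id hC
  have hfin : Module.Finite Kᵐᵒᵖ
      ((tensorFunctor.{u, w} ρ).obj ((resComplex (ringMap (MonoidHom.id H)) C).X l)) :=
    finite_tensorObj ρ (Fin (C.rank l))
  let T := tensorFunctor.{u, w} ρ
  let Y := resComplex (ringMap (MonoidHom.id H)) C
  let m := (ComplexShape.down ℕ).next l
  obtain ⟨e⟩ := nonempty_leftDerived_equiv T P hP l m rfl LinearMap.id Function.injective_id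
    (c := LinearMap.ker (T.map (Y.d l m)).hom) (b := LinearMap.range (T.map (Y.d (l + 1) l)).hom)
    (fun v => ⟨fun h => ⟨v, h, rfl⟩, by rintro ⟨z, hz, rfl⟩; exact hz⟩) (fun v => Iff.rfl)
  exact Module.Finite.equiv e.symm

end Finiteness

section Exactness

variable {K : Type w} [DivisionRing K] {n : ℕ}

/-- The Laurent polynomials form an infinite-dimensional space, because the multiplication by `1 +
u` is injective but not surjective. -/
theorem not_finite_laurentLattice : ¬ AlmostLE (laurentLattice K) ⊥ := by
  intro h
  rw [laurentLattice, LinearMap.range_eq_map, ← Submodule.map_bot (laurentLin K)] at h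
  have h1 := h.of_map_injective laurentLin_injective
  have hfin : Module.Finite Kᵐᵒᵖ (Laurent K) := by
    have h2 : Module.Finite Kᵐᵒᵖ ((⊤ : Submodule Kᵐᵒᵖ (Laurent K)).map
      (⊥ : Submodule Kᵐᵒᵖ (Laurent K)).mkQ) := h1
    refine Module.Finite.of_injective ((⊥ : Submodule Kᵐᵒᵖ (Laurent K)).mkQ.codRestrict _
      fun x => Submodule.mem_map_of_mem (Submodule.mem_top (x := x))) fun x y hxy => ?_
    have := congrArg Subtype.val hxy
    exact sub_eq_zero.1 ((Submodule.mem_bot _).1 ((Submodule.Quotient.eq _).1 this))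
  let f : Laurent K := Laurent.mono 0 1 + Laurent.mono 1 1
  have hf : ∀ i, Laurent.cf f i = (if 0 = i then 1 else 0) + if 1 = i then 1 else 0 := fun i => by
    rw [Laurent.cf_add, Laurent.cf_mono, Laurent.cf_mono]
  have hc := (Laurent.codim_range_mulLin (f := f) (a := 0) (d := 1) (by simp [hf]) (by simp [hf])
    (fun i hi => by
      rw [hf] at hi
      by_cases h0 : 0 = i
      · omega
      · by_cases h1 : 1 = i
        · exact ⟨by omega, by omega⟩
        · simp [h0, h1] at hi)).2
  have hf0 : f ≠ 0 := fun h0 => by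
    have := hf 0
    rw [h0] at this
    simp [Laurent.cf] at this
  have hinj : Function.Injective (Laurent.mulLin f) :=
    (injective_iff_map_eq_zero _).2 fun g hg => (mul_eq_zero.1 hg).resolve_left hf0
  rw [LinearMap.range_eq_top.2 (LinearMap.injective_iff_surjective.1 hinj),
    codim_of_le le_rfl] at hc
  omega

/-- If the homology of the lattice of Laurent columns is finite-dimensional, then the complex is
exact over the field of fractions. If no non-zero multiple `z v` of a cycle `z` were a boundary,
then `v ↦ z v` would embed the infinite-dimensional space of Laurent polynomials, up to finite
dimension, into the homology; and `z` is a boundary as soon as some non-zero `z v` is. -/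
theorem exists_mulVec_eq_of_almostLE {I J L : Type} [Fintype I] [Fintype J] [Fintype L]
    {A : Matrix I J (LaurentField K)} {B : Matrix J L (LaurentField K)}
    (h : AlmostLE (lat (laurentLattice K) J ⊓ LinearMap.ker (matLin Kᵐᵒᵖ A))
      ((lat (laurentLattice K) L).map (matLin Kᵐᵒᵖ B))) {z : J → LaurentField K}
    (hz : A.mulVec z = 0) : ∃ w, B.mulVec w = z := by
  by_contra hne
  let μ : LaurentField K →ₗ[Kᵐᵒᵖ] (J → LaurentField K) := LinearMap.pi fun p => lmul Kᵐᵒᵖ (z p)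
  have h1 : AlmostLE ((laurentLattice K).map μ) (lat (laurentLattice K) J) := by
    have h2 := (isLattice_laurentLattice (K := K)).map_matLin
      (Matrix.of fun (p : J) (_ : Unit) => z p)
    refine h2.mono_left ?_
    rintro _ ⟨v, hv, rfl⟩
    refine ⟨fun _ => v, mem_lat.2 fun _ => hv, ?_⟩
    ext p
    simp [μ, Matrix.mulVec, dotProduct]
  have hk : (laurentLattice K).map μ ≤ LinearMap.ker (matLin Kᵐᵒᵖ A) := by
    rintro _ ⟨v, -, rfl⟩
    rw [LinearMap.mem_ker, matLin_apply]
    ext i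
    have := congrArg (· * v) (congrFun hz i)
    simpa [μ, Matrix.mulVec, dotProduct, Finset.sum_mul, mul_assoc] using this
  have h3 := (h1.inf_ker (matLin Kᵐᵒᵖ A)).trans h
  rw [inf_eq_left.2 hk] at h3
  refine not_finite_laurentLattice (K := K) (AlmostLE.of_map μ (Y := (lat (laurentLattice K) L).map
    (matLin Kᵐᵒᵖ B)) bot_le h3 (almostLE_of_le ?_))
  rintro v ⟨-, w, -, hw⟩
  by_contra hv
  refine hne ⟨fun q => w q * v⁻¹, ?_⟩
  ext p
  have := congrArg (· * v⁻¹) (congrFun hw p)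
  have hv' : v ≠ 0 := hv
  simpa [μ, Matrix.mulVec, dotProduct, Finset.sum_mul, mul_assoc, hv'] using this

/-- Exactness descends along a homomorphism `K → F` of skew fields: apply a left `K`-linear
retraction `F → K` to the entries of a solution over `F`. -/
theorem exists_mulVec_eq_of_map {F : Type*} [DivisionRing F] (f : K →+* F) {J L : Type} [Fintype J]
    [Fintype L] {B : Matrix J L K} {z : J → K}
    (h : ∃ w, (B.map f).mulVec w = fun j => f (z j)) : ∃ w, B.mulVec w = z := by
  obtain ⟨w, hw⟩ := h
  let _ : Module K F := Module.compHom F f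
  have hsmul : ∀ (a : K) (x : F), a • x = f a * x := fun _ _ => rfl
  let i : K →ₗ[K] F := { toFun := f, map_add' := map_add f, map_smul' := fun a x => map_mul f a x }
  obtain ⟨r, hr⟩ := LinearMap.exists_leftInverse_of_injective i (LinearMap.ker_eq_bot.2 f.injective)
  refine ⟨fun q => r (w q), ?_⟩
  ext p
  have h1 := congrArg r (congrFun hw p)
  have h2 : r (f (z p)) = z p := LinearMap.congr_fun hr (z p)
  rw [h2] at h1
  rw [← h1, Matrix.mulVec, dotProduct, Matrix.mulVec, dotProduct, map_sum]
  refine Finset.sum_congr rfl fun q _ => ?_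
  rw [Matrix.map_apply, ← hsmul, map_smul, smul_eq_mul]

end Exactness

/-! ### Chain contractions of exact complexes -/

namespace BasedComplex

variable {R : Type*} [Ring R] {K : Type*} [DivisionRing K] {n : ℕ} {C : BasedComplex R}
  {ρ : R →+* Matrix (Fin n) (Fin n) K}

/-- The complex `C ⊗_R K^n` is exact; in degree `0` the outgoing differential is zero. -/
def Exact (C : BasedComplex R) (ρ : R →+* Matrix (Fin n) (Fin n) K) : Prop :=
  ∀ l m, (ComplexShape.down ℕ).next l = m → ∀ z, (C.tensorD ρ m l).mulVec z = 0 →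
    ∃ w, (C.tensorD ρ l (l + 1)).mulVec w = z

theorem Exact.acyclic (h : C.Exact ρ) : C.Acyclic ρ := by
  intro l
  have : C.cycles ρ l ≤ C.boundaries ρ l := by
    intro z hz
    obtain ⟨w, hw⟩ := h l _ rfl z ((Submodule.mem_iInf _).1 hz _)
    exact ⟨w, hw⟩
  rw [betti, Submodule.submoduleOf_eq_top.2 this]
  exact Module.finrank_zero_of_subsingleton

/-- Every matrix over a skew field has a generalized inverse. -/
theorem exists_mul_mul_eq {I J : Type*} [Fintype I] [Fintype J] [DecidableEq I]
    (A : Matrix I J K) : ∃ B : Matrix J I K, A * B * A = A := by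
  classical
  let f := matLin Kᵐᵒᵖ A
  obtain ⟨g, hg⟩ := f.rangeRestrict.exists_rightInverse_of_surjective f.range_rangeRestrict
  obtain ⟨s, hs⟩ := LinearMap.exists_extend g
  refine ⟨matOf s, matLin_injective (k := Kᵐᵒᵖ) (LinearMap.ext fun v => ?_)⟩
  rw [matLin_apply, ← Matrix.mulVec_mulVec, ← Matrix.mulVec_mulVec, matOf_mulVec]
  have h1 : s (f v) = g (f.rangeRestrict v) := LinearMap.congr_fun hs (f.rangeRestrict v)
  have h2 : f (g (f.rangeRestrict v)) = f v :=
    congrArg Subtype.val (LinearMap.congr_fun hg (f.rangeRestrict v))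
  rw [← h1] at h2
  exact h2

theorem Exact.exists_contraction (h : C.Exact ρ) : ∃ γ, C.IsContraction ρ γ := by
  choose s hs using fun l => exists_mul_mul_eq (C.tensorD ρ l (l + 1))
  -- correct the generalized inverse `s` in order to have `d γ = 1 - γ d`
  let g : ∀ l, Matrix (C.Idx n (l + 1)) (C.Idx n l) K
    | 0 => s 0
    | l + 1 => s (l + 1) * (1 - s l * C.tensorD ρ l (l + 1))
  have hg : ∀ l, g l * C.tensorD ρ l (l + 1) = s l * C.tensorD ρ l (l + 1) := by
    intro l
    cases l with
    | zero => rfl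
    | succ l =>
      change s (l + 1) * (1 - s l * C.tensorD ρ l (l + 1)) * _ = _
      rw [Matrix.mul_assoc, Matrix.sub_mul, Matrix.mul_assoc (s l), tensorD_mul_tensorD,
        Matrix.mul_zero, Matrix.one_mul, sub_zero]
  have key : ∀ l m, (ComplexShape.down ℕ).next l = m → ∀ {J : Type} [Fintype J] [DecidableEq J]
      (A : Matrix (C.Idx n l) J K), C.tensorD ρ m l * A = 0 →
      C.tensorD ρ l (l + 1) * (s l * A) = A := by
    intro l m hm J _ _ A hA
    refine matLin_injective (k := Kᵐᵒᵖ) (LinearMap.ext fun v => ?_)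
    obtain ⟨w, hw⟩ := h l m hm (A.mulVec v) (by rw [Matrix.mulVec_mulVec, hA, Matrix.zero_mulVec])
    rw [matLin_apply, matLin_apply, ← Matrix.mulVec_mulVec, ← Matrix.mulVec_mulVec, ← hw,
      Matrix.mulVec_mulVec, Matrix.mulVec_mulVec, hs]
  refine ⟨fun k l => if hk : k = l + 1 then hk ▸ g l else 0, ⟨fun k l hk => dif_neg hk, ?_, ?_⟩⟩
  · rw [dif_pos rfl]
    have := key 0 0 (by simp) (1 : Matrix (C.Idx n 0) (C.Idx n 0) K) (by
      rw [tensorD_shape C ρ (by simp), Matrix.zero_mul])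
    rwa [Matrix.mul_one] at this
  · intro l
    rw [dif_pos rfl, dif_pos rfl]
    change C.tensorD ρ (l + 1) (l + 2) * (s (l + 1) * (1 - s l * C.tensorD ρ l (l + 1))) +
      g l * C.tensorD ρ l (l + 1) = 1
    rw [key (l + 1) l (by simp), hg, sub_add_cancel]
    rw [Matrix.mul_sub, Matrix.mul_one, ← Matrix.mul_assoc, hs, sub_self]

variable {F : Type*} [DivisionRing F]

theorem tensorD_map (f : K →+* F) (k l : ℕ) :
    C.tensorD (f.mapMatrix.comp ρ) k l = (C.tensorD ρ k l).map f := rfl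

theorem IsContraction.map {γ : ∀ k l, Matrix (C.Idx n k) (C.Idx n l) K}
    (hγ : C.IsContraction ρ γ) (f : K →+* F) :
    C.IsContraction (f.mapMatrix.comp ρ) fun k l => (γ k l).map f where
  shape k l h := by rw [hγ.shape k l h, Matrix.map_zero _ (map_zero f)]
  zero := by
    rw [tensorD_map, ← Matrix.map_mul, hγ.zero, Matrix.map_one _ (map_zero f) (map_one f)]
  succ k := by
    rw [tensorD_map, tensorD_map, ← Matrix.map_mul, ← Matrix.map_mul,
      ← Matrix.map_add _ (map_add f), hγ.succ, Matrix.map_one _ (map_zero f) (map_one f)]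

theorem torsionMatrix_map (γ : ∀ k l, Matrix (C.Idx n k) (C.Idx n l) K) (f : K →+* F) :
    C.torsionMatrix (f.mapMatrix.comp ρ) (fun k l => (γ k l).map f) =
      (C.torsionMatrix ρ γ).map f := by
  ext x y
  exact (map_add f _ _).symm

end BasedComplex

/-! ### The agrarian norm and the Euler characteristic of the kernel -/

section Main

variable {G : Type u} [Group G] {D : Type v} [DivisionRing D] {n : ℕ}

/-- The representation `g ↦ σ(g) q(g) u^{φ(g)}` is obtained from `σ ⊗ q` by the deformation of the
coefficient field along `φ`. -/
theorem fieldTwist_twistRing (σ : G →* Matrix.GeneralLinearGroup (Fin n) D)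
    (φ : G →* Multiplicative ℤ) :
    fieldTwist (twistRing σ) φ = (deform (FreeAb.lift φ)).mapMatrix.comp (twistRing σ) := by
  have h1 : ∀ g, twistRing σ (MonoidAlgebra.single g 1) = twist σ g := fun g => by
    refine (MonoidAlgebra.lift_single ..).trans ?_
    rw [Algebra.smul_def, map_one, one_mul]
  refine MonoidAlgebra.ringHom_ext (fun z => ?_) fun g => ?_
  · have : (MonoidAlgebra.single 1 z : MonoidAlgebra ℤ G) = (z : MonoidAlgebra ℤ G) := by
      simp [MonoidAlgebra.intCast_def]
    rw [this, map_intCast, map_intCast]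
  · change (laurentTwist (twistRing σ) φ (MonoidAlgebra.single g 1)).map (toOre _ _) =
      (twistRing σ (MonoidAlgebra.single g 1)).map (deform (FreeAb.lift φ))
    rw [laurentTwist_single, h1]
    ext i j : 2
    change toOre _ _ (Laurent.mono (φ g).toAdd (toOre D (FreeAb G) (MonoidAlgebra.single
      (toFreeAb G g) ((σ g : Matrix (Fin n) (Fin n) D) i j)))) =
      deform (FreeAb.lift φ) (toOre D (FreeAb G) (MonoidAlgebra.single
      (toFreeAb G g) ((σ g : Matrix (Fin n) (Fin n) D) i j)))
    rw [deform_toOre, deformLaurent_single]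
    rfl

theorem preserves_fieldTwist {K : Type*} [DivisionRing K]
    (ρ : MonoidAlgebra ℤ G →+* Matrix (Fin n) (Fin n) K) (φ : G →* Multiplicative ℤ)
    (C : BasedComplex (MonoidAlgebra ℤ G)) :
    BasedComplex.Preserves C (fieldTwist ρ φ) (laurentLattice K) := by
  rintro l _ ⟨v, hv, rfl⟩
  refine mem_lat.2 fun p => ?_
  refine Submodule.sum_mem _ fun q _ => ?_
  obtain ⟨w, hw⟩ := mem_lat.1 hv q
  rw [← hw]
  exact ⟨laurentTwist ρ φ (C.d l (l + 1) p.1 q.1) p.2 q.2 * w, map_mul (toOre K _) _ _⟩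

theorem exists_character_of_isTypeFByInfiniteCyclic (hG : IsTypeFByInfiniteCyclic G) :
    ∃ ψ : G →* Multiplicative ℤ, Function.Surjective ψ ∧ IsTypeF ψ.ker := by
  obtain ⟨N, hN, hF, ⟨e⟩⟩ := hG
  let ψ : G →* Multiplicative ℤ := e.toMonoidHom.comp (QuotientGroup.mk' N)
  have hk : ψ.ker = N := by
    ext g
    simp [ψ]
  exact ⟨ψ, e.surjective.comp (QuotientGroup.mk'_surjective N), by rw [hk]; exact hF⟩

/-- A character is the multiple of another one by a generator of its image. -/
theorem surjective_of_isPrimitive {φ : G →* Multiplicative ℤ} (hφ : IsPrimitive φ) :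
    Function.Surjective φ := by
  obtain ⟨t, ht⟩ := (Subgroup.isCyclic_iff_exists_zpowers_eq_top φ.range).1 inferInstance
  set k : ℤ := t.toAdd
  have hdvd : ∀ g, k ∣ (φ g).toAdd := fun g => by
    have : φ g ∈ Subgroup.zpowers t := by rw [ht]; exact ⟨g, rfl⟩
    obtain ⟨m, hm⟩ := this
    exact ⟨m, by rw [← hm]; simp [k, mul_comm]⟩
  let ψ : G →* Multiplicative ℤ :=
    { toFun := fun g => Multiplicative.ofAdd ((φ g).toAdd / k)
      map_one' := by simp
      map_mul' := fun g h => by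
        rw [map_mul, toAdd_mul, Int.add_ediv_of_dvd_left (hdvd g), ofAdd_add] }
  have hψ : φ = ψ ^ k := by
    ext g
    have h1 : (φ g).toAdd = k * ((φ g).toAdd / k) := (Int.mul_ediv_cancel' (hdvd g)).symm
    have h2 : (ψ ^ k) g = ψ g ^ k := rfl
    rw [h2, toAdd_zpow, h1]
    rfl
  have hu := hφ ψ k hψ
  intro x
  have hx : x ∈ Subgroup.zpowers t := by
    rcases Int.isUnit_iff.1 hu with h | h
    · exact ⟨x.toAdd, Multiplicative.toAdd.injective ((toAdd_zpow t x.toAdd).trans (by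
        rw [show t.toAdd = 1 from h]; simp))⟩
    · exact ⟨-x.toAdd, Multiplicative.toAdd.injective ((toAdd_zpow t (-x.toAdd)).trans (by
        rw [show t.toAdd = -1 from h]; simp))⟩
  rw [ht] at hx
  exact hx

/-- The homology of a kernel of type F is finite-dimensional; here it is expressed by the lattices
of Laurent columns. -/
theorem almostLE_latCycles (ρ : MonoidAlgebra ℤ G →+* Matrix (Fin n) (Fin n) D)
    {φ : G →* Multiplicative ℤ} (hφ : Function.Surjective φ) (hF : IsTypeF φ.ker)
    {C : BasedComplex (MonoidAlgebra ℤ G)} (hC : C.IsResolution) (l : ℕ) :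
    AlmostLE (BasedComplex.latCycles C (fieldTwist ρ φ) (laurentLattice _) l)
      (BasedComplex.latBoundaries C (fieldTwist ρ φ) (laurentLattice _) l) := by
  obtain ⟨-, C', hC'⟩ := hF
  obtain ⟨e⟩ := nonempty_groupHomologySpace_equiv ρ hφ hC l
  have h := finite_groupHomologySpace (ρ.comp (ringMap φ.ker.subtype)) hC' l
  exact Module.Finite.equiv e

/-- Deform along a character whose kernel is of type F: the lattice of Laurent columns then has
finite-dimensional homology, so the complex is exact over the field of fractions, and over `K`. -/
theorem exact_twistRing (hG : IsTypeFByInfiniteCyclic G)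
    (σ : G →* Matrix.GeneralLinearGroup (Fin n) D)
    {C : BasedComplex (MonoidAlgebra ℤ G)} (hC : C.IsResolution) : C.Exact (twistRing σ) := by
  obtain ⟨ψ, hψ, hF⟩ := exists_character_of_isTypeFByInfiniteCyclic hG
  intro l m hm z hz
  refine exists_mulVec_eq_of_map (deform (FreeAb.lift ψ)) ?_
  have hfin := almostLE_latCycles (twistRing σ) hψ hF hC l
  rw [latCycles_eq C _ l m hm] at hfin
  have := exists_mulVec_eq_of_almostLE hfin (z := fun p => deform (FreeAb.lift ψ) (z p)) (by
    rw [fieldTwist_twistRing, BasedComplex.tensorD_map]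
    ext p
    refine (RingHom.map_mulVec (deform (FreeAb.lift ψ)) _ z p).symm.trans ?_
    rw [hz]
    exact map_zero _)
  rwa [fieldTwist_twistRing, BasedComplex.tensorD_map] at this

/-- The Betti numbers of the kernel are computed by the lattices of Laurent columns. -/
theorem groupBetti_eq_codim (σ : G →* Matrix.GeneralLinearGroup (Fin n) D)
    {φ : G →* Multiplicative ℤ} (hφ : Function.Surjective φ)
    {C : BasedComplex (MonoidAlgebra ℤ G)} (hC : C.IsResolution) (l : ℕ) :
    groupBetti (twistRestrict σ φ.ker) l =
      codim (BasedComplex.latCycles C (fieldTwist (twistRing σ) φ) (laurentLattice _) l)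
        (BasedComplex.latBoundaries C (fieldTwist (twistRing σ) φ) (laurentLattice _) l) := by
  obtain ⟨e⟩ := nonempty_groupHomologySpace_equiv (twistRing σ) hφ hC l
  exact e.finrank_eq

theorem groupBetti_eq_zero (σ : G →* Matrix.GeneralLinearGroup (Fin n) D)
    {φ : G →* Multiplicative ℤ} (hφ : Function.Surjective φ)
    {C : BasedComplex (MonoidAlgebra ℤ G)} (hC : C.IsResolution) {l : ℕ} (hl : C.rank l = 0) :
    groupBetti (twistRestrict σ φ.ker) l = 0 := by
  rw [groupBetti_eq_codim σ hφ hC]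
  have : IsEmpty (Fin (C.rank l)) := by
    rw [hl]
    infer_instance
  exact codim_of_le fun x _ => by
    rw [Subsingleton.elim x 0]
    exact zero_mem _

/-- The homology of `ker φ` is finite-dimensional once `C ⊗ K^n` is contractible. -/
theorem eulerCharDefined (σ : G →* Matrix.GeneralLinearGroup (Fin n) D)
    {φ : G →* Multiplicative ℤ} (hφ : Function.Surjective φ)
    {C : BasedComplex (MonoidAlgebra ℤ G)} (hC : C.IsResolution) (h : C.Exact (twistRing σ)) :
    EulerCharDefined (twistRestrict σ φ.ker) := by
  obtain ⟨γ, hγ⟩ := h.exists_contraction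
  refine ⟨fun l => ?_, ?_⟩
  · have hγ' := hγ.map (deform (FreeAb.lift φ))
    rw [← fieldTwist_twistRing] at hγ'
    have h1 := (BasedComplex.relIndex_adapted isLattice_laurentLattice hγ'
      (preserves_fieldTwist (twistRing σ) φ C) l).1
    obtain ⟨e⟩ := nonempty_groupHomologySpace_equiv (twistRing σ) hφ hC l
    have h2 : Module.Finite _ _ := h1
    exact Module.Finite.equiv e.symm
  · obtain ⟨N, hN⟩ := C.finite
    refine (Set.finite_lt_nat N).subset fun l hl => ?_
    by_contra h
    exact hl (groupBetti_eq_zero σ hφ hC (hN l (not_lt.1 h)))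

/-- Only the invertibility of the matrix matters, so the zero lattice can be used. -/
theorem detRep_torsionMatrix_ne_zero {R : Type*} [Ring R] {K : Type*} [DivisionRing K]
    {C : BasedComplex R} {ρ : R →+* Matrix (Fin n) (Fin n) K}
    {γ : ∀ k l, Matrix (C.Idx n k) (C.Idx n l) K} (hγ : C.IsContraction ρ γ) {m : ℕ}
    (o : Fin m ≃ C.OddIdx n) (e : Fin m ≃ C.EvenIdx n) :
    detRep ((C.torsionMatrix ρ γ).submatrix o e) ≠ 0 := by
  have hΛ : IsLattice (⊥ : Submodule Kᵐᵒᵖ K) := fun x => by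
    rw [Submodule.map_bot]
    exact almostLE_of_le le_rfl
  exact (hΛ.relIndex_eq_weight_detRep _ (BasedComplex.isUnit_torsionMatrix hγ o e)).1

/-- The width of the agrarian polytope, computed with any choices, is minus the Euler characteristic
of the kernel. -/
theorem width_eq_neg_eulerChar (σ : G →* Matrix.GeneralLinearGroup (Fin n) D)
    {φ : G →* Multiplicative ℤ} (hφ : Function.Surjective φ)
    {C : BasedComplex (MonoidAlgebra ℤ G)} (hC : C.IsResolution) {x : ℝ}
    (hx : IsAgrarianNormOf σ C φ x) : x = -(eulerChar (twistRestrict σ φ.ker) : ℝ) := by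
  obtain ⟨_, P, ⟨γ, hγ, m, o, e, rfl⟩, hP, rfl⟩ := hx
  obtain ⟨N, hN⟩ := C.finite
  have hγ' := hγ.map (deform (FreeAb.lift φ))
  have hd := preserves_fieldTwist (twistRing σ) φ C
  have hw := width_of_isPolytope (FreeAb.lift φ) hP
  rw [fieldTwist_twistRing] at hd
  rw [hw, ← detRep_map, ← Matrix.submatrix_map, ← BasedComplex.torsionMatrix_map,
    BasedComplex.weight_detRep_torsionMatrix isLattice_laurentLattice hγ' hd hN o e, eulerChar,
    finsum_eq_sum_of_support_subset (s := Finset.range N)]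
  · rw [← Int.cast_neg]
    congr 2
    refine Finset.sum_congr rfl fun l _ => ?_
    rw [groupBetti_eq_codim σ hφ hC, fieldTwist_twistRing]
  · intro l hl
    rw [Finset.coe_range, Set.mem_Iio]
    by_contra h
    refine hl ?_
    simp only [groupBetti_eq_zero σ hφ hC (hN l (not_lt.1 h)), Nat.cast_zero, mul_zero]

theorem exists_isPolytope_of_isTorsion (σ : G →* Matrix.GeneralLinearGroup (Fin n) D)
    {C : BasedComplex (MonoidAlgebra ℤ G)}
    {τ} (h : C.IsTorsion (twistRing σ) τ) : ∃ P, IsPolytope τ P := by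
  obtain ⟨γ, hγ, m, o, e, rfl⟩ := h
  exact exists_isPolytope (detRep_torsionMatrix_ne_zero hγ o e)

end Main

/-! ### Finite presentation of (type F)-by-(infinite cyclic) groups -/

section Presentation

variable {G : Type u} [Group G]

/-- An extension of `ℤ` by a finitely presented group is generated by the kernel and a lift `t` of a
generator of `ℤ`; the conjugation relations `t x t⁻¹ = α(x)` for the generators `x` of the kernel
suffice, because the elements satisfying such a relation form a subgroup. -/
theorem isFinitelyPresented_of_ker {ψ : G →* Multiplicative ℤ} (hψ : Function.Surjective ψ)
    (hF : Group.IsFinitelyPresented ψ.ker) : Group.IsFinitelyPresented G := by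
  obtain ⟨t, ht⟩ := hψ (Multiplicative.ofAdd 1)
  obtain ⟨r, p, hp, -⟩ := hF.out
  let f : Monoid.Coprod ψ.ker (Multiplicative ℤ) →* G :=
    Monoid.Coprod.lift ψ.ker.subtype (zpowersHom G t)
  let α : ψ.ker ≃* ψ.ker := MulAut.conjNormal t
  let u : Monoid.Coprod ψ.ker (Multiplicative ℤ) := Monoid.Coprod.inr (Multiplicative.ofAdd 1)
  let rel : Fin r → Monoid.Coprod ψ.ker (Multiplicative ℤ) := fun i =>
    u * Monoid.Coprod.inl (p (FreeGroup.of i)) * u⁻¹ *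
      (Monoid.Coprod.inl (α (p (FreeGroup.of i))))⁻¹
  have hfl : ∀ x, f (Monoid.Coprod.inl x) = x := fun x => Monoid.Coprod.lift_apply_inl _ _ x
  have hfr : ∀ k : ℤ, f (Monoid.Coprod.inr (Multiplicative.ofAdd k)) = t ^ k := fun k =>
    (Monoid.Coprod.lift_apply_inr _ _ _).trans (by simp)
  have htk : ∀ k : ℤ, ψ (t ^ k) = Multiplicative.ofAdd k := fun k => by
    rw [map_zpow, ht, ← ofAdd_zsmul, smul_eq_mul, mul_one]
  have hsurj : Function.Surjective f := fun g => by
    refine ⟨Monoid.Coprod.inl ⟨g * (t ^ (ψ g).toAdd)⁻¹, ?_⟩ *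
      Monoid.Coprod.inr (Multiplicative.ofAdd (ψ g).toAdd), ?_⟩
    · rw [map_mul, hfl, hfr, inv_mul_cancel_right]
    · rw [MonoidHom.mem_ker, map_mul, map_inv, htk, ofAdd_toAdd, mul_inv_cancel]
  have hQ : Subgroup.normalClosure (Set.range rel) ≤ f.ker := by
    refine Subgroup.normalClosure_le_normal ?_
    rintro _ ⟨i, rfl⟩
    have hu : f u = t := (hfr 1).trans (zpow_one t)
    rw [SetLike.mem_coe, MonoidHom.mem_ker, map_mul, map_mul, map_mul, map_inv, map_inv, hfl, hfl,
      hu]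
    simp [α]
  -- `G` is the quotient of the finitely presented group `ker ψ * ℤ` by the conjugation relations
  refine Group.IsFinitelyPresented.of_surjective f hsurj
    ⟨Set.range rel, Set.finite_range _, le_antisymm ?_ ?_⟩
  · exact hQ
  · set Q := Subgroup.normalClosure (Set.range rel)
    let π := QuotientGroup.mk' Q
    let a : ψ.ker →* _ := π.comp Monoid.Coprod.inl
    let τ := π u
    have hconj : ∀ x, τ * a x * τ⁻¹ = a (α x) := by
      have h1 : ((MulAut.conj τ).toMonoidHom.comp (a.comp p)) = (a.comp α.toMonoidHom).comp p := by
        refine FreeGroup.ext_hom _ _ fun i => ?_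
        have : π (rel i) = 1 :=
          (QuotientGroup.eq_one_iff _).2 (Subgroup.subset_normalClosure ⟨i, rfl⟩)
        simp only [rel, map_mul, map_inv] at this
        exact mul_inv_eq_one.1 this
      intro x
      obtain ⟨y, rfl⟩ := hp x
      exact DFunLike.congr_fun h1 y
    have hpow : ∀ k : ℤ, ∀ x, ∃ y, τ ^ k * a x = a y * τ ^ k := by
      intro k
      induction k using Int.induction_on with
      | zero => exact fun x => ⟨x, by simp⟩
      | succ k ih =>
        intro x
        obtain ⟨y, hy⟩ := ih (α x)
        refine ⟨y, ?_⟩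
        rw [zpow_add_one, mul_assoc, ← mul_assoc (a y), ← hy, ← hconj]
        group
      | pred k ih =>
        intro x
        obtain ⟨y, hy⟩ := ih (α.symm x)
        refine ⟨y, ?_⟩
        have := hconj (α.symm x)
        rw [MulEquiv.apply_symm_apply] at this
        rw [zpow_sub_one, ← mul_assoc (a y), ← hy, ← this]
        group
    -- normal form: modulo the relations every element is `y t^k` with `y` in the kernel
    have hform : ∀ x, ∃ (y : ψ.ker) (k : ℤ), π x = a y * τ ^ k := by
      intro x
      induction x using Monoid.Coprod.induction_on with
      | inl x => exact ⟨x, 0, by simp [a]⟩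
      | inr k =>
        refine ⟨1, k.toAdd, ?_⟩
        rw [map_one, one_mul, ← map_zpow, ← map_zpow, ← ofAdd_zsmul, smul_eq_mul, mul_one,
          ofAdd_toAdd]
      | mul x y hx hy =>
        obtain ⟨x', k, hx⟩ := hx
        obtain ⟨y', l, hy⟩ := hy
        obtain ⟨z, hz⟩ := hpow k y'
        exact ⟨x' * z, k + l, by
          rw [map_mul, hx, hy, mul_assoc, ← mul_assoc (τ ^ k), hz, map_mul, zpow_add]
          group⟩
    intro x hx
    obtain ⟨y, k, hy⟩ := hform x
    have h1 : f x = y * t ^ k := by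
      have h2 : QuotientGroup.lift Q f hQ (π x) = f x := rfl
      rw [← h2, hy, map_mul, map_zpow]
      change f (Monoid.Coprod.inl y) * f u ^ k = _
      rw [hfl, (hfr 1).trans (zpow_one t)]
    rw [MonoidHom.mem_ker.1 hx] at h1
    have hk : k = 0 := by
      have h2 := congrArg ψ h1
      rw [map_one, map_mul, htk, MonoidHom.mem_ker.1 y.2, one_mul] at h2
      exact (congrArg Multiplicative.toAdd h2).symm
    have hy1 : y = 1 := Subtype.ext (by rw [hk, zpow_zero, mul_one] at h1; exact h1.symm)
    rw [hk, hy1, map_one, zpow_zero, one_mul] at hy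
    exact (QuotientGroup.eq_one_iff x).1 hy

end Presentation

/-! ### Induction of a resolution from the kernel of a character -/

section Induction

/-- A finitely supported family of values of `f` lifts to a finitely supported family. -/
theorem exists_mapRange_eq {ι A B : Type*} [AddCommGroup A] [AddCommGroup B] (f : A →+ B)
    (c : ι →₀ B) (h : ∀ i, ∃ a, f a = c i) : ∃ d : ι →₀ A, d.mapRange f (map_zero f) = c := by
  classical
  choose g hg using h
  refine ⟨Finsupp.onFinset c.support (fun i => if c i = 0 then 0 else g i) fun i hi => ?_, ?_⟩
  · rw [Finsupp.mem_support_iff]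
    intro h0
    exact hi (if_pos h0)
  · ext i
    rw [Finsupp.mapRange_apply, Finsupp.onFinset_apply]
    split_ifs with h0
    · rw [h0, map_zero]
    · exact hg i

variable {G : Type u} [Group G] (ψ : G →* Multiplicative ℤ) (t : G)

/-- The columns over `ℤG` as sums `∑ v_k t^k` with `v_k` columns over `ℤ[ker ψ]`; this map is
bijective when `ψ(t) = 1`, the generator of `ℤ`. -/
def assemble (J : Type) : (Multiplicative ℤ →₀ (J → MonoidAlgebra ℤ ψ.ker)) →+
    (J → MonoidAlgebra ℤ G) :=
  Finsupp.liftAddHom fun k =>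
    { toFun := fun a j => ringMap ψ.ker.subtype (a j) * MonoidAlgebra.single (t ^ k.toAdd) 1
      map_zero' := by ext j : 1; simp
      map_add' := fun a b => by
        ext j : 1
        rw [Pi.add_apply, Pi.add_apply, map_add, add_mul] }

theorem assemble_single {J : Type} (k : Multiplicative ℤ) (a : J → MonoidAlgebra ℤ ψ.ker) (j : J) :
    assemble ψ t J (Finsupp.single k a) j =
      ringMap ψ.ker.subtype (a j) * MonoidAlgebra.single (t ^ k.toAdd) 1 :=
  congrFun (Finsupp.liftAddHom_apply_single _ k a) j

theorem mulVec_assemble {I J : Type} [Fintype J] (A : Matrix I J (MonoidAlgebra ℤ ψ.ker))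
    (c : Multiplicative ℤ →₀ (J → MonoidAlgebra ℤ ψ.ker)) :
    (A.map (ringMap ψ.ker.subtype)).mulVec (assemble ψ t J c) =
      assemble ψ t I (c.mapRange A.mulVec (Matrix.mulVec_zero A)) := by
  induction c using Finsupp.induction_linear with
  | zero => rw [map_zero, Matrix.mulVec_zero, Finsupp.mapRange_zero, map_zero]
  | add c d hc hd =>
    rw [map_add, Matrix.mulVec_add, hc, hd, Finsupp.mapRange_add (Matrix.mulVec_add A), map_add]
  | single k a =>
    rw [Finsupp.mapRange_single]
    ext i : 1
    rw [assemble_single, Matrix.mulVec, dotProduct, Matrix.mulVec, dotProduct, map_sum,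
      Finset.sum_mul]
    refine Finset.sum_congr rfl fun j _ => ?_
    rw [assemble_single, Matrix.map_apply, map_mul, mul_assoc]

variable {ψ t}

theorem assemble_surjective (ht : ψ t = Multiplicative.ofAdd 1) (J : Type) [Fintype J] :
    Function.Surjective (assemble ψ t J) := by
  classical
  intro v
  change v ∈ (assemble ψ t J).range
  rw [← Finset.univ_sum_single v]
  refine sum_mem fun j _ => ?_
  induction v j using MonoidAlgebra.induction_linear with
  | zero => rw [Pi.single_zero]; exact zero_mem _
  | add x y hx hy => rw [Pi.single_add]; exact add_mem hx hy
  | single g z =>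
    have hg : g * t ^ (-(ψ g).toAdd) ∈ ψ.ker := by
      rw [MonoidHom.mem_ker, map_mul, map_zpow, ht, ← ofAdd_zsmul, smul_eq_mul, mul_one,
        ofAdd_neg, ofAdd_toAdd, mul_inv_cancel]
    refine ⟨Finsupp.single (ψ g) (Pi.single j (MonoidAlgebra.single ⟨_, hg⟩ z)), ?_⟩
    ext i : 1
    rw [assemble_single]
    by_cases h : i = j
    · subst h
      rw [Pi.single_eq_same, Pi.single_eq_same, ringMap_single, MonoidAlgebra.single_mul_single,
        mul_one, Subgroup.subtype_apply, Subgroup.coe_mk, zpow_neg, inv_mul_cancel_right]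
    · rw [Pi.single_eq_of_ne h, Pi.single_eq_of_ne h, map_zero, zero_mul]

theorem coeff_assemble (ht : ψ t = Multiplicative.ofAdd 1) {J : Type}
    (c : Multiplicative ℤ →₀ (J → MonoidAlgebra ℤ ψ.ker)) (k : Multiplicative ℤ) (j : J)
    (x : ψ.ker) : (assemble ψ t J c j).coeff (x * t ^ k.toAdd) = (c k j).coeff x := by
  induction c using Finsupp.induction_linear with
  | zero => simp
  | add c d hc hd =>
    rw [map_add, Pi.add_apply, MonoidAlgebra.coeff_add, Finsupp.add_apply, hc, hd]
    simp
  | single l a =>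
    rw [assemble_single, MonoidAlgebra.coeff_mul_single_apply, mul_one]
    by_cases h : l = k
    · subst h
      rw [Finsupp.single_eq_same, mul_inv_cancel_right]
      exact Finsupp.mapDomain_apply ψ.ker.subtype_injective _ x
    · rw [Finsupp.single_eq_of_ne (Ne.symm h), Pi.zero_apply]
      refine Finsupp.mapDomain_of_notMem_range _ _ ?_
      rintro ⟨y, hy⟩
      have h1 := congrArg ψ hy
      have hx : ψ x = 1 := x.2
      have hy' : ψ (ψ.ker.subtype y) = 1 := y.2
      rw [hy', map_mul, map_mul, map_inv, map_zpow, map_zpow, ht, hx, one_mul, ← ofAdd_zsmul,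
        ← ofAdd_zsmul] at h1
      simp only [smul_eq_mul, mul_one, ofAdd_toAdd] at h1
      exact h (mul_inv_eq_one.1 h1.symm).symm

theorem assemble_injective (ht : ψ t = Multiplicative.ofAdd 1) (J : Type) :
    Function.Injective (assemble ψ t J) := by
  intro c d h
  ext k j x
  rw [← coeff_assemble ht, h, coeff_assemble ht]

end Induction

section Induction

variable {G : Type u} [Group G]

/-- A resolution whose bases are indexed by arbitrary finite types gives a based resolution. -/
theorem exists_isResolution_of_fintype {ι : ℕ → Type} [∀ k, Fintype (ι k)]
    (hfin : ∃ N, ∀ k, N ≤ k → IsEmpty (ι k))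
    (D : ∀ k, Matrix (ι k) (ι (k + 1)) (MonoidAlgebra ℤ G)) (hD : ∀ k, D k * D (k + 1) = 0)
    (e : ι 0 → ℤ)
    (he : ∀ z : ℤ, ∃ v : ι 0 → MonoidAlgebra ℤ G, ∑ i, e i * augmentation G (v i) = z)
    (h₀ : ∀ v : ι 0 → MonoidAlgebra ℤ G,
      ∑ i, e i * augmentation G (v i) = 0 ↔ ∃ w, (D 0).mulVec w = v)
    (h : ∀ k v, (D k).mulVec v = 0 → ∃ w, (D (k + 1)).mulVec w = v) :
    ∃ C : BasedComplex (MonoidAlgebra ℤ G), C.IsResolution := by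
  let q : ∀ k, ι k ≃ Fin (Fintype.card (ι k)) := fun k => Fintype.equivFin _
  let d : ∀ k l, Matrix (Fin (Fintype.card (ι k))) (Fin (Fintype.card (ι l)))
      (MonoidAlgebra ℤ G) := fun k l =>
    if hl : l = k + 1 then by subst hl; exact (D k).submatrix (q k).symm (q (k + 1)).symm else 0
  have hd : ∀ k, d k (k + 1) = (D k).submatrix (q k).symm (q (k + 1)).symm := fun k => dif_pos rfl
  have hd0 : ∀ k l, l ≠ k + 1 → d k l = 0 := fun k l hl => dif_neg hl
  have hmul : ∀ k w, ((D k).submatrix (q k).symm (q (k + 1)).symm).mulVec w =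
      (D k).mulVec (w ∘ q (k + 1)) ∘ (q k).symm := fun k w => by
    rw [Matrix.submatrix_mulVec_equiv]
    rfl
  let C : BasedComplex (MonoidAlgebra ℤ G) :=
    { rank := fun k => Fintype.card (ι k)
      finite := by
        obtain ⟨N, hN⟩ := hfin
        exact ⟨N, fun k hk => Fintype.card_eq_zero_iff.2 (hN k hk)⟩
      d := d
      shape := hd0
      d_comp_d := fun j k l => by
        by_cases h1 : k = j + 1
        · by_cases h2 : l = k + 1
          · subst h2 h1
            rw [hd, hd, Matrix.submatrix_mul_equiv, hD]
            rfl
          · rw [hd0 k l h2, Matrix.mul_zero]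
        · rw [hd0 j k h1, Matrix.zero_mul] }
  have haug : ∀ v : Fin (C.rank 0) → MonoidAlgebra ℤ G,
      ∑ i, (e ∘ (q 0).symm) i * augmentation G (v i) =
        ∑ i, e i * augmentation G ((v ∘ q 0) i) := fun v => by
    rw [← (q 0).sum_comp]
    simp
  refine ⟨C, ⟨e ∘ (q 0).symm, fun z => ?_, fun v => ?_⟩, fun k v => ?_⟩
  · obtain ⟨v, hv⟩ := he z
    refine ⟨v ∘ (q 0).symm, ?_⟩
    rw [haug, ← hv]
    simp
  · rw [haug, h₀]
    change _ ↔ ∃ w, (d 0 1).mulVec w = v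
    rw [hd]
    constructor
    · rintro ⟨w, hw⟩
      refine ⟨w ∘ (q 1).symm, ?_⟩
      rw [hmul]
      ext i : 1
      simpa [Function.comp_def] using congrFun hw ((q 0).symm i)
    · rintro ⟨w, rfl⟩
      refine ⟨w ∘ q 1, ?_⟩
      rw [hmul]
      ext i : 1
      simp
  · change (d k (k + 1)).mulVec v = 0 ↔ ∃ w, (d (k + 1) (k + 2)).mulVec w = v
    rw [hd, hd]
    constructor
    · intro hv
      rw [hmul] at hv
      obtain ⟨w, hw⟩ := h k (v ∘ q (k + 1)) (by
        ext i : 1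
        simpa using congrFun hv (q k i))
      refine ⟨w ∘ (q (k + 2)).symm, ?_⟩
      rw [hmul]
      ext i : 1
      simpa [Function.comp_def] using congrFun hw ((q (k + 1)).symm i)
    · rintro ⟨w, rfl⟩
      rw [Matrix.mulVec_mulVec, Matrix.submatrix_mul_equiv, hD]
      exact Matrix.zero_mulVec _

/-- The augmentation ideal of `ℤ[u, u⁻¹]` is generated by `1 - u`. -/
theorem exists_one_sub_mul_eq (p : MonoidAlgebra ℤ (Multiplicative ℤ))
    (hp : augmentation (Multiplicative ℤ) p = 0) :
    ∃ r, (1 - MonoidAlgebra.single (Multiplicative.ofAdd 1) 1) * r = p := by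
  set u : MonoidAlgebra ℤ (Multiplicative ℤ) := MonoidAlgebra.single (Multiplicative.ofAdd 1) 1
  have h1 : ∀ k : ℤ, (1 - u) ∣ 1 - MonoidAlgebra.single (Multiplicative.ofAdd k) 1 := by
    intro k
    induction k using Int.induction_on with
    | zero => simp [MonoidAlgebra.one_def]
    | succ k ih =>
      have : (1 : MonoidAlgebra ℤ (Multiplicative ℤ)) -
          MonoidAlgebra.single (Multiplicative.ofAdd ((k : ℤ) + 1)) 1 =
          (1 - MonoidAlgebra.single (Multiplicative.ofAdd (k : ℤ)) 1) +
            MonoidAlgebra.single (Multiplicative.ofAdd (k : ℤ)) 1 * (1 - u) := by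
        rw [mul_sub, MonoidAlgebra.single_mul_single, ← ofAdd_add]
        simp
      rw [this]
      exact dvd_add ih (dvd_mul_left _ _)
    | pred k ih =>
      have : (1 : MonoidAlgebra ℤ (Multiplicative ℤ)) -
          MonoidAlgebra.single (Multiplicative.ofAdd (-(k : ℤ) - 1)) 1 =
          (1 - MonoidAlgebra.single (Multiplicative.ofAdd (-(k : ℤ))) 1) -
            MonoidAlgebra.single (Multiplicative.ofAdd (-(k : ℤ) - 1)) 1 * (1 - u) := by
        rw [mul_sub, MonoidAlgebra.single_mul_single, ← ofAdd_add]
        simp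
      rw [this]
      exact dvd_sub ih (dvd_mul_left _ _)
  have h2 : ∀ q : MonoidAlgebra ℤ (Multiplicative ℤ),
      (1 - u) ∣ MonoidAlgebra.single 1 (augmentation _ q) - q := by
    intro q
    induction q using MonoidAlgebra.induction_linear with
    | zero => simp
    | add a b ha hb =>
      rw [map_add, MonoidAlgebra.single_add, add_sub_add_comm]
      exact dvd_add ha hb
    | single k z =>
      have : (MonoidAlgebra.single 1 (augmentation _ (MonoidAlgebra.single k z)) -
          MonoidAlgebra.single k z : MonoidAlgebra ℤ (Multiplicative ℤ)) =
          MonoidAlgebra.single 1 z * (1 - MonoidAlgebra.single k 1) := by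
        rw [augmentation_single, mul_sub, MonoidAlgebra.single_mul_single, mul_one, mul_one,
          one_mul]
      rw [this]
      exact (h1 k.toAdd).mul_left _
  obtain ⟨r, hr⟩ := h2 p
  refine ⟨-r, ?_⟩
  rw [mul_neg, ← hr, hp]
  simp

variable (ψ : G →* Multiplicative ℤ)

/-- The augmentation of the induced complex, with values in `ℤ[G / ker ψ] = ℤ[u, u⁻¹]`. -/
def indAug {J : Type} [Fintype J] (e : J → ℤ) :
    (J → MonoidAlgebra ℤ G) →+ MonoidAlgebra ℤ (Multiplicative ℤ) where
  toFun v := ∑ j, e j • ringMap ψ (v j)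
  map_zero' := by simp
  map_add' v w := by
    simp only [Pi.add_apply, map_add, smul_add, Finset.sum_add_distrib]

variable {ψ}

theorem indAug_apply {J : Type} [Fintype J] (e : J → ℤ) (v : J → MonoidAlgebra ℤ G) :
    indAug ψ e v = ∑ j, e j • ringMap ψ (v j) := rfl

theorem augmentation_indAug {J : Type} [Fintype J] (e : J → ℤ) (v : J → MonoidAlgebra ℤ G) :
    augmentation _ (indAug ψ e v) = ∑ j, e j * augmentation G (v j) := by
  rw [indAug_apply, map_sum]
  refine Finset.sum_congr rfl fun j _ => ?_
  rw [map_zsmul, augmentation_ringMap, smul_eq_mul]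

theorem ringMap_ringMap_subtype (x : MonoidAlgebra ℤ ψ.ker) :
    ringMap ψ (ringMap ψ.ker.subtype x) = MonoidAlgebra.single 1 (augmentation _ x) := by
  induction x using MonoidAlgebra.induction_linear with
  | zero => simp
  | add x y hx hy => rw [map_add, map_add, map_add, hx, hy, MonoidAlgebra.single_add]
  | single h z =>
    have : ψ (ψ.ker.subtype h) = 1 := h.2
    rw [ringMap_single, ringMap_single, augmentation_single, this]

/-- The augmentation `ℤ[ker ψ]^J → ℤ`. -/
def colAug (H : Type*) [Group H] {J : Type} [Fintype J] (e : J → ℤ) :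
    (J → MonoidAlgebra ℤ H) →+ ℤ where
  toFun v := ∑ j, e j * augmentation H (v j)
  map_zero' := by simp
  map_add' v w := by simp [mul_add, Finset.sum_add_distrib]

theorem indAug_assemble {t : G} (ht : ψ t = Multiplicative.ofAdd 1) {J : Type} [Fintype J]
    (e : J → ℤ) (c : Multiplicative ℤ →₀ (J → MonoidAlgebra ℤ ψ.ker)) :
    indAug ψ e (assemble ψ t J c) =
      MonoidAlgebra.ofCoeff (c.mapRange (colAug ψ.ker e) (map_zero _)) := by
  induction c using Finsupp.induction_linear with
  | zero => rw [map_zero, map_zero, Finsupp.mapRange_zero, MonoidAlgebra.ofCoeff_zero]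
  | add c d hc hd =>
    rw [map_add, map_add, hc, hd, Finsupp.mapRange_add (map_add _), MonoidAlgebra.ofCoeff_add]
  | single k a =>
    rw [Finsupp.mapRange_single, MonoidAlgebra.ofCoeff_single, indAug_apply]
    have h1 : ∀ j, e j • ringMap ψ (assemble ψ t J (Finsupp.single k a) j) =
        MonoidAlgebra.single k (e j * augmentation _ (a j)) := fun j => by
      rw [assemble_single, map_mul, ringMap_ringMap_subtype, ringMap_single,
        MonoidAlgebra.single_mul_single, one_mul, mul_one, map_zpow, ht, ← ofAdd_zsmul,
        smul_eq_mul, mul_one, ofAdd_toAdd, MonoidAlgebra.smul_single, smul_eq_mul]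
    rw [Finset.sum_congr rfl fun j _ => h1 j]
    exact (map_sum (MonoidAlgebra.singleAddHom k) _ _).symm

/-- Exactness of a sequence of columns over `ℤ[ker ψ]` is preserved by induction to `ℤG`. -/
theorem exists_mulVec_map_eq {t : G} (ht : ψ t = Multiplicative.ofAdd 1) {I J L : Type} [Fintype J]
    [Fintype L] {A : Matrix I J (MonoidAlgebra ℤ ψ.ker)} {B : Matrix J L (MonoidAlgebra ℤ ψ.ker)}
    (h : ∀ v, A.mulVec v = 0 → ∃ w, B.mulVec w = v) {v : J → MonoidAlgebra ℤ G}
    (hv : (A.map (ringMap ψ.ker.subtype)).mulVec v = 0) :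
    ∃ w, (B.map (ringMap ψ.ker.subtype)).mulVec w = v := by
  obtain ⟨c, rfl⟩ := assemble_surjective ht J v
  rw [mulVec_assemble] at hv
  have h0 := assemble_injective ht I (hv.trans (map_zero _).symm)
  obtain ⟨d, hd⟩ := exists_mapRange_eq (AddMonoidHom.mk' B.mulVec (Matrix.mulVec_add B)) c
    fun k => h _ (DFunLike.congr_fun h0 k)
  refine ⟨assemble ψ t L d, ?_⟩
  rw [mulVec_assemble, ← hd]
  rfl

/-- Induction also preserves exactness at the augmentation. -/
theorem exists_mulVec_map_eq_of_indAug {t : G} (ht : ψ t = Multiplicative.ofAdd 1) {J L : Type}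
    [Fintype J] [Fintype L] {e : J → ℤ} {B : Matrix J L (MonoidAlgebra ℤ ψ.ker)}
    (h : ∀ v, ∑ j, e j * augmentation ψ.ker (v j) = 0 → ∃ w, B.mulVec w = v)
    {v : J → MonoidAlgebra ℤ G} (hv : indAug ψ e v = 0) :
    ∃ w, (B.map (ringMap ψ.ker.subtype)).mulVec w = v := by
  obtain ⟨c, rfl⟩ := assemble_surjective ht J v
  rw [indAug_assemble ht, MonoidAlgebra.ofCoeff_eq_zero] at hv
  obtain ⟨d, hd⟩ := exists_mapRange_eq (AddMonoidHom.mk' B.mulVec (Matrix.mulVec_add B)) c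
    fun k => h _ (DFunLike.congr_fun hv k)
  refine ⟨assemble ψ t L d, ?_⟩
  rw [mulVec_assemble, ← hd]
  rfl

theorem indAug_surjective {t : G} (ht : ψ t = Multiplicative.ofAdd 1) {J : Type} [Fintype J]
    {e : J → ℤ}
    (h : ∀ z : ℤ, ∃ v : J → MonoidAlgebra ℤ ψ.ker, ∑ j, e j * augmentation ψ.ker (v j) = z) :
    Function.Surjective (indAug ψ e) := by
  intro p
  obtain ⟨d, hd⟩ := exists_mapRange_eq (colAug ψ.ker e) p.coeff fun k => h _
  refine ⟨assemble ψ t J d, ?_⟩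
  rw [indAug_assemble ht, hd, MonoidAlgebra.ofCoeff_coeff]

theorem indAug_mulVec {J L : Type} [Fintype J] [Fintype L] {e : J → ℤ}
    {B : Matrix J L (MonoidAlgebra ℤ ψ.ker)}
    (h : ∀ w, ∑ j, e j * augmentation ψ.ker (B.mulVec w j) = 0) (w : L → MonoidAlgebra ℤ G) :
    indAug ψ e ((B.map (ringMap ψ.ker.subtype)).mulVec w) = 0 := by
  classical
  have h1 : ∀ l, ∑ j, e j * augmentation ψ.ker (B j l) = 0 := fun l => by
    have := h (Pi.single l 1)
    simpa using this
  rw [indAug_apply]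
  have h2 : ∀ j, e j • ringMap ψ ((B.map (ringMap ψ.ker.subtype)).mulVec w j) =
      ∑ l, MonoidAlgebra.single 1 (e j * augmentation _ (B j l)) * ringMap ψ (w l) := fun j => by
    rw [Matrix.mulVec, dotProduct, map_sum, Finset.smul_sum]
    refine Finset.sum_congr rfl fun l _ => ?_
    rw [Matrix.map_apply, map_mul, ringMap_ringMap_subtype, ← smul_mul_assoc,
      MonoidAlgebra.smul_single, smul_eq_mul]
  rw [Finset.sum_congr rfl fun j _ => h2 j, Finset.sum_comm]
  refine Finset.sum_eq_zero fun l _ => ?_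
  have h3 : ∑ j, (MonoidAlgebra.single 1 (e j * augmentation _ (B j l)) :
      MonoidAlgebra ℤ (Multiplicative ℤ)) = 0 :=
    (map_sum (MonoidAlgebra.singleAddHom 1) _ _).symm.trans (by rw [h1, map_zero])
  rw [← Finset.sum_mul, h3, zero_mul]

/-- An endomorphism `f₀` in degree zero which preserves the boundaries extends to an endomorphism of
a complex of free modules which is exact in positive degrees. -/
theorem exists_chainMap {R : Type*} [Ring R] {ι : ℕ → Type} [∀ k, Fintype (ι k)]
    (D : ∀ k, Matrix (ι k) (ι (k + 1)) R) (hD : ∀ k, D k * D (k + 1) = 0)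
    (h : ∀ k v, (D k).mulVec v = 0 → ∃ w, (D (k + 1)).mulVec w = v) (f₀ : Matrix (ι 0) (ι 0) R)
    (h₀ : ∀ w, ∃ w', (D 0).mulVec w' = f₀.mulVec ((D 0).mulVec w)) :
    ∃ f : ∀ k, Matrix (ι k) (ι k) R, f 0 = f₀ ∧ ∀ k, D k * f (k + 1) = f k * D k := by
  classical
  have lift : ∀ k (g : Matrix (ι k) (ι k) R),
      (∀ w, ∃ w', (D k).mulVec w' = g.mulVec ((D k).mulVec w)) →
      ∃ g' : Matrix (ι (k + 1)) (ι (k + 1)) R, D k * g' = g * D k := by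
    intro k g hg
    choose c hc using fun j => hg (Pi.single j 1)
    refine ⟨Matrix.of fun i j => c j i, ?_⟩
    ext i j : 2
    have := congrFun (hc j) i
    rw [Matrix.mulVec_mulVec, Matrix.mulVec_single_one] at this
    exact this
  have step : ∀ k (g : Matrix (ι k) (ι k) R) (g' : Matrix (ι (k + 1)) (ι (k + 1)) R),
      D k * g' = g * D k →
      ∀ w, ∃ w', (D (k + 1)).mulVec w' = g'.mulVec ((D (k + 1)).mulVec w) := by
    intro k g g' hg w
    refine h k _ ?_
    rw [Matrix.mulVec_mulVec, Matrix.mulVec_mulVec, hg, Matrix.mul_assoc, hD, Matrix.mul_zero,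
      Matrix.zero_mulVec]
  let seq : ∀ k, {g : Matrix (ι k) (ι k) R //
      ∀ w, ∃ w', (D k).mulVec w' = g.mulVec ((D k).mulVec w)} := fun k =>
    Nat.rec ⟨f₀, h₀⟩ (fun k g =>
      ⟨(lift k g.1 g.2).choose, step k g.1 _ (lift k g.1 g.2).choose_spec⟩) k
  exact ⟨fun k => (seq k).1, rfl, fun k => (lift k (seq k).1 (seq k).2).choose_spec⟩

/-! ### The mapping cone resolution -/

/-- The index sets of the bases of the mapping cone: degree `k` is the sum of the degrees `k` and
`k - 1`. -/
abbrev ConeIdx (ι : ℕ → Type) : ℕ → Type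
  | 0 => ι 0 ⊕ Empty
  | k + 1 => ι (k + 1) ⊕ ι k

instance (ι : ℕ → Type) [∀ k, Fintype (ι k)] : ∀ k, Fintype (ConeIdx ι k)
  | 0 => inferInstanceAs (Fintype (ι 0 ⊕ Empty))
  | k + 1 => inferInstanceAs (Fintype (ι (k + 1) ⊕ ι k))

/-- The differential `(x, y) ↦ (D x + g y, -D y)` of the mapping cone of `g`. -/
def coneD {R : Type*} [Ring R] {ι : ℕ → Type} (D : ∀ k, Matrix (ι k) (ι (k + 1)) R)
    (g : ∀ k, Matrix (ι k) (ι k) R) : ∀ k, Matrix (ConeIdx ι k) (ConeIdx ι (k + 1)) R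
  | 0 => Matrix.fromBlocks (D 0) (g 0) 0 0
  | k + 1 => Matrix.fromBlocks (D (k + 1)) (g (k + 1)) 0 (-D k)

/-- The induced complex resolves `ℤ[u, u⁻¹]`, and it has an endomorphism `f` lifting the
multiplication by `u`. The mapping cone of `1 - f` is a resolution of `ℤ`, because `1 - u` is not a
zero divisor in `ℤ[u, u⁻¹]` and generates the augmentation ideal. -/
theorem exists_isResolution_of_ker (hψ : Function.Surjective ψ)
    {C : BasedComplex (MonoidAlgebra ℤ ψ.ker)} (hC : C.IsResolution) :
    ∃ C : BasedComplex (MonoidAlgebra ℤ G), C.IsResolution := by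
  classical
  obtain ⟨t, ht⟩ := hψ (Multiplicative.ofAdd 1)
  obtain ⟨⟨e, he, hC₀⟩, hCk⟩ := hC
  let ι : ℕ → Type := fun k => Fin (C.rank k)
  let D : ∀ k, Matrix (ι k) (ι (k + 1)) (MonoidAlgebra ℤ G) := fun k =>
    (C.d k (k + 1)).map (ringMap ψ.ker.subtype)
  have hD : ∀ k, D k * D (k + 1) = 0 := fun k => by
    rw [← Matrix.map_mul, C.d_comp_d, Matrix.map_zero _ (map_zero _)]
  have hex : ∀ k v, (D k).mulVec v = 0 → ∃ w, (D (k + 1)).mulVec w = v := fun k v hv =>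
    exists_mulVec_map_eq ht (fun v => (hCk k v).1) hv
  have hex₀ : ∀ v, indAug ψ e v = 0 → ∃ w, (D 0).mulVec w = v := fun v hv =>
    exists_mulVec_map_eq_of_indAug ht (fun v => (hC₀ v).1) hv
  have haD : ∀ w, indAug ψ e ((D 0).mulVec w) = 0 :=
    indAug_mulVec fun w => (hC₀ _).2 ⟨w, rfl⟩
  set u : MonoidAlgebra ℤ (Multiplicative ℤ) := MonoidAlgebra.single (Multiplicative.ofAdd 1) 1
  let f₀ : Matrix (ι 0) (ι 0) (MonoidAlgebra ℤ G) :=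
    Matrix.diagonal fun _ => MonoidAlgebra.single t 1
  have hf₀ : ∀ v, indAug ψ e (f₀.mulVec v) = u * indAug ψ e v := fun v => by
    rw [indAug_apply, indAug_apply, Finset.mul_sum]
    refine Finset.sum_congr rfl fun j _ => ?_
    rw [Matrix.mulVec_diagonal, map_mul, ringMap_single, ht, mul_smul_comm]
  obtain ⟨f, hf0, hf⟩ := exists_chainMap D hD hex f₀ fun w => hex₀ _ (by
    rw [hf₀, haD, mul_zero])
  let g : ∀ k, Matrix (ι k) (ι k) (MonoidAlgebra ℤ G) := fun k => 1 - f k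
  have hg : ∀ k, D k * g (k + 1) = g k * D k := fun k => by
    rw [Matrix.mul_sub, Matrix.sub_mul, hf, Matrix.mul_one, Matrix.one_mul]
  have hg₀ : ∀ v, indAug ψ e ((g 0).mulVec v) = (1 - u) * indAug ψ e v := fun v => by
    rw [Matrix.sub_mulVec, Matrix.one_mulVec, map_sub, hf0, hf₀, sub_mul, one_mul]
  have hu : (1 - u) ≠ 0 := fun h0 => by
    have := congrArg (fun p => p.coeff 1) h0
    simp [u, MonoidAlgebra.one_def] at this
  -- a cycle `(x, y)` of the cone is a boundary if `y` is a boundary of the induced complex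
  have key : ∀ k (x : ι (k + 1) → MonoidAlgebra ℤ G) (y : ι k → MonoidAlgebra ℤ G),
      (D k).mulVec x + (g k).mulVec y = 0 → (∃ z, (D k).mulVec z = y) →
      ∃ a b, (D (k + 1)).mulVec a + (g (k + 1)).mulVec b = x ∧ -(D k).mulVec b = y := by
    rintro k x _ h1 ⟨z, rfl⟩
    obtain ⟨a, ha⟩ := hex k (x + (g (k + 1)).mulVec z) (by
      rw [Matrix.mulVec_add, Matrix.mulVec_mulVec, hg, ← Matrix.mulVec_mulVec]
      exact h1)
    refine ⟨a, -z, ?_, ?_⟩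
    · rw [ha, Matrix.mulVec_neg, add_neg_cancel_right]
    · rw [Matrix.mulVec_neg, neg_neg]
  refine exists_isResolution_of_fintype (ι := ConeIdx ι) ?_ (coneD D g) ?_
    (Sum.elim e Empty.elim) ?_ ?_ ?_
  · obtain ⟨N, hN⟩ := C.finite
    refine ⟨N + 1, fun k hk => ?_⟩
    obtain ⟨k, rfl⟩ : ∃ l, k = l + 1 := ⟨k - 1, by omega⟩
    have h1 : IsEmpty (ι (k + 1)) := by
      simp only [ι, hN (k + 1) (by omega)]
      infer_instance
    have h2 : IsEmpty (ι k) := by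
      simp only [ι, hN k (by omega)]
      infer_instance
    exact inferInstanceAs (IsEmpty (ι (k + 1) ⊕ ι k))
  · intro k
    cases k with
    | zero =>
      refine (Matrix.fromBlocks_multiply ..).trans ?_
      rw [hD, hg]
      simp
    | succ k =>
      refine (Matrix.fromBlocks_multiply ..).trans ?_
      rw [hD, hg]
      simp [hD]
  · intro z
    obtain ⟨v, hv⟩ := he z
    refine ⟨Sum.elim (fun i => ringMap ψ.ker.subtype (v i)) Empty.elim, ?_⟩
    refine (Fintype.sum_sum_type _).trans ?_
    simp only [Sum.elim_inl, augmentation_ringMap, Finset.univ_eq_empty, Finset.sum_empty,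
      add_zero]
    exact hv
  · intro v
    obtain ⟨x, rfl⟩ : ∃ x : ι 0 → MonoidAlgebra ℤ G, v = Sum.elim x Empty.elim :=
      ⟨v ∘ Sum.inl, funext fun i => by
        rcases i with i | i
        · rfl
        · exact i.elim⟩
    have h1 : ∑ i, (Sum.elim e Empty.elim : ConeIdx ι 0 → ℤ) i *
        augmentation G ((Sum.elim x Empty.elim : ConeIdx ι 0 → MonoidAlgebra ℤ G) i) =
        augmentation _ (indAug ψ e x) := by
      rw [augmentation_indAug]
      refine (Fintype.sum_sum_type _).trans ?_
      simp only [Sum.elim_inl, Finset.univ_eq_empty, Finset.sum_empty, add_zero]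
      rfl
    rw [h1]
    constructor
    · intro hx
      obtain ⟨p, hp⟩ := exists_one_sub_mul_eq _ hx
      obtain ⟨y, rfl⟩ := indAug_surjective ht he p
      obtain ⟨z, hz⟩ := hex₀ (x - (g 0).mulVec y) (by rw [map_sub, hg₀, hp, sub_self])
      refine ⟨Sum.elim z y, (Matrix.fromBlocks_mulVec ..).trans ?_⟩
      ext (i | i) : 1
      · simp [hz]
      · exact i.elim
    · rintro ⟨w, hw⟩
      have h2 : x = (D 0).mulVec (w ∘ Sum.inl) + (g 0).mulVec (w ∘ Sum.inr) := by
        ext i : 1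
        exact (congrFun (hw.symm.trans (Matrix.fromBlocks_mulVec ..)) (Sum.inl i))
      rw [h2, map_add, haD, hg₀, zero_add, map_mul, map_sub, map_one, augmentation_single, sub_self,
        zero_mul]
  · intro k v hv
    cases k with
    | zero =>
      have h1 : (D 0).mulVec (v ∘ Sum.inl) + (g 0).mulVec (v ∘ Sum.inr) = 0 := by
        ext i : 1
        exact (congrFun ((Matrix.fromBlocks_mulVec ..).symm.trans hv) (Sum.inl i))
      obtain ⟨a, b, ha, hb⟩ := key 0 _ _ h1 (hex₀ _ (by
        have h2 := congrArg (indAug ψ e) h1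
        rw [map_add, haD, hg₀, zero_add, map_zero] at h2
        exact (mul_eq_zero.1 h2).resolve_left hu))
      refine ⟨Sum.elim a b, (Matrix.fromBlocks_mulVec ..).trans ?_⟩
      ext (i | i) : 1
      · simpa using congrFun ha i
      · simpa [Matrix.neg_mulVec] using congrFun hb i
    | succ k =>
      have h0 := (Matrix.fromBlocks_mulVec ..).symm.trans hv
      have h1 : (D (k + 1)).mulVec (v ∘ Sum.inl) + (g (k + 1)).mulVec (v ∘ Sum.inr) = 0 := by
        ext i : 1
        exact congrFun h0 (Sum.inl i)
      have h2 : (D k).mulVec (v ∘ Sum.inr) = 0 := by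
        ext i : 1
        have := congrFun h0 (Sum.inr i)
        simpa [Matrix.neg_mulVec] using this
      obtain ⟨a, b, ha, hb⟩ := key (k + 1) _ _ h1 (hex k _ h2)
      refine ⟨Sum.elim a b, (Matrix.fromBlocks_mulVec ..).trans ?_⟩
      ext (i | i) : 1
      · simpa using congrFun ha i
      · simpa [Matrix.neg_mulVec] using congrFun hb i

theorem isTypeF_of_isTypeFByInfiniteCyclic (hG : IsTypeFByInfiniteCyclic G) : IsTypeF G := by
  obtain ⟨ψ, hψ, hfp, C, hC⟩ := exists_character_of_isTypeFByInfiniteCyclic hG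
  exact ⟨isFinitelyPresented_of_ker hψ hfp, exists_isResolution_of_ker hψ hC⟩

end Induction

end Agrarian

end

theorem mainTheorem6 {G : Type u} [Group G] (hG : Agrarian.IsTypeFByInfiniteCyclic G)
    (φ : G →* Multiplicative ℤ) (hφ : Agrarian.IsPrimitive φ)
    {D : Type v} [DivisionRing D] (n : ℕ) (σ : G →* Matrix.GeneralLinearGroup (Fin n) D) :
    Agrarian.AgrarianNormDefined σ φ ∧
    Agrarian.EulerCharDefined (Agrarian.twistRestrict σ φ.ker) ∧
    Agrarian.agrarianNorm σ φ =
      -(Agrarian.eulerChar (Agrarian.twistRestrict σ φ.ker) : ℝ) := by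
  have hs := Agrarian.surjective_of_isPrimitive hφ
  have hF := Agrarian.isTypeF_of_isTypeFByInfiniteCyclic hG
  have hex : ∀ C : Agrarian.BasedComplex (MonoidAlgebra ℤ G), C.IsResolution →
      ∃ τ, C.IsTorsion (Agrarian.twistRing σ) τ := fun C hC => by
    obtain ⟨γ, hγ⟩ := (Agrarian.exact_twistRing hG σ hC).exists_contraction
    obtain ⟨m, ⟨o⟩, ⟨e⟩⟩ := Agrarian.BasedComplex.exists_orderings hγ
    exact ⟨_, γ, hγ, m, o, e, rfl⟩
  obtain ⟨-, C, hC⟩ := id hF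
  obtain ⟨τ, hτ⟩ := hex C hC
  obtain ⟨P, hP⟩ := Agrarian.exists_isPolytope_of_isTorsion σ hτ
  have hnorm : Agrarian.IsAgrarianNorm σ φ (Agrarian.width (Agrarian.FreeAb.lift φ) P) :=
    ⟨C, hC, τ, P, hτ, hP, rfl⟩
  have hval : ∀ x, Agrarian.IsAgrarianNorm σ φ x →
      x = -(Agrarian.eulerChar (Agrarian.twistRestrict σ φ.ker) : ℝ) := by
    rintro x ⟨C', hC', hx⟩
    exact Agrarian.width_eq_neg_eulerChar σ hs hC' hx
  refine ⟨⟨hF, fun C' hC' => ⟨(Agrarian.exact_twistRing hG σ hC').acyclic, hex C' hC',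
    fun _ h => Agrarian.exists_isPolytope_of_isTorsion σ h⟩, _, hnorm, fun y hy => ?_⟩,
    Agrarian.eulerCharDefined σ hs hC (Agrarian.exact_twistRing hG σ hC),
    hval _ (Classical.epsilon_spec (p := Agrarian.IsAgrarianNorm σ φ) ⟨_, hnorm⟩)⟩
  rw [hval y hy, hval _ hnorm]
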